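/- **Proposition 3.3.** Let $(M^4,g)$ be a smooth closed (i.e. compact, without boundary) Riemannian 4-manifold. Let $R_{ijkl}$ be the curvature tensor, with the sign for which $R_{ijij}>0$ on round spheres, $R_{jl}=g^{ik}R_{ijkl}$ the Ricci tensor, $R$ the scalar curvature, $E=\mathrm{Ric}-\frac14 Rg$ the trace-free Ricci tensor, and let $W$ be the Weyl tensor, defined by $$R_{ijkl}=W_{ijkl}+\tfrac12\,(E_{ik}g_{jl}+E_{jl}g_{ik}-E_{il}g_{jk}-E_{jk}g_{il})+\tfrac1{12}R\,(g_{ik}g_{jl}-g_{il}g_{jk}).$$ Suppose that $g$ is Bach-flat, i.e. that the Bach tensor $B_{ij}=\nabla^k\nabla^lW_{kijl}+\frac12R^{kl}W_{kijl}$ vanishes identically. Then $$\int_M|\nabla W|^2\,dvol=\int_M\Big\{72\det W^++72\det W^--\tfrac12R\,|W|^2+2\,W_{ijkl}E_{ik}E_{jl}\Big\}\,dvol .$$ Here $|W|^2=W_{ijkl}W^{ijkl}$ and $|\nabla W|^2=\nabla_mW_{ijkl}\nabla^mW^{ijkl}$, the indices of $E$ in the last term are contracted with those of $W$ by means of $g$,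 and $W^\pm:\Lambda^2_\pm\to\Lambda^2_\pm$ is the restriction of the endomorphism $(W\omega)_{ij}=\frac12W_{ij}{}^{kl}\omega_{kl}$ of $\Lambda^2$ to the self-dual, respectively anti-self-dual, 2-forms with respect to an orientation of the tangent space. The sum $\det W^++\det W^-$ does not depend on that orientation, so $M$ need not be orientable. -/

import Mathlib

open scoped Manifold ContDiff
open MeasureTheory

noncomputable section

namespace BachFlat

/-- The model space `ℝ⁴`. -/
abbrev E4 : Type := EuclideanSpace ℝ (Fin 4)

/-! ### Riemannian geometry in a coordinate system

A metric in a coordinate system is a matrix-valued function `G` on `ℝ⁴`, `G y i j = g_{ij}(y)`;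
the formulas below are local and are used on the open image of a chart. -/

/-- A covariant tensor field of rank `k` in coordinates: `T y I` is the component of `T` at `y`
with the indices `I 0, …, I (k-1)`. -/
abbrev TensorField (k : ℕ) : Type := E4 → (Fin k → Fin 4) → ℝ

/-- A metric in coordinates. -/
abbrev LocalMetric : Type := E4 → Matrix (Fin 4) (Fin 4) ℝ

/-- The coordinate vector `e_i` of `ℝ⁴`. -/
def basisVec (i : Fin 4) : E4 := EuclideanSpace.single i 1

/-- The partial derivative `∂_i f (y)`. -/
def pderiv (i : Fin 4) (f : E4 → ℝ) (y : E4) : ℝ := fderiv ℝ f y (basisVec i)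

variable (G : LocalMetric)

/-- Christoffel symbols
`Γ^k_{ij} = ½ g^{kl} (∂_i g_{jl} + ∂_j g_{il} - ∂_l g_{ij})` of the Levi-Civita connection. -/
def christoffel (y : E4) (k i j : Fin 4) : ℝ :=
  (1 / 2) * ∑ l, (G y)⁻¹ k l *
    (pderiv i (fun z => G z j l) y + pderiv j (fun z => G z i l) y
      - pderiv l (fun z => G z i j) y)

/-- The covariant derivative `(∇T)_{m i₁ … i_k} = ∇_m T_{i₁ … i_k}`; the index of
differentiation comes first. -/
def covDeriv {k : ℕ} (T : TensorField k) : TensorField (k + 1) := fun y I =>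
  pderiv (I 0) (fun z => T z (Fin.tail I)) y
    - ∑ a : Fin k, ∑ s, christoffel G y s (I 0) (I a.succ) * T y (Function.update (Fin.tail I) a s)

/-- The components `ρ^l` of `R(∂_i, ∂_j) ∂_k = ρ^l ∂_l`, where
`R(X, Y) = ∇_X ∇_Y - ∇_Y ∇_X - ∇_{[X, Y]}`. -/
def curv (y : E4) (l k i j : Fin 4) : ℝ :=
  pderiv i (fun z => christoffel G z l j k) y - pderiv j (fun z => christoffel G z l i k) y
    + ∑ s, (christoffel G y l i s * christoffel G y s j k
      - christoffel G y l j s * christoffel G y s i k)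

/-- The curvature tensor `R_{ijkl} = g(R(∂_i, ∂_j) ∂_l, ∂_k)`, so that `R_{ijij} > 0` on round
spheres. -/
def riem (y : E4) (i j k l : Fin 4) : ℝ := ∑ s, G y k s * curv G y s l i j

/-- The Ricci tensor `R_{jl} = g^{ik} R_{ijkl}`. -/
def ric (y : E4) (j l : Fin 4) : ℝ := ∑ i, ∑ k, (G y)⁻¹ i k * riem G y i j k l

/-- The scalar curvature `R = g^{jl} R_{jl}`. -/
def scal (y : E4) : ℝ := ∑ j, ∑ l, (G y)⁻¹ j l * ric G y j l

/-- The trace-free Ricci tensor `E = Ric - ¼ R g`. -/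
def tracefreeRic (y : E4) (i j : Fin 4) : ℝ := ric G y i j - (1 / 4) * scal G y * G y i j

/-- The Kulkarni-Nomizu product of two symmetric 2-tensors. -/
def kulkarniNomizu (h k : Fin 4 → Fin 4 → ℝ) (i j m n : Fin 4) : ℝ :=
  h i m * k j n + h j n * k i m - h i n * k j m - h j m * k i n

/-- The Weyl tensor, defined by `Riem = W + ½ E ∧ g + (1/24) R g ∧ g`, where `∧` is the
Kulkarni-Nomizu product. -/
def weyl : TensorField 4 := fun y I =>
  riem G y (I 0) (I 1) (I 2) (I 3)
    - (1 / 2) * kulkarniNomizu (tracefreeRic G y) (G y) (I 0) (I 1) (I 2) (I 3)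
    - (1 / 24) * scal G y * kulkarniNomizu (G y) (G y) (I 0) (I 1) (I 2) (I 3)

/-- The Bach tensor `B_{ij} = ∇^k ∇^l W_{kijl} + ½ R^{kl} W_{kijl}`. -/
def bach (y : E4) (i j : Fin 4) : ℝ :=
  (∑ k, ∑ l, ∑ a, ∑ b, (G y)⁻¹ k a * (G y)⁻¹ l b *
      covDeriv G (covDeriv G (weyl G)) y ![a, b, k, i, j, l])
    + (1 / 2) * ∑ k, ∑ l, ∑ a, ∑ b, (G y)⁻¹ k a * (G y)⁻¹ l b * ric G y a b *
      weyl G y ![k, i, j, l]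

/-- The squared norm `T_{i₁ … i_k} T^{i₁ … i_k}` of a covariant tensor. -/
def normSq {k : ℕ} (T : TensorField k) (y : E4) : ℝ :=
  ∑ I : Fin k → Fin 4, ∑ J : Fin k → Fin 4, (∏ a, (G y)⁻¹ (I a) (J a)) * T y I * T y J

/-- The scalar `W_{ijkl} E_{ik} E_{jl}`, the indices of `E` being raised with the metric. -/
def weylRicRic (y : E4) : ℝ :=
  ∑ i, ∑ j, ∑ k, ∑ l, ∑ a, ∑ b, ∑ c, ∑ d,
    weyl G y ![i, j, k, l] * ((G y)⁻¹ i a * (G y)⁻¹ k b * tracefreeRic G y a b)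
      * ((G y)⁻¹ j c * (G y)⁻¹ l d * tracefreeRic G y c d)

/-! ### 2-forms, the Hodge star and the determinants of `W^±` -/

/-- The space `Λ²` of 2-forms at a point, given by their skew-symmetric components `ω_{ij}`. -/
def twoForms : Submodule ℝ (Matrix (Fin 4) (Fin 4) ℝ) where
  carrier := {θ | ∀ i j, θ i j = -θ j i}
  add_mem' := by
    intro a b ha hb i j
    simp only [Matrix.add_apply]
    rw [ha i j, hb i j]
    ring
  zero_mem' := by
    intro i j
    simp
  smul_mem' := by
    intro c a ha i j
    simp only [Matrix.smul_apply, smul_eq_mul]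
    rw [ha i j]
    ring

/-- A tensor `Z_{ijkl}`, skew in `i, j`, acts on 2-forms at a point with metric matrix `A` by
`(Z ω)_{ij} = ½ Z_{ij}^{kl} ω_{kl}`. -/
def formOp (A : Matrix (Fin 4) (Fin 4) ℝ) (Z : Fin 4 → Fin 4 → Fin 4 → Fin 4 → ℝ)
    (hZ : ∀ i j k l, Z i j k l = -Z j i k l) : twoForms →ₗ[ℝ] twoForms where
  toFun θ := ⟨Matrix.of fun i j =>
      (1 / 2) * ∑ k, ∑ l, Z i j k l * (A⁻¹ * θ.1 * (A⁻¹).transpose) k l, by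
    intro i j
    simp only [Matrix.of_apply, hZ i j, neg_mul, Finset.sum_neg_distrib, mul_neg]⟩
  map_add' θ η := by
    ext i j
    simp only [Submodule.coe_add, Matrix.add_mul, Matrix.add_apply,
      Matrix.of_apply, mul_add, Finset.sum_add_distrib]
  map_smul' c θ := by
    ext i j
    simp only [Submodule.coe_smul, Matrix.mul_smul, Matrix.smul_mul, Matrix.smul_apply,
      Matrix.of_apply, smul_eq_mul, RingHom.id_apply, Finset.mul_sum]
    refine Finset.sum_congr rfl fun k _ => Finset.sum_congr rfl fun l _ => ?_
    ring

/-- The Levi-Civita symbol `ε_{ijkl}`: the sign of `(i, j, k, l)` if this is a permutation of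
the four indices, and `0` otherwise. -/
def leviCivita (i j k l : Fin 4) : ℝ :=
  ((1 : Matrix (Fin 4) (Fin 4) ℝ).submatrix ![i, j, k, l] id).det

theorem leviCivita_swap (i j k l : Fin 4) : leviCivita i j k l = -leviCivita j i k l := by
  have h : (1 : Matrix (Fin 4) (Fin 4) ℝ).submatrix ![i, j, k, l] id
      = ((1 : Matrix (Fin 4) (Fin 4) ℝ).submatrix ![j, i, k, l] id).submatrix
        (Equiv.swap (0 : Fin 4) 1) id := by
    ext a b
    fin_cases a <;> rfl
  unfold leviCivita
  rw [h, Matrix.det_permute]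
  simp

/-- The Hodge star `(⋆ω)_{ij} = ½ s √(det A) ε_{ijkl} ω^{kl}` on 2-forms at a point with metric
matrix `A`. The sign `s` is `1` if the coordinates are positively oriented and `-1` if they are
negatively oriented. -/
def hodgeStar (A : Matrix (Fin 4) (Fin 4) ℝ) (s : ℝ) : twoForms →ₗ[ℝ] twoForms :=
  formOp A (fun i j k l => s * √A.det * leviCivita i j k l)
    (fun i j k l => by rw [leviCivita_swap i j k l, mul_neg])

/-- The projection `½ (1 + ⋆)` of `Λ²` onto the self-dual 2-forms. -/
def sdProj (A : Matrix (Fin 4) (Fin 4) ℝ) (s : ℝ) : twoForms →ₗ[ℝ] twoForms :=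
  (1 / 2 : ℝ) • (LinearMap.id + hodgeStar A s)

/-- The space `Λ²₊` of self-dual 2-forms for the orientation given by the sign `s`; reversing
the sign gives `Λ²₋`. -/
def selfDual (A : Matrix (Fin 4) (Fin 4) ℝ) (s : ℝ) : Submodule ℝ twoForms :=
  LinearMap.range (sdProj A s)

theorem curv_swap (y : E4) (l k i j : Fin 4) : curv G y l k i j = -curv G y l k j i := by
  unfold curv
  simp only [Finset.sum_sub_distrib]
  ring

theorem weyl_swap (y : E4) (i j k l : Fin 4) :
    weyl G y ![i, j, k, l] = -weyl G y ![j, i, k, l] := by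
  have h : riem G y i j k l = -riem G y j i k l := by
    unfold riem
    rw [← Finset.sum_neg_distrib]
    refine Finset.sum_congr rfl fun s _ => ?_
    rw [curv_swap G y s l i j, mul_neg]
  simp only [weyl, kulkarniNomizu, Matrix.cons_val]
  rw [h]
  ring

/-- The Weyl tensor as an endomorphism of `Λ²`, `(W ω)_{ij} = ½ W_{ij}^{kl} ω_{kl}`. -/
def weylOp (y : E4) : twoForms →ₗ[ℝ] twoForms :=
  formOp (G y) (fun i j k l => weyl G y ![i, j, k, l]) (weyl_swap G y)

/-- The self-dual Weyl curvature `W⁺ : Λ²₊ → Λ²₊`, the diagonal block of `W` on `Λ²₊` in the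
splitting `Λ² = Λ²₊ ⊕ Λ²₋` (which `W` preserves), for the orientation given by the sign `s`;
reversing the sign gives `W⁻ : Λ²₋ → Λ²₋`. -/
def weylPlus (s : ℝ) (y : E4) : selfDual (G y) s →ₗ[ℝ] selfDual (G y) s :=
  (sdProj (G y) s).rangeRestrict ∘ₗ weylOp G y ∘ₗ (selfDual (G y) s).subtype

/-! ### Riemannian 4-manifolds -/

section Manifold

variable {M : Type*} [TopologicalSpace M] [ChartedSpace E4 M] [IsManifold 𝓘(ℝ, E4) ∞ M]

variable (M) in
/-- A smooth Riemannian metric on `M`. -/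
abbrev Metric : Type _ :=
  Bundle.ContMDiffRiemannianMetric 𝓘(ℝ, E4) ∞ E4 (fun x : M => TangentSpace 𝓘(ℝ, E4) x)

variable (M) in
/-- A choice of an orientation of every tangent space. -/
abbrev PointwiseOrientation : Type _ :=
  ∀ q : M, Orientation ℝ (TangentSpace 𝓘(ℝ, E4) q) (Fin 4)

/-- The coordinate vector field `∂_i` of the chart `e`, at the point with coordinates `y`. -/
def coordVec (e : OpenPartialHomeomorph M E4) (y : E4) (i : Fin 4) :
    TangentSpace 𝓘(ℝ, E4) (e.symm y) :=
  mfderiv 𝓘(ℝ, E4) 𝓘(ℝ, E4) e.symm y (basisVec i)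

/-- The components `g_{ij} = g(∂_i, ∂_j)` of the metric in the chart `e`. -/
def metricIn (g : Metric M) (e : OpenPartialHomeomorph M E4) : LocalMetric := fun y =>
  Matrix.of fun i j => g.inner (e.symm y) (coordVec e y i) (coordVec e y j)

/-- The metric is Bach-flat: its Bach tensor vanishes identically. -/
def IsBachFlat (g : Metric M) : Prop :=
  ∀ e ∈ atlas E4 M, ∀ y ∈ e.target, ∀ i j, bach (metricIn g e) y i j = 0

/-- The squared norm `|∇W|²` at `q`. -/
def normSqCovDerivWeyl (g : Metric M) (q : M) : ℝ :=
  normSq (metricIn g (chartAt E4 q))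
    (covDeriv (metricIn g (chartAt E4 q)) (weyl (metricIn g (chartAt E4 q)))) (chartAt E4 q q)

/-- The squared norm `|W|² = W_{ijkl} W^{ijkl}` at `q`. -/
def normSqWeyl (g : Metric M) (q : M) : ℝ :=
  normSq (metricIn g (chartAt E4 q)) (weyl (metricIn g (chartAt E4 q))) (chartAt E4 q q)

/-- The scalar curvature at `q`. -/
def scalarCurvature (g : Metric M) (q : M) : ℝ :=
  scal (metricIn g (chartAt E4 q)) (chartAt E4 q q)

/-- The scalar `W_{ijkl} E_{ik} E_{jl}` at `q`. -/
def weylEE (g : Metric M) (q : M) : ℝ :=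
  weylRicRic (metricIn g (chartAt E4 q)) (chartAt E4 q q)

/-- The sign of the coordinate frame `(∂₁, …, ∂₄)` at `q` of the chart at `q`, with respect to
the orientation `o q` of the tangent space at `q`. -/
def frameSign (o : PointwiseOrientation M) (q : M) : ℝ :=
  Real.sign ((o q).someVector fun i => (coordVec (chartAt E4 q) (chartAt E4 q q) i : E4))

/-- The determinant of the endomorphism `W⁺` of the self-dual 2-forms at `q`. -/
def detWeylPlus (g : Metric M) (o : PointwiseOrientation M) (q : M) : ℝ :=
  LinearMap.det (M := selfDual (metricIn g (chartAt E4 q) (chartAt E4 q q)) _)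
    (weylPlus (metricIn g (chartAt E4 q)) (frameSign o q) (chartAt E4 q q))

/-- The determinant of the endomorphism `W⁻` of the anti-self-dual 2-forms at `q`. -/
def detWeylMinus (g : Metric M) (o : PointwiseOrientation M) (q : M) : ℝ :=
  LinearMap.det (M := selfDual (metricIn g (chartAt E4 q) (chartAt E4 q q)) _)
    (weylPlus (metricIn g (chartAt E4 q)) (-frameSign o q) (chartAt E4 q q))

variable [MeasurableSpace M]

/-- The measure `√(det g_{ij}) dy` on the domain of the chart `e`, extended by zero to `M`. -/
def chartVolume (g : Metric M) (e : OpenPartialHomeomorph M E4) : Measure M :=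
  ((volume.restrict e.target).withDensity
    fun y => ENNReal.ofReal √(metricIn g e y).det).map e.symm

/-- The Riemannian volume measure `dvol`: the least measure that dominates the measures
`√(det g_{ij}) dy` of all charts. These agree on overlaps, so on the domain of each chart of a
second countable manifold it equals the measure of the chart. -/
def riemannianVolume (g : Metric M) : Measure M := ⨆ e : atlas E4 M, chartVolume g e.1

end Manifold

end BachFlat

end

noncomputable section

namespace BachFlat

/-! The theorem is the integral of a pointwise identity that holds for every metric, Bach-flat or
not: |∇W|² = 3 W_{ij}^{kl} W_{kl}^{mn} W_{mn}^{ij} − ½ R|W|² + 2 W(E,E) + div X + 4⟨B,E⟩, where X_m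
= 2 W^{ijkl} ∇_i W_{mjkl} − 2 W_m^{jkl} ∇^i W_{ijkl} − 4 E^{ij} ∇^l W_{mijl}
(`IsMetricOn.divergence_identity`). Bach-flatness removes ⟨B,E⟩, the divergence theorem removes div
X, and the cubic term equals 72 det W⁺ + 72 det W⁻.

The identity rests on four facts. The second Bianchi identity gives |∇W|² = 2 ∇_m W_{ijkl} ∇_i
W_{mjkl} + 2|div W|² (`IsCurvatureDerivative.normSq_weyl`). The product ∇_m W_{ijkl} ∇_i W_{mjkl}
differs from |div W|² by a divergence and the commutator W·[∇_m, ∇_i]W; by the Ricci identity the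
commutator is algebraic in the curvature, and two identities special to dimension four reduce it to
W³ and R|W|² (`IsWeyl.weitzenbock`). Since div W is the Cotton tensor, ∇_k E_{ij} ∇_l W_{kijl} =
−|div W|² (`IsCurvatureDerivative.ric_weyl`), so the remaining |div W|² terms form a divergence up
to E^{ij} ∇^k ∇^l W_{kijl}. That last term is ⟨B,E⟩ + ½ W(E,E) by the definition of B.

Such identities are checked only where the metric is the identity to first order. All tensors
involved are `Natural`: smooth in the metric and compatible with pull-back. A quadratic coordinate
change makes any metric normal at a given point (`exists_isNormal`), and a natural tensor that
vanishes there vanishes everywhere (`Natural.eq_zero`). Naturality also makes the scalars on the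
manifold independent of the chart, hence continuous and integrable.

For the determinants, W^± are trace-free 3×3 blocks, for which tr A³ = 3 det A, and the full cubic
contraction is 8 times the trace of W³ on Λ²; hence 3·8·3 = 72. The proof expresses everything
through the ten independent components of a Weyl tensor.

The divergence theorem comes from √g div X = ∂_k(√g X^k) in a chart, a partition of unity, and the
fact that the Riemannian measure restricts to √g dy on each chart. -/

/-! ### Algebra behind the transformation laws of connection and curvature -/

/-- The Koszul combination of the first derivatives of h = JᵀgJ, given by `hdh` through the product
and chain rules. With dJ symmetric in its lower indices, the derivatives of J collapse to a single
term. -/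
theorem christoffelTransform_algebra (J : Fin 4 → Fin 4 → ℝ) (dJ : Fin 4 → Fin 4 → Fin 4 → ℝ)
    (g : Fin 4 → Fin 4 → ℝ) (dg : Fin 4 → Fin 4 → Fin 4 → ℝ)
    (hdJ : ∀ i a j, dJ i a j = dJ j a i) (hg : ∀ a b, g a b = g b a)
    (hdg : ∀ c a b, dg c a b = dg c b a) (Γ : Fin 4 → Fin 4 → Fin 4 → ℝ)
    (hΓ : ∀ a b c, ∑ s, g a s * Γ s b c = 1 / 2 * (dg b c a + dg c b a - dg a b c))
    (dh : Fin 4 → Fin 4 → Fin 4 → ℝ)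
    (hdh : ∀ k i j, dh k i j = ∑ a, ∑ b, (dJ k a i * J b j * g a b + J a i * dJ k b j * g a b
      + J a i * J b j * ∑ c, J c k * dg c a b)) (l i j : Fin 4) :
    1 / 2 * (dh i j l + dh j i l - dh l i j) = ∑ a, ∑ c, J a l * g a c *
      (dJ i c j + ∑ d, ∑ e, Γ c d e * J d i * J e j) := by
  have e1 : ∑ a, ∑ c, J a l * g a c * (dJ i c j + ∑ d, ∑ e, Γ c d e * J d i * J e j)
     = ∑ a, ∑ c, J a l * g a c * dJ i c j
      + ∑ a, ∑ d, ∑ e, J a l * J d i * J e j * (1 / 2 * (dg d e a + dg e d a - dg a d e)) := by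
    simp only [← hΓ, mul_add, Finset.sum_add_distrib]
    congr 1
    refine Finset.sum_congr rfl fun a _ => ?_
    simp only [Finset.mul_sum]
    rw [Finset.sum_comm]
    refine Finset.sum_congr rfl fun d _ => ?_
    rw [Finset.sum_comm]
    refine Finset.sum_congr rfl fun e _ => Finset.sum_congr rfl fun c _ => ?_
    ring
  rw [e1]
  -- The symmetries are built in by replacing each array by its symmetrization; what remains is an
  -- unconditional polynomial identity.
  have s1 : dJ = fun i a j => (dJ i a j + dJ j a i) / 2 := by
    funext i a j; rw [hdJ j a i]; ring
  have s2 : g = fun a b => (g a b + g b a) / 2 := by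
    funext a b; rw [hg b a]; ring
  have s3 : dg = fun c a b => (dg c a b + dg c b a) / 2 := by
    funext c a b; rw [hdg c b a]; ring
  simp only [hdh]
  generalize dJ = p at *
  rw [s1, s2, s3]
  simp only [Fin.sum_univ_four]
  ring

/-- `h2` is the equality of mixed second derivatives of the Jacobian, each computed by
differentiating the Christoffel law `hdJ` once more. Substituting `hdJ` into this integrability
condition leaves exactly the transformation law of curvature. -/
theorem curvTransform_algebra (J : Fin 4 → Fin 4 → ℝ) (A B : Fin 4 → Fin 4 → Fin 4 → ℝ)
    (dA dB : Fin 4 → Fin 4 → Fin 4 → Fin 4 → ℝ) (dJ : Fin 4 → Fin 4 → Fin 4 → ℝ)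
    (hA : ∀ s i j, A s i j = A s j i) (hB : ∀ s i j, B s i j = B s j i)
    (hdJ : ∀ k b j, dJ k b j = ∑ s, J b s * A s k j - ∑ d, ∑ e, B b d e * J d k * J e j)
    (h2 : ∀ k i j c,
      ∑ s, (dA k s i j * J c s + A s i j * dJ k c s) - ∑ a, ∑ b, ((∑ d, dB d c a b * J d k) * J a i * J b j
        + B c a b * (dJ k a i * J b j + J a i * dJ k b j))
      = ∑ s, (dA i s k j * J c s + A s k j * dJ i c s) - ∑ a, ∑ b, ((∑ d, dB d c a b * J d i) * J a k * J b j
        + B c a b * (dJ i a k * J b j + J a k * dJ i b j))) (c k i j : Fin 4) :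
    ∑ s, J c s * (dA i s j k - dA j s i k + ∑ t, (A s i t * A t j k - A s j t * A t i k))
      = ∑ a, ∑ b, ∑ d, J a k * J b i * J d j *
        (dB b c d a - dB d c b a + ∑ t, (B c b t * B t d a - B c d t * B t b a)) := by
  have hQ : ∀ k i j, dJ k i j = dJ j i k := fun k b j => by
    rw [hdJ, hdJ]
    congr 1
    · simp only [hA _ k j]
    · rw [Finset.sum_comm]
      simp only [hB b]
      exact Finset.sum_congr rfl fun _ _ => Finset.sum_congr rfl fun _ _ => by ring
  -- Eliminates the derivatives of J by the Christoffel law. The two mixed A·B sums are exchanged by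
  -- i ↔ j, so they drop out of the difference.
  have key : ∀ i j, ∑ s, A s j k * dJ i c s - ∑ a, ∑ b, B c a b * (J a j * dJ i b k)
      = ∑ s, J c s * ∑ t, A s i t * A t j k
        - ∑ s, ∑ d, ∑ e, A s j k * B c d e * J d i * J e s
        - ∑ s, ∑ d, ∑ e, A s i k * B c d e * J d j * J e s
        + ∑ a, ∑ b, ∑ d, J a k * J b i * J d j * ∑ t, B c d t * B t b a := by
    intro i j
    simp only [hdJ, Fin.sum_univ_four]
    ring
  have e1 : ∀ i j, ∑ s, (dA i s j k * J c s + A s j k * dJ i c s)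
      - ∑ a, ∑ b, ((∑ d, dB d c a b * J d i) * J a j * J b k
        + B c a b * (dJ i a j * J b k + J a j * dJ i b k))
      = ∑ s, J c s * dA i s j k + (∑ s, A s j k * dJ i c s - ∑ a, ∑ b, B c a b * (J a j * dJ i b k))
        - ∑ a, ∑ b, ∑ d, J a k * J b i * J d j * dB b c d a
        - ∑ a, ∑ b, B c a b * dJ i a j * J b k := by
    intro i j
    have e : ∑ a, ∑ b, ∑ d, J a k * J b i * J d j * dB b c d a
        = ∑ a, ∑ b, (∑ d, dB d c a b * J d i) * J a j * J b k := by
      simp only [Finset.sum_mul]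
      rw [Finset.sum_congr rfl fun a _ => Finset.sum_comm, Finset.sum_comm]
      refine Finset.sum_congr rfl fun a _ => Finset.sum_congr rfl fun b _ =>
        Finset.sum_congr rfl fun d _ => by ring
    rw [e]
    simp only [mul_add, Finset.sum_add_distrib, ← mul_assoc, mul_comm (J c _)]
    ring
  have h := h2 i j k c
  rw [e1 i j, e1 j i, key i j, key j i] at h
  -- By the symmetry of dJ, the remaining sums B·dJ·J now coincide on the two sides.
  simp only [hQ j _ i] at h
  have e3 : ∑ a, ∑ b, ∑ d, J a k * J b j * J d i * dB b c d a = ∑ a, ∑ b, ∑ d, J a k * J b i * J d j * dB d c b a := by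
    refine Finset.sum_congr rfl fun a _ => ?_
    rw [Finset.sum_comm]
    exact Finset.sum_congr rfl fun _ _ => Finset.sum_congr rfl fun _ _ => by ring
  have e4 : ∑ a, ∑ b, ∑ d, J a k * J b j * J d i * ∑ t, B c d t * B t b a
     = ∑ a, ∑ b, ∑ d, J a k * J b i * J d j * ∑ t, B c b t * B t d a := by
    refine Finset.sum_congr rfl fun a _ => ?_
    rw [Finset.sum_comm]
    exact Finset.sum_congr rfl fun _ _ => Finset.sum_congr rfl fun _ _ => by ring
  rw [e3, e4] at h
  simp only [mul_add, mul_sub, Finset.sum_add_distrib, Finset.sum_sub_distrib] at h ⊢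
  linear_combination h

/-! ### Partial derivatives -/

section PartialDerivatives

variable {f h : E4 → ℝ} {y : E4} {i : Fin 4}

theorem pderiv_const (c : ℝ) : pderiv i (fun _ => c) y = 0 := by
  simp [pderiv]

theorem pderiv_add (hf : DifferentiableAt ℝ f y) (hh : DifferentiableAt ℝ h y) :
    pderiv i (fun z => f z + h z) y = pderiv i f y + pderiv i h y := by
  simp [pderiv, fderiv_fun_add hf hh]

theorem pderiv_neg : pderiv i (fun z => -f z) y = -pderiv i f y := by
  simp [pderiv, fderiv_fun_neg]

theorem pderiv_sub (hf : DifferentiableAt ℝ f y) (hh : DifferentiableAt ℝ h y) :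
    pderiv i (fun z => f z - h z) y = pderiv i f y - pderiv i h y := by
  simp [pderiv, fderiv_fun_sub hf hh]

theorem pderiv_mul (hf : DifferentiableAt ℝ f y) (hh : DifferentiableAt ℝ h y) :
    pderiv i (fun z => f z * h z) y = pderiv i f y * h y + f y * pderiv i h y := by
  simp [pderiv, fderiv_fun_mul hf hh]
  ring

theorem pderiv_const_mul (c : ℝ) (hf : DifferentiableAt ℝ f y) :
    pderiv i (fun z => c * f z) y = c * pderiv i f y := by
  simp [pderiv_mul (differentiableAt_const c) hf, pderiv_const]

theorem pderiv_sum {ι : Type*} (s : Finset ι) {F : ι → E4 → ℝ}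
    (hF : ∀ a ∈ s, DifferentiableAt ℝ (F a) y) :
    pderiv i (fun z => ∑ a ∈ s, F a z) y = ∑ a ∈ s, pderiv i (F a) y := by
  simp [pderiv, fderiv_fun_sum hF]

theorem pderiv_prod {ι : Type*} [DecidableEq ι] (s : Finset ι) {F : ι → E4 → ℝ}
    (hF : ∀ a ∈ s, DifferentiableAt ℝ (F a) y) :
    pderiv i (fun z => ∏ a ∈ s, F a z) y = ∑ a ∈ s, (∏ b ∈ s.erase a, F b y) * pderiv i (F a) y := by
  simp [pderiv, fderiv_finsetProd hF]

theorem pderiv_congr (hfh : f =ᶠ[nhds y] h) : pderiv i f y = pderiv i h y := by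
  simp [pderiv, hfh.fderiv_eq]

theorem contDiffAt_pderiv (hf : ContDiffAt ℝ ∞ f y) (i : Fin 4) :
    ContDiffAt ℝ ∞ (pderiv i f) y :=
  (hf.fderiv_right (m := ∞) (by simp)).clm_apply contDiffAt_const

theorem pderiv_comm (hf : ContDiffAt ℝ ∞ f y) (i j : Fin 4) :
    pderiv i (pderiv j f) y = pderiv j (pderiv i f) y := by
  have hd : DifferentiableAt ℝ (fderiv ℝ f) y :=
    (hf.fderiv_right (m := ∞) (by simp)).differentiableAt (by simp)
  have hs : IsSymmSndFDerivAt ℝ f y := hf.isSymmSndFDerivAt (by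
    simpa using WithTop.coe_le_coe.2 (le_top : (2 : ℕ∞) ≤ ⊤))
  have e : ∀ i j, pderiv i (pderiv j f) y = fderiv ℝ (fderiv ℝ f) y (basisVec i) (basisVec j) := by
    intro i j
    unfold pderiv
    rw [fderiv_clm_apply hd (differentiableAt_const _)]
    simp
  rw [e, e, hs]

theorem fderiv_apply_eq_sum (f : E4 → ℝ) (y v : E4) :
    fderiv ℝ f y v = ∑ c, v c * pderiv c f y := by
  have : v = ∑ c, v c • basisVec c := by
    ext d
    simp [basisVec, Finset.sum_apply, Pi.single_apply]
  conv_lhs => rw [this]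
  simp [pderiv]

theorem pderiv_comp {φ : E4 → E4} (hf : DifferentiableAt ℝ f (φ y)) (hφ : DifferentiableAt ℝ φ y) :
    pderiv i (fun z => f (φ z)) y
      = ∑ c, pderiv i (fun z => φ z c) y * pderiv c f (φ y) := by
  have h1 : fderiv ℝ (fun z => f (φ z)) y = (fderiv ℝ f (φ y)).comp (fderiv ℝ φ y) :=
    fderiv_comp y hf hφ
  have h2 : ∀ c, pderiv i (fun z => φ z c) y = (fderiv ℝ φ y (basisVec i)) c := by
    intro c
    have : fderiv ℝ (fun z => φ z c) y = (EuclideanSpace.proj c : E4 →L[ℝ] ℝ).comp (fderiv ℝ φ y) :=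
      (EuclideanSpace.proj c : E4 →L[ℝ] ℝ).hasFDerivAt.comp y hφ.hasFDerivAt |>.fderiv
    simp [pderiv, this]
  simp only [h2]
  rw [pderiv, h1, ContinuousLinearMap.comp_apply, fderiv_apply_eq_sum f]

end PartialDerivatives

/-! ### Multi-indices -/

theorem sum_cons {k : ℕ} {A : Type*} [AddCommMonoid A] (f : (Fin (k + 1) → Fin 4) → A) :
    ∑ I, f I = ∑ a, ∑ I : Fin k → Fin 4, f (Matrix.vecCons a I) := by
  rw [← (Fin.consEquiv fun _ => Fin 4).sum_comp, Fintype.sum_prod_type]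
  rfl

theorem sum_nil {A : Type*} [AddCommMonoid A] (f : (Fin 0 → Fin 4) → A) : ∑ I, f I = f ![] := by
  rw [Fintype.sum_unique]
  congr

/-- Exchanging s with the slot a of P is an involution of the pairs (P, s). It moves the dummy index
of a Christoffel term from the tensor to the Jacobian factors. -/
theorem sum_update_swap {k : ℕ} (a : Fin k) (f : (Fin k → Fin 4) → Fin 4 → ℝ) :
    ∑ P, ∑ s, f P s = ∑ P, ∑ s, f (Function.update P a s) (P a) := by
  rw [← Fintype.sum_prod_type', ← Fintype.sum_prod_type']
  refine Fintype.sum_equiv ⟨fun x => (Function.update x.1 a x.2, x.1 a),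
    fun x => (Function.update x.1 a x.2, x.1 a), fun x => ?_, fun x => ?_⟩ _ _ fun x => ?_
  · simp
  · simp
  · simp

/-! ### Pull-back of tensors -/

/-- The Jacobian matrix `J^c_i = ∂_i φ^c`. -/
def jac (φ : E4 → E4) (y : E4) : Matrix (Fin 4) (Fin 4) ℝ :=
  Matrix.of fun c i => pderiv i (fun z => φ z c) y

/-- The pull-back of the components of a covariant tensor by a linear map. -/
def pullComp {k : ℕ} (K : Matrix (Fin 4) (Fin 4) ℝ) (T : (Fin k → Fin 4) → ℝ)
    (I : Fin k → Fin 4) : ℝ :=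
  ∑ P : Fin k → Fin 4, (∏ a, K (P a) (I a)) * T P

/-- `G` is a smooth metric on the open set `U`. -/
structure IsMetricOn (G : LocalMetric) (U : Set E4) : Prop where
  isOpen : IsOpen U
  smooth : ∀ z ∈ U, ∀ i j, ContDiffAt ℝ ∞ (fun z => G z i j) z
  posDef : ∀ z ∈ U, (G z).PosDef

/-- The components of `T` are smooth at the points of `U`. -/
def SmoothOn {k : ℕ} (T : TensorField k) (U : Set E4) : Prop :=
  ∀ I, ∀ z ∈ U, ContDiffAt ℝ ∞ (fun z => T z I) z

/-- The smooth map `φ : V → U` pulls the metric `G` on `U` back to the metric `H` on `V`. -/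
structure IsPullback (φ : E4 → E4) (V U : Set E4) (H G : LocalMetric) : Prop where
  source : IsMetricOn H V
  target : IsMetricOn G U
  mapsTo : Set.MapsTo φ V U
  smooth : ∀ z ∈ V, ContDiffAt ℝ ∞ φ z
  metric : ∀ z ∈ V, ∀ i j, H z i j = ∑ a, ∑ b, jac φ z a i * jac φ z b j * G (φ z) a b

/-- The tensor field `S` on `V` is the pull-back of `T` by `φ`. -/
def Covariant {k : ℕ} (φ : E4 → E4) (V : Set E4) (S T : TensorField k) : Prop :=
  ∀ z ∈ V, ∀ I, S z I = pullComp (jac φ z) (T (φ z)) I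

theorem IsMetricOn.symm {G : LocalMetric} {U : Set E4} (hG : IsMetricOn G U) {z : E4} (hz : z ∈ U)
    (i j : Fin 4) : G z i j = G z j i := by
  simpa using (hG.posDef z hz).isHermitian.apply j i

theorem IsMetricOn.isUnit_det {G : LocalMetric} {U : Set E4} (hG : IsMetricOn G U) {z : E4}
    (hz : z ∈ U) : IsUnit (G z).det :=
  (hG.posDef z hz).det_pos.ne'.isUnit

theorem IsMetricOn.differentiableAt {G : LocalMetric} {U : Set E4} (hG : IsMetricOn G U) {z : E4}
    (hz : z ∈ U) (i j : Fin 4) : DifferentiableAt ℝ (fun z => G z i j) z :=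
  (hG.smooth z hz i j).differentiableAt (by simp)

theorem IsMetricOn.mul_inv {G : LocalMetric} {U : Set E4} (hG : IsMetricOn G U) {z : E4}
    (hz : z ∈ U) : G z * (G z)⁻¹ = 1 := Matrix.mul_nonsing_inv _ (hG.isUnit_det hz)

theorem IsMetricOn.inv_mul {G : LocalMetric} {U : Set E4} (hG : IsMetricOn G U) {z : E4}
    (hz : z ∈ U) : (G z)⁻¹ * G z = 1 := Matrix.nonsing_inv_mul _ (hG.isUnit_det hz)

theorem IsMetricOn.inv_symm {G : LocalMetric} {U : Set E4} (hG : IsMetricOn G U) {z : E4}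
    (hz : z ∈ U) (i j : Fin 4) : (G z)⁻¹ i j = (G z)⁻¹ j i := by
  simpa using (hG.posDef z hz).isHermitian.inv.apply j i

theorem contDiffAt_det {n : ℕ} {A : E4 → Matrix (Fin n) (Fin n) ℝ} {z : E4}
    (hA : ∀ i j, ContDiffAt ℝ ∞ (fun z => A z i j) z) : ContDiffAt ℝ ∞ (fun z => (A z).det) z := by
  simp only [Matrix.det_apply]
  refine ContDiffAt.sum fun σ _ => ?_
  exact (contDiffAt_prod fun i _ => hA _ _).const_smul _

theorem IsMetricOn.smooth_inv {G : LocalMetric} {U : Set E4} (hG : IsMetricOn G U) {z : E4}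
    (hz : z ∈ U) (i j : Fin 4) : ContDiffAt ℝ ∞ (fun z => (G z)⁻¹ i j) z := by
  simp only [Matrix.inv_def, Matrix.smul_apply, Ring.inverse_eq_inv', smul_eq_mul,
    Matrix.adjugate_apply]
  refine ((contDiffAt_det (hG.smooth z hz)).inv (hG.posDef z hz).det_pos.ne').mul
    (contDiffAt_det fun a b => ?_)
  by_cases h : a = j
  · subst h; simpa using contDiffAt_const
  · simpa [h] using hG.smooth z hz a b

/-! ### The Levi-Civita connection -/

section Connection

variable {G : LocalMetric} {U : Set E4} {y : E4}

theorem IsMetricOn.pderiv_symm (hG : IsMetricOn G U) (hy : y ∈ U) (k i j : Fin 4) :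
    pderiv k (fun z => G z i j) y = pderiv k (fun z => G z j i) y :=
  pderiv_congr <| by
    filter_upwards [hG.isOpen.mem_nhds hy] with z hz using hG.symm hz i j

theorem christoffel_symm (hG : IsMetricOn G U) (hy : y ∈ U) (k i j : Fin 4) :
    christoffel G y k i j = christoffel G y k j i := by
  unfold christoffel
  congr 1
  refine Finset.sum_congr rfl fun l _ => ?_
  rw [hG.pderiv_symm hy l i j]
  ring

/-- Lowering the upper index removes the inverse metric, so the transformation law of Γ can be read
off from derivatives of the metric alone. -/
theorem sum_metric_christoffel (hG : IsMetricOn G U) (hy : y ∈ U) (a i j : Fin 4) :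
    ∑ s, G y a s * christoffel G y s i j = 1 / 2 * (pderiv i (fun z => G z j a) y
      + pderiv j (fun z => G z i a) y - pderiv a (fun z => G z i j) y) := by
  have h : ∀ l, ∑ s, G y a s * (G y)⁻¹ s l = if a = l then 1 else 0 := fun l => by
    rw [← Matrix.mul_apply, hG.mul_inv hy, Matrix.one_apply]
  set d : Fin 4 → ℝ := fun l => pderiv i (fun z => G z j l) y + pderiv j (fun z => G z i l) y
    - pderiv l (fun z => G z i j) y with hd
  calc ∑ s, G y a s * christoffel G y s i j
      = ∑ s, ∑ l, G y a s * (G y)⁻¹ s l * (1 / 2 * d l) := by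
        refine Finset.sum_congr rfl fun s _ => ?_
        rw [christoffel, Finset.mul_sum, Finset.mul_sum]
        exact Finset.sum_congr rfl fun l _ => by simp only [hd]; ring
    _ = ∑ l, (if a = l then 1 else 0) * (1 / 2 * d l) := by
        rw [Finset.sum_comm]
        exact Finset.sum_congr rfl fun l _ => by rw [← Finset.sum_mul, h]
    _ = 1 / 2 * d a := by simp

theorem smooth_christoffel (hG : IsMetricOn G U) (hy : y ∈ U) (k i j : Fin 4) :
    ContDiffAt ℝ ∞ (fun z => christoffel G z k i j) y := by
  unfold christoffel
  refine contDiffAt_const.mul (ContDiffAt.sum fun l _ => (hG.smooth_inv hy k l).mul ?_)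
  exact ((contDiffAt_pderiv (hG.smooth y hy j l) i).add
    (contDiffAt_pderiv (hG.smooth y hy i l) j)).sub (contDiffAt_pderiv (hG.smooth y hy i j) l)

end Connection

/-! ### Transformation law of the Christoffel symbols -/

section Pullback

variable {φ : E4 → E4} {V U : Set E4} {H G : LocalMetric} {y : E4}

theorem contDiffAt_component {φ : E4 → E4} {y : E4} (h : ContDiffAt ℝ ∞ φ y) (c : Fin 4) :
    ContDiffAt ℝ ∞ (fun z => φ z c) y :=
  (EuclideanSpace.proj c : E4 →L[ℝ] ℝ).contDiff.contDiffAt.comp y h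

theorem IsPullback.smooth_jac (hφ : IsPullback φ V U H G) (hy : y ∈ V) (c i : Fin 4) :
    ContDiffAt ℝ ∞ (fun z => jac φ z c i) y :=
  contDiffAt_pderiv (contDiffAt_component (hφ.smooth y hy) c) i

theorem IsPullback.differentiableAt_jac (hφ : IsPullback φ V U H G) (hy : y ∈ V) (c i : Fin 4) :
    DifferentiableAt ℝ (fun z => jac φ z c i) y :=
  (hφ.smooth_jac hy c i).differentiableAt (by simp)

theorem IsPullback.differentiableAt (hφ : IsPullback φ V U H G) (hy : y ∈ V) :
    DifferentiableAt ℝ φ y := (hφ.smooth y hy).differentiableAt (by simp)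

theorem IsPullback.pderiv_jac_symm (hφ : IsPullback φ V U H G) (hy : y ∈ V) (c i j : Fin 4) :
    pderiv i (fun z => jac φ z c j) y = pderiv j (fun z => jac φ z c i) y :=
  pderiv_comm (contDiffAt_component (hφ.smooth y hy) c) i j

theorem IsPullback.metric_eq (hφ : IsPullback φ V U H G) (hy : y ∈ V) :
    H y = (jac φ y).transpose * G (φ y) * jac φ y := by
  ext i j
  rw [hφ.metric y hy]
  simp only [Matrix.mul_apply, Finset.sum_mul, Matrix.transpose_apply]
  rw [Finset.sum_comm]
  exact Finset.sum_congr rfl fun _ _ => Finset.sum_congr rfl fun _ _ => by ring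

/-- Invertibility of the Jacobian need not be assumed: det H = (det J)² det G is positive. -/
theorem IsPullback.det_jac_ne_zero (hφ : IsPullback φ V U H G) (hy : y ∈ V) :
    (jac φ y).det ≠ 0 := by
  intro h
  have := (hφ.source.posDef y hy).det_pos
  rw [hφ.metric_eq hy, Matrix.det_mul, h, mul_zero] at this
  exact lt_irrefl _ this

/-- The inverse of H = JᵀGJ; this is what makes contractions commute with pull-back. -/
theorem IsPullback.jac_inv_transpose (hφ : IsPullback φ V U H G) (hy : y ∈ V) :
    jac φ y * (H y)⁻¹ * (jac φ y).transpose = (G (φ y))⁻¹ := by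
  have hJ : IsUnit (jac φ y).det := (hφ.det_jac_ne_zero hy).isUnit
  have hJt : IsUnit (jac φ y).transpose.det := by rwa [Matrix.det_transpose]
  rw [hφ.metric_eq hy, Matrix.mul_inv_rev, Matrix.mul_inv_rev, ← mul_assoc,
    Matrix.mul_nonsing_inv _ hJ, one_mul, mul_assoc, Matrix.nonsing_inv_mul _ hJt, mul_one]

/-- The transformation law of the Christoffel symbols. -/
theorem IsPullback.christoffel (hφ : IsPullback φ V U H G) (hy : y ∈ V) (c i j : Fin 4) :
    pderiv i (fun z => jac φ z c j) y = ∑ s, jac φ y c s * BachFlat.christoffel H y s i j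
      - ∑ d, ∑ e, BachFlat.christoffel G (φ y) c d e * jac φ y d i * jac φ y e j := by
  have hφy := hφ.mapsTo hy
  have hdh : ∀ k i j, pderiv k (fun z => H z i j) y = ∑ a, ∑ b,
      (pderiv k (fun z => jac φ z a i) y * jac φ y b j * G (φ y) a b
      + jac φ y a i * pderiv k (fun z => jac φ z b j) y * G (φ y) a b
      + jac φ y a i * jac φ y b j * ∑ c, jac φ y c k * pderiv c (fun z => G z a b) (φ y)) := by
    intro k i j
    have dG : ∀ a b, DifferentiableAt ℝ (fun z => G (φ z) a b) y := fun a b =>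
      (hφ.target.differentiableAt hφy a b).comp (f := φ) y (hφ.differentiableAt hy)
    rw [pderiv_congr (h := fun z => ∑ a, ∑ b, jac φ z a i * jac φ z b j * G (φ z) a b) (by
      filter_upwards [hφ.source.isOpen.mem_nhds hy] with z hz using hφ.metric z hz i j)]
    have dJ := fun c i => hφ.differentiableAt_jac hy c i
    rw [pderiv_sum _ fun a _ => DifferentiableAt.fun_sum fun b _ =>
      ((dJ a i).fun_mul (dJ b j)).fun_mul (dG a b)]
    refine Finset.sum_congr rfl fun a _ => ?_
    rw [pderiv_sum _ fun b _ => ((dJ a i).fun_mul (dJ b j)).fun_mul (dG a b)]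
    refine Finset.sum_congr rfl fun b _ => ?_
    rw [pderiv_mul ((dJ a i).fun_mul (dJ b j)) (dG a b), pderiv_mul (dJ a i) (dJ b j),
      pderiv_comp (f := fun z => G z a b) (hφ.target.differentiableAt hφy a b)
        (hφ.differentiableAt hy)]
    simp only [jac, Matrix.of_apply]
    ring
  have key := fun l => christoffelTransform_algebra (fun c i => jac φ y c i)
    (fun i c j => pderiv i (fun z => jac φ z c j) y) (fun a b => G (φ y) a b)
    (fun c a b => pderiv c (fun z => G z a b) (φ y))
    (fun i a j => hφ.pderiv_jac_symm hy a i j) (hφ.target.symm hφy)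
    (hφ.target.pderiv_symm hφy) (BachFlat.christoffel G (φ y))
    (fun a b c => sum_metric_christoffel hφ.target hφy a b c)
    (fun k i j => pderiv k (fun z => H z i j) y) hdh l i j
  have key2 : ∀ l, ∑ s, H y l s * BachFlat.christoffel H y s i j
      = ∑ a, ∑ c, jac φ y a l * G (φ y) a c *
        (pderiv i (fun z => jac φ z c j) y
          + ∑ d, ∑ e, BachFlat.christoffel G (φ y) c d e * jac φ y d i * jac φ y e j) := fun l => by
    rw [sum_metric_christoffel hφ.source hy, ← key]
  set Q : Fin 4 → ℝ := fun c => pderiv i (fun z => jac φ z c j) y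
          + ∑ d, ∑ e, BachFlat.christoffel G (φ y) c d e * jac φ y d i * jac φ y e j with hQ
  set P : Fin 4 → ℝ := fun c => ∑ s, jac φ y c s * BachFlat.christoffel H y s i j with hP
  -- The law is first obtained with its index lowered, that is, multiplied by JᵀG; this matrix is
  -- invertible and cancels.
  have e1 : ((jac φ y).transpose * G (φ y)).mulVec P = ((jac φ y).transpose * G (φ y)).mulVec Q := by
    have : P = (jac φ y).mulVec (fun s => BachFlat.christoffel H y s i j) := rfl
    rw [this, Matrix.mulVec_mulVec, ← hφ.metric_eq hy]
    funext l
    refine (key2 l).trans ?_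
    simp only [Matrix.mulVec, dotProduct, Matrix.mul_apply, Finset.sum_mul, Matrix.transpose_apply]
    rw [Finset.sum_comm]
  have hinv : IsUnit ((jac φ y).transpose * G (φ y)) := by
    rw [Matrix.isUnit_iff_isUnit_det, Matrix.det_mul, Matrix.det_transpose]
    exact (hφ.det_jac_ne_zero hy).isUnit.mul (hφ.target.isUnit_det hφy)
  have e2 : P = Q := Matrix.mulVec_injective_of_isUnit hinv e1
  have := congrFun e2 c
  simp only [hP, hQ] at this
  linarith

end Pullback

theorem pullComp_vecCons {k : ℕ} (K : Matrix (Fin 4) (Fin 4) ℝ) (T : (Fin (k + 1) → Fin 4) → ℝ)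
    (i : Fin 4) (I : Fin k → Fin 4) :
    pullComp K T (Matrix.vecCons i I)
      = ∑ c, K c i * pullComp K (fun P => T (Matrix.vecCons c P)) I := by
  simp only [pullComp, sum_cons, Finset.mul_sum, Fin.prod_univ_succ]
  exact Finset.sum_congr rfl fun _ _ => Finset.sum_congr rfl fun _ _ => by
    simp [mul_assoc]

theorem pullComp_nil (K : Matrix (Fin 4) (Fin 4) ℝ) (T : (Fin 0 → Fin 4) → ℝ) (I) :
    pullComp K T I = T ![] := by
  simp [pullComp, Subsingleton.elim default ![]]

/-- The covariant derivative commutes with pull-backs. -/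
theorem Covariant.covDeriv {k : ℕ} {φ : E4 → E4} {V U : Set E4} {H G : LocalMetric}
    {S T : TensorField k} (hφ : IsPullback φ V U H G) (hT : SmoothOn T U) (h : Covariant φ V S T) :
    Covariant φ V (covDeriv H S) (covDeriv G T) := by
  intro y hy I
  have hφy := hφ.mapsTo hy
  set i := I 0 with hi
  set K := Fin.tail I with hK
  have dJ := fun c i => hφ.differentiableAt_jac hy c i
  have dT : ∀ P, DifferentiableAt ℝ (fun z => T (φ z) P) y := fun P =>
    ((hT P _ hφy).differentiableAt (by simp)).comp (f := φ) y (hφ.differentiableAt hy)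
  have e1 : pderiv i (fun z => S z K) y = ∑ P : Fin k → Fin 4,
      ((∑ a, (∏ b ∈ Finset.univ.erase a, jac φ y (P b) (K b)) *
        pderiv i (fun z => jac φ z (P a) (K a)) y) * T (φ y) P
      + (∏ a, jac φ y (P a) (K a)) * ∑ c, jac φ y c i * pderiv c (fun z => T z P) (φ y)) := by
    rw [pderiv_congr (h := fun z => ∑ P : Fin k → Fin 4, (∏ a, jac φ z (P a) (K a)) * T (φ z) P) (by
      filter_upwards [hφ.source.isOpen.mem_nhds hy] with z hz using h z hz K)]
    have dP : ∀ P : Fin k → Fin 4, DifferentiableAt ℝ (fun z => ∏ a, jac φ z (P a) (K a)) y :=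
      fun P => (contDiffAt_prod fun a _ => hφ.smooth_jac hy (P a) (K a)).differentiableAt (by simp)
    rw [pderiv_sum _ fun P _ => (dP P).fun_mul (dT P)]
    refine Finset.sum_congr rfl fun P _ => ?_
    rw [pderiv_mul (dP P) (dT P), pderiv_prod _ fun a _ => dJ _ _,
      pderiv_comp (f := fun z => T z P) ((hT P _ hφy).differentiableAt (by simp))
        (hφ.differentiableAt hy)]
    rfl
  have e2 : ∀ (a : Fin k) (s : Fin 4), S y (Function.update K a s)
      = ∑ P : Fin k → Fin 4, (∏ b ∈ Finset.univ.erase a, jac φ y (P b) (K b)) *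
        jac φ y (P a) s * T (φ y) P := by
    intro a s
    rw [h y hy]
    refine Finset.sum_congr rfl fun P _ => ?_
    rw [← Finset.prod_erase_mul _ _ (Finset.mem_univ a)]
    simp only [Function.update_self]
    congr 2
    refine Finset.prod_congr rfl fun b hb => ?_
    rw [Function.update_of_ne (Finset.ne_of_mem_erase hb)]
  have e3 : pullComp (jac φ y) (BachFlat.covDeriv G T (φ y)) I
      = ∑ c, ∑ P : Fin k → Fin 4, jac φ y c i * (∏ a, jac φ y (P a) (K a)) *
        (pderiv c (fun z => T z P) (φ y)
          - ∑ a : Fin k, ∑ s, christoffel G (φ y) s c (P a) * T (φ y) (Function.update P a s)) := by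
    simp only [pullComp, sum_cons, Fin.prod_univ_succ]
    refine Finset.sum_congr rfl fun c _ => Finset.sum_congr rfl fun P _ => ?_
    simp [BachFlat.covDeriv, hK, hi, Fin.tail]
  rw [e3]
  show pderiv i (fun z => S z K) y - ∑ a : Fin k, ∑ s, christoffel H y s i (K a) *
    S y (Function.update K a s) = _
  rw [e1]
  -- The Christoffel law splits each derivative of a Jacobian factor into a part with the symbols of
  -- H and a part with those of G.
  have e4 : ∀ P : Fin k → Fin 4, ∑ a, (∏ b ∈ Finset.univ.erase a, jac φ y (P b) (K b)) *
        pderiv i (fun z => jac φ z (P a) (K a)) y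
      = ∑ a, ∑ s, christoffel H y s i (K a) * ((∏ b ∈ Finset.univ.erase a, jac φ y (P b) (K b)) *
        jac φ y (P a) s)
      - ∑ a, ∑ d, ∑ e, (∏ b ∈ Finset.univ.erase a, jac φ y (P b) (K b)) *
        (christoffel G (φ y) (P a) d e * jac φ y d i * jac φ y e (K a)) := by
    intro P
    rw [← Finset.sum_sub_distrib]
    refine Finset.sum_congr rfl fun a _ => ?_
    rw [hφ.christoffel hy, mul_sub, Finset.mul_sum, Finset.mul_sum]
    simp only [Finset.mul_sum]
    congr 1
    exact Finset.sum_congr rfl fun s _ => by ring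
  -- The correction terms of ∇S cancel the first of these parts.
  have e5 : ∑ a : Fin k, ∑ s, christoffel H y s i (K a) * S y (Function.update K a s)
      = ∑ P : Fin k → Fin 4, (∑ a, ∑ s, christoffel H y s i (K a) *
        ((∏ b ∈ Finset.univ.erase a, jac φ y (P b) (K b)) * jac φ y (P a) s)) * T (φ y) P := by
    simp only [e2, Finset.mul_sum, Finset.sum_mul]
    rw [Finset.sum_comm' (t' := Finset.univ) (s' := fun _ => Finset.univ) (by simp)]
    rw [Finset.sum_congr rfl fun s _ => Finset.sum_comm, Finset.sum_comm]
    refine Finset.sum_congr rfl fun P _ => ?_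
    rw [Finset.sum_comm]
    exact Finset.sum_congr rfl fun _ _ => Finset.sum_congr rfl fun _ _ => by ring
  -- After the exchange of dummy indices, the correction terms of ∇T match the second part.
  have e6 : ∀ c, ∀ a : Fin k, ∑ P : Fin k → Fin 4, ∑ s, jac φ y c i *
        (∏ b, jac φ y (P b) (K b)) * (christoffel G (φ y) s c (P a) * T (φ y) (Function.update P a s))
      = ∑ P : Fin k → Fin 4, ∑ s, (∏ b ∈ Finset.univ.erase a, jac φ y (P b) (K b)) *
        (christoffel G (φ y) (P a) c s * jac φ y c i * jac φ y s (K a)) * T (φ y) P := by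
    intro c a
    rw [sum_update_swap a fun P s => (∏ b ∈ Finset.univ.erase a, jac φ y (P b) (K b)) *
        (christoffel G (φ y) (P a) c s * jac φ y c i * jac φ y s (K a)) * T (φ y) P]
    refine Finset.sum_congr rfl fun P _ => Finset.sum_congr rfl fun s _ => ?_
    have : ∏ b ∈ Finset.univ.erase a, jac φ y (Function.update P a s b) (K b)
        = ∏ b ∈ Finset.univ.erase a, jac φ y (P b) (K b) :=
      Finset.prod_congr rfl fun b hb => by rw [Function.update_of_ne (Finset.ne_of_mem_erase hb)]
    rw [this, ← Finset.prod_erase_mul _ _ (Finset.mem_univ a), Function.update_self]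
    ring
  have e7 : ∑ c, ∑ P : Fin k → Fin 4, jac φ y c i * (∏ a, jac φ y (P a) (K a)) *
        ∑ a : Fin k, ∑ s, christoffel G (φ y) s c (P a) * T (φ y) (Function.update P a s)
      = ∑ P : Fin k → Fin 4, (∑ a, ∑ d, ∑ e, (∏ b ∈ Finset.univ.erase a, jac φ y (P b) (K b)) *
        (christoffel G (φ y) (P a) d e * jac φ y d i * jac φ y e (K a))) * T (φ y) P := by
    simp only [Finset.mul_sum, Finset.sum_mul]
    rw [Finset.sum_congr rfl fun c _ => Finset.sum_comm]
    rw [Finset.sum_congr rfl fun c _ => Finset.sum_congr rfl fun a _ => e6 c a]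
    rw [Finset.sum_comm, Finset.sum_comm (s := (Finset.univ : Finset (Fin k → Fin 4)))]
    refine Finset.sum_congr rfl fun a _ => ?_
    rw [Finset.sum_comm]
  simp only [mul_sub, Finset.sum_sub_distrib, e7]
  rw [e5]
  simp only [e4, sub_mul, Finset.sum_add_distrib, Finset.sum_sub_distrib]
  rw [Finset.sum_comm (s := (Finset.univ : Finset (Fin 4)))]
  simp only [Finset.mul_sum]
  have e8 : ∀ (P : Fin k → Fin 4), ∀ c, (∏ a, jac φ y (P a) (K a)) * (jac φ y c i *
      pderiv c (fun z => T z P) (φ y)) = jac φ y c i * (∏ a, jac φ y (P a) (K a)) *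
      pderiv c (fun z => T z P) (φ y) := fun _ _ => by ring
  simp only [e8]
  ring

/-! ### Covariance of the curvature -/

section Curvature

variable {G : LocalMetric} {U : Set E4} {y : E4}

theorem smooth_curv (hG : IsMetricOn G U) (hy : y ∈ U) (l k i j : Fin 4) :
    ContDiffAt ℝ ∞ (fun z => curv G z l k i j) y := by
  unfold curv
  have h := fun k i j => smooth_christoffel hG hy k i j
  exact ((contDiffAt_pderiv (h l j k) i).sub (contDiffAt_pderiv (h l i k) j)).add
    (ContDiffAt.sum fun s _ => ((h l i s).mul (h s j k)).sub ((h l j s).mul (h s i k)))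

theorem smooth_riem (hG : IsMetricOn G U) (hy : y ∈ U) (i j k l : Fin 4) :
    ContDiffAt ℝ ∞ (fun z => riem G z i j k l) y :=
  ContDiffAt.sum fun s _ => (hG.smooth y hy k s).mul (smooth_curv hG hy s l i j)

variable {φ : E4 → E4} {V : Set E4} {H : LocalMetric}

/-- The Christoffel law is differentiated once more; the commutation of the second partial
derivatives of the Jacobian is the hypothesis `h2` of `curvTransform_algebra`. -/
theorem IsPullback.curv (hφ : IsPullback φ V U H G) (hy : y ∈ V) (c k i j : Fin 4) :
    ∑ s, jac φ y c s * BachFlat.curv H y s k i j = ∑ a, ∑ b, ∑ d,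
      jac φ y a k * jac φ y b i * jac φ y d j * BachFlat.curv G (φ y) c a b d := by
  have hφy := hφ.mapsTo hy
  refine curvTransform_algebra (fun c s => jac φ y c s) (BachFlat.christoffel H y)
    (BachFlat.christoffel G (φ y)) (fun i l j k => pderiv i (fun z => BachFlat.christoffel H z l j k) y)
    (fun i l j k => pderiv i (fun z => BachFlat.christoffel G z l j k) (φ y))
    (fun k b j => pderiv k (fun z => jac φ z b j) y) (christoffel_symm hφ.source hy)
    (christoffel_symm hφ.target hφy) (fun k b j => hφ.christoffel hy b k j) ?_ c k i j
  intro k i j c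
  have dJ := fun c i => hφ.differentiableAt_jac hy c i
  have dA : ∀ s i j, DifferentiableAt ℝ (fun z => BachFlat.christoffel H z s i j) y :=
    fun s i j => (smooth_christoffel hφ.source hy s i j).differentiableAt (by simp)
  have dB' : ∀ s i j, DifferentiableAt ℝ (fun z => BachFlat.christoffel G z s i j) (φ y) :=
    fun s i j => (smooth_christoffel hφ.target hφy s i j).differentiableAt (by simp)
  have dB : ∀ s i j, DifferentiableAt ℝ (fun z => BachFlat.christoffel G (φ z) s i j) y :=
    fun s i j => (dB' s i j).comp (f := φ) y (hφ.differentiableAt hy)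
  have key : ∀ k i, pderiv k (pderiv i (fun z => jac φ z c j)) y
      = ∑ s, (pderiv k (fun z => BachFlat.christoffel H z s i j) y * jac φ y c s
          + BachFlat.christoffel H y s i j * pderiv k (fun z => jac φ z c s) y)
        - ∑ a, ∑ b, ((∑ d, pderiv d (fun z => BachFlat.christoffel G z c a b) (φ y) * jac φ y d k)
          * jac φ y a i * jac φ y b j + BachFlat.christoffel G (φ y) c a b *
          (pderiv k (fun z => jac φ z a i) y * jac φ y b j
            + jac φ y a i * pderiv k (fun z => jac φ z b j) y)) := by
    intro k i
    rw [pderiv_congr (h := fun z => ∑ s, BachFlat.christoffel H z s i j * jac φ z c s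
      - ∑ d, ∑ e, BachFlat.christoffel G (φ z) c d e * (jac φ z d i * jac φ z e j)) (by
        filter_upwards [hφ.source.isOpen.mem_nhds hy] with z hz
        rw [hφ.christoffel hz]
        simp only [mul_assoc, mul_comm (BachFlat.christoffel H z _ i j)]),
      pderiv_sub (DifferentiableAt.fun_sum fun s _ => (dA s i j).fun_mul (dJ c s))
        (DifferentiableAt.fun_sum fun d _ => DifferentiableAt.fun_sum fun e _ =>
          (dB c d e).fun_mul ((dJ d i).fun_mul (dJ e j))),
      pderiv_sum _ fun s _ => (dA s i j).fun_mul (dJ c s),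
      pderiv_sum _ fun d _ => DifferentiableAt.fun_sum fun e _ =>
          (dB c d e).fun_mul ((dJ d i).fun_mul (dJ e j))]
    congr 1
    · exact Finset.sum_congr rfl fun s _ => pderiv_mul (dA s i j) (dJ c s)
    · refine Finset.sum_congr rfl fun d _ => ?_
      rw [pderiv_sum _ fun e _ => (dB c d e).fun_mul ((dJ d i).fun_mul (dJ e j))]
      refine Finset.sum_congr rfl fun e _ => ?_
      rw [pderiv_mul (dB c d e) ((dJ d i).fun_mul (dJ e j)), pderiv_mul (dJ d i) (dJ e j),
        pderiv_comp (f := fun z => BachFlat.christoffel G z c d e) (dB' c d e)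
          (hφ.differentiableAt hy), mul_assoc]
      simp only [jac, Matrix.of_apply, mul_comm]
  rw [← key, ← key, pderiv_comm (hφ.smooth_jac hy c j)]

theorem sum_reorder (f : Fin 4 → Fin 4 → Fin 4 → Fin 4 → Fin 4 → ℝ) :
    ∑ c, ∑ e, ∑ a, ∑ b, ∑ d, f c e a b d = ∑ b, ∑ d, ∑ c, ∑ a, ∑ e, f c e a b d :=
  (Finset.sum_congr rfl fun _ _ => Finset.sum_congr rfl fun _ _ => Finset.sum_comm).trans <|
  (Finset.sum_congr rfl fun _ _ => Finset.sum_comm).trans <|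
  Finset.sum_comm.trans <|
  (Finset.sum_congr rfl fun _ _ => Finset.sum_congr rfl fun _ _ =>
    Finset.sum_congr rfl fun _ _ => Finset.sum_comm).trans <|
  (Finset.sum_congr rfl fun _ _ => Finset.sum_congr rfl fun _ _ => Finset.sum_comm).trans <|
  (Finset.sum_congr rfl fun _ _ => Finset.sum_comm).trans <|
  (Finset.sum_congr rfl fun _ _ => Finset.sum_congr rfl fun _ _ =>
    Finset.sum_congr rfl fun _ _ => Finset.sum_comm)

/-- The curvature tensor as a tensor field. -/
def riemT (G : LocalMetric) : TensorField 4 := fun y I => riem G y (I 0) (I 1) (I 2) (I 3)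

/-- The metric as a tensor field. -/
def metricT (G : LocalMetric) : TensorField 2 := fun y I => G y (I 0) (I 1)

theorem pullComp_two (K : Matrix (Fin 4) (Fin 4) ℝ) (T : (Fin 2 → Fin 4) → ℝ) (i j : Fin 4) :
    pullComp K T ![i, j] = ∑ a, ∑ b, K a i * K b j * T ![a, b] := by
  simp only [pullComp_vecCons, pullComp_nil, Finset.mul_sum]
  exact Finset.sum_congr rfl fun _ _ => Finset.sum_congr rfl fun _ _ => by ring

theorem IsPullback.covariant_metricT (hφ : IsPullback φ V U H G) :
    Covariant φ V (metricT H) (metricT G) := by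
  intro y hy I
  have : I = ![I 0, I 1] := by ext a; fin_cases a <;> rfl
  rw [this, pullComp_two]
  exact hφ.metric y hy _ _

theorem IsPullback.covariant_riemT (hφ : IsPullback φ V U H G) :
    Covariant φ V (riemT H) (riemT G) := by
  intro y hy I
  have hI : I = ![I 0, I 1, I 2, I 3] := by ext a; fin_cases a <;> rfl
  rw [hI]
  generalize I 0 = i, I 1 = j, I 2 = k, I 3 = l
  simp only [pullComp_vecCons, pullComp_nil]
  show riem H y i j k l = ∑ b, jac φ y b i * ∑ d, jac φ y d j * ∑ c, jac φ y c k *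
    ∑ a, jac φ y a l * riem G (φ y) b d c a
  calc riem H y i j k l
      = ∑ c, ∑ e, jac φ y c k * G (φ y) c e * ∑ s, jac φ y e s * BachFlat.curv H y s l i j := by
        simp only [riem, hφ.metric y hy, Finset.sum_mul, Finset.mul_sum]
        rw [Finset.sum_comm]
        refine Finset.sum_congr rfl fun c _ => ?_
        rw [Finset.sum_comm]
        exact Finset.sum_congr rfl fun _ _ => Finset.sum_congr rfl fun _ _ => by ring
    _ = ∑ c, ∑ e, ∑ a, ∑ b, ∑ d, jac φ y c k * G (φ y) c e *
          (jac φ y a l * jac φ y b i * jac φ y d j * BachFlat.curv G (φ y) e a b d) := by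
        simp only [hφ.curv hy, Finset.mul_sum]
    _ = _ := by
        simp only [riem, Finset.mul_sum]
        refine (sum_reorder _).trans ?_
        refine Finset.sum_congr rfl fun b _ => Finset.sum_congr rfl fun d _ =>
          Finset.sum_congr rfl fun c _ => Finset.sum_congr rfl fun a _ =>
          Finset.sum_congr rfl fun e _ => ?_
        ring

end Curvature

/-! ### Natural tensors -/

/-- A tensor field that is built from the metric in a smooth and coordinate-invariant way. -/
structure Natural {k : ℕ} (τ : LocalMetric → TensorField k) : Prop where
  smooth : ∀ {G : LocalMetric} {U : Set E4}, IsMetricOn G U → SmoothOn (τ G) U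
  covariant : ∀ {φ : E4 → E4} {V U : Set E4} {H G : LocalMetric},
    IsPullback φ V U H G → Covariant φ V (τ H) (τ G)

/-- The contraction of the first two indices of a covariant tensor field. -/
def contr {k : ℕ} (G : LocalMetric) (T : TensorField (k + 2)) : TensorField k := fun y I =>
  ∑ a, ∑ b, (G y)⁻¹ a b * T y (Matrix.vecCons a (Matrix.vecCons b I))

/-- A rearrangement of the indices of a tensor field. -/
def reindex {k n : ℕ} (a : Fin k → Fin n) (T : TensorField k) : TensorField n := fun y I =>
  T y (I ∘ a)

/-- The tensor product of two tensor fields; the indices of the factors are placed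
according to `a` and `b`. -/
def mulT {k l n : ℕ} (a : Fin k → Fin n) (b : Fin l → Fin n) (T : TensorField k)
    (S : TensorField l) : TensorField n := fun y I => T y (I ∘ a) * S y (I ∘ b)

/-- The full contraction of two tensor fields. -/
def pairing {k : ℕ} (G : LocalMetric) (T S : TensorField k) : TensorField 0 := fun y _ =>
  ∑ I : Fin k → Fin 4, ∑ J : Fin k → Fin 4, (∏ a, (G y)⁻¹ (I a) (J a)) * T y I * S y J

/-! ### Operations that preserve covariance and smoothness -/

section Closure

variable {φ : E4 → E4} {V U : Set E4} {H G : LocalMetric}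

/-- Bijectivity of `Sum.elim a b` says that the slots of the two factors partition the slots of the
product. Multi-indices then split into pairs, and the products of Jacobian entries factor
accordingly. -/
theorem pullComp_mulT {k l n : ℕ} {a : Fin k → Fin n} {b : Fin l → Fin n}
    (hab : Function.Bijective (Sum.elim a b)) (K : Matrix (Fin 4) (Fin 4) ℝ)
    (T : (Fin k → Fin 4) → ℝ) (S : (Fin l → Fin 4) → ℝ) (I : Fin n → Fin 4) :
    pullComp K (fun P => T (P ∘ a) * S (P ∘ b)) I = pullComp K T (I ∘ a) * pullComp K S (I ∘ b) := by
  set e : Fin k ⊕ Fin l ≃ Fin n := Equiv.ofBijective _ hab with he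
  have h1 : ∀ f : Fin n → ℝ, ∏ c, f c = (∏ c, f (a c)) * ∏ c, f (b c) := fun f => by
    rw [← e.prod_comp, Fintype.prod_sum_type]
    rfl
  simp only [pullComp, h1]
  rw [Finset.sum_mul_sum, ← Fintype.sum_prod_type']
  refine Fintype.sum_equiv ((e.arrowCongr (Equiv.refl _)).symm.trans
    (Equiv.sumArrowEquivProdArrow _ _ _)) _ _ fun P => ?_
  have h2 : ((e.arrowCongr (Equiv.refl (Fin 4))).symm.trans (Equiv.sumArrowEquivProdArrow _ _ _) P)
      = (P ∘ a, P ∘ b) := rfl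
  rw [h2]
  simp only [Function.comp_apply]
  ring

theorem Covariant.mulT {k l n : ℕ} {a : Fin k → Fin n} {b : Fin l → Fin n}
    (hab : Function.Bijective (Sum.elim a b)) {T T' : TensorField k} {S S' : TensorField l}
    (hT : Covariant φ V T' T) (hS : Covariant φ V S' S) :
    Covariant φ V (BachFlat.mulT a b T' S') (BachFlat.mulT a b T S) := by
  intro y hy I
  simp only [BachFlat.mulT, hT y hy, hS y hy]
  exact (pullComp_mulT hab _ _ _ _).symm

theorem Covariant.reindex {k n : ℕ} {a : Fin k → Fin n} (ha : Function.Bijective a)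
    {T T' : TensorField k} (hT : Covariant φ V T' T) :
    Covariant φ V (BachFlat.reindex a T') (BachFlat.reindex a T) := by
  intro y hy I
  simp only [BachFlat.reindex, hT y hy, pullComp]
  set e : Fin k ≃ Fin n := Equiv.ofBijective _ ha with he
  symm
  refine Fintype.sum_equiv (e.arrowCongr (Equiv.refl _)).symm _ _ fun P => ?_
  have h2 : (e.arrowCongr (Equiv.refl (Fin 4))).symm P = P ∘ a := rfl
  rw [h2, ← e.prod_comp]
  rfl

theorem Covariant.contr {k : ℕ} (hφ : IsPullback φ V U H G) {S T : TensorField (k + 2)}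
    (h : Covariant φ V S T) : Covariant φ V (BachFlat.contr H S) (BachFlat.contr G T) := by
  intro y hy I
  -- The two Jacobian factors on the contracted slots turn the inverse of H into the inverse of G.
  have e : ∀ c d, ∑ a, ∑ b, (H y)⁻¹ a b * (jac φ y c a * jac φ y d b) = (G (φ y))⁻¹ c d := by
    intro c d
    rw [← hφ.jac_inv_transpose hy]
    simp only [Matrix.mul_apply, Finset.sum_mul, Matrix.transpose_apply]
    rw [Finset.sum_comm]
    exact Finset.sum_congr rfl fun _ _ => Finset.sum_congr rfl fun _ _ => by ring
  have e1 : pullComp (jac φ y) (BachFlat.contr G T (φ y)) I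
      = ∑ c, ∑ d, (G (φ y))⁻¹ c d * pullComp (jac φ y)
        (fun P => T (φ y) (Matrix.vecCons c (Matrix.vecCons d P))) I := by
    simp only [pullComp, BachFlat.contr, Finset.mul_sum]
    rw [Finset.sum_comm]
    refine Finset.sum_congr rfl fun c _ => ?_
    rw [Finset.sum_comm]
    exact Finset.sum_congr rfl fun _ _ => Finset.sum_congr rfl fun _ _ => by ring
  rw [e1]
  simp only [← e, BachFlat.contr, h y hy, pullComp_vecCons, Finset.mul_sum, Finset.sum_mul]
  rw [Finset.sum_congr rfl fun _ _ => Finset.sum_comm, Finset.sum_comm]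
  refine Finset.sum_congr rfl fun c _ => ?_
  rw [Finset.sum_congr rfl fun _ _ => Finset.sum_congr rfl fun _ _ => rfl]
  rw [Finset.sum_congr rfl fun _ _ => Finset.sum_comm, Finset.sum_comm]
  exact Finset.sum_congr rfl fun _ _ => Finset.sum_congr rfl fun _ _ =>
    Finset.sum_congr rfl fun _ _ => by ring

theorem sum_prod_eq_prod_sum {k : ℕ} (f : Fin k → Fin 4 → ℝ) :
    ∑ I : Fin k → Fin 4, ∏ a, f a (I a) = ∏ a, ∑ i, f a i := by
  rw [Finset.prod_univ_sum, Fintype.piFinset_univ]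

theorem Covariant.pairing {k : ℕ} (hφ : IsPullback φ V U H G) {S T S' T' : TensorField k}
    (hT : Covariant φ V T' T) (hS : Covariant φ V S' S) :
    Covariant φ V (BachFlat.pairing H T' S') (BachFlat.pairing G T S) := by
  intro y hy I
  have e : ∀ c d, ∑ a, ∑ b, (H y)⁻¹ a b * (jac φ y c a * jac φ y d b) = (G (φ y))⁻¹ c d := by
    intro c d
    rw [← hφ.jac_inv_transpose hy]
    simp only [Matrix.mul_apply, Finset.sum_mul, Matrix.transpose_apply]
    rw [Finset.sum_comm]
    exact Finset.sum_congr rfl fun _ _ => Finset.sum_congr rfl fun _ _ => by ring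
  rw [pullComp_nil]
  simp only [BachFlat.pairing, hT y hy, hS y hy]
  -- The same relation in every slot at once: a product over the slots of double sums is a double
  -- sum over multi-indices.
  have e2 : ∀ P Q : Fin k → Fin 4, ∏ c, (G (φ y))⁻¹ (P c) (Q c)
      = ∑ I : Fin k → Fin 4, ∑ J : Fin k → Fin 4,
        ∏ a, (H y)⁻¹ (I a) (J a) * (jac φ y (P a) (I a) * jac φ y (Q a) (J a)) := by
    intro P Q
    simp only [← e]
    rw [← sum_prod_eq_prod_sum fun c a => ∑ b, (H y)⁻¹ a b * (jac φ y (P c) a * jac φ y (Q c) b)]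
    refine Finset.sum_congr rfl fun I _ => ?_
    rw [← sum_prod_eq_prod_sum fun c b =>
      (H y)⁻¹ (I c) b * (jac φ y (P c) (I c) * jac φ y (Q c) b)]
  simp only [e2, pullComp, Finset.sum_mul, Finset.mul_sum, Finset.prod_mul_distrib]
  have r : ∀ f : (Fin k → Fin 4) → (Fin k → Fin 4) → (Fin k → Fin 4) → (Fin k → Fin 4) → ℝ,
      ∑ I, ∑ J, ∑ Q, ∑ P, f I J P Q = ∑ P, ∑ Q, ∑ I, ∑ J, f I J P Q := fun f =>
    (Finset.sum_congr rfl fun _ _ => Finset.sum_congr rfl fun _ _ => Finset.sum_comm).trans <|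
    (Finset.sum_congr rfl fun _ _ => Finset.sum_comm).trans <|
    Finset.sum_comm.trans <| Finset.sum_congr rfl fun _ _ =>
    (Finset.sum_congr rfl fun _ _ => Finset.sum_comm).trans Finset.sum_comm
  refine Eq.trans ?_ (r _)
  exact Finset.sum_congr rfl fun _ _ => Finset.sum_congr rfl fun _ _ =>
    Finset.sum_congr rfl fun _ _ => Finset.sum_congr rfl fun _ _ => by ring

theorem SmoothOn.covDeriv {k : ℕ} (hG : IsMetricOn G U) {T : TensorField k} (hT : SmoothOn T U) :
    SmoothOn (BachFlat.covDeriv G T) U := fun _ z hz =>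
  (contDiffAt_pderiv (hT _ z hz) _).sub <| ContDiffAt.sum fun _ _ => ContDiffAt.sum fun _ _ =>
    (smooth_christoffel hG hz _ _ _).mul (hT _ z hz)

theorem SmoothOn.contr {k : ℕ} (hG : IsMetricOn G U) {T : TensorField (k + 2)}
    (hT : SmoothOn T U) : SmoothOn (BachFlat.contr G T) U := fun _ z hz =>
  ContDiffAt.sum fun _ _ => ContDiffAt.sum fun _ _ => (hG.smooth_inv hz _ _).mul (hT _ z hz)

end Closure

namespace Natural

variable {k l n : ℕ} {τ τ' : LocalMetric → TensorField k} {σ : LocalMetric → TensorField l}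

theorem metricT : Natural metricT where
  smooth h _ _ hz := h.smooth _ hz _ _
  covariant h := h.covariant_metricT

theorem riemT : Natural riemT where
  smooth h _ _ hz := smooth_riem h hz _ _ _ _
  covariant h := h.covariant_riemT

theorem add (hτ : Natural τ) (hτ' : Natural τ') : Natural fun G => τ G + τ' G where
  smooth h I z hz := (hτ.smooth h I z hz).add (hτ'.smooth h I z hz)
  covariant h y hy I := by
    simp [hτ.covariant h y hy, hτ'.covariant h y hy, pullComp, mul_add, Finset.sum_add_distrib]

theorem smul (c : ℝ) (hτ : Natural τ) : Natural fun G => c • τ G where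
  smooth h I z hz := (hτ.smooth h I z hz).const_smul c
  covariant h y hy I := by
    simp [hτ.covariant h y hy, pullComp, Finset.mul_sum, mul_left_comm]

theorem sub (hτ : Natural τ) (hτ' : Natural τ') : Natural fun G => τ G - τ' G where
  smooth h I z hz := (hτ.smooth h I z hz).sub (hτ'.smooth h I z hz)
  covariant h y hy I := by
    simp [hτ.covariant h y hy, hτ'.covariant h y hy, pullComp, mul_sub, Finset.sum_sub_distrib]

theorem mulT (hτ : Natural τ) (hσ : Natural σ) {a : Fin k → Fin n} {b : Fin l → Fin n}
    (hab : Function.Bijective (Sum.elim a b)) :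
    Natural fun G => BachFlat.mulT a b (τ G) (σ G) where
  smooth h _ z hz := (hτ.smooth h _ z hz).mul (hσ.smooth h _ z hz)
  covariant h := (hτ.covariant h).mulT hab (hσ.covariant h)

theorem reindex (hτ : Natural τ) {a : Fin k → Fin n} (ha : Function.Bijective a) :
    Natural fun G => BachFlat.reindex a (τ G) where
  smooth h _ z hz := hτ.smooth h _ z hz
  covariant h := (hτ.covariant h).reindex ha

theorem contr {τ : LocalMetric → TensorField (k + 2)} (hτ : Natural τ) :
    Natural fun G => BachFlat.contr G (τ G) where
  smooth h := (hτ.smooth h).contr h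
  covariant h := (hτ.covariant h).contr h

theorem pairing (hτ : Natural τ) (hτ' : Natural τ') :
    Natural fun G => BachFlat.pairing G (τ G) (τ' G) where
  smooth h _ z hz := ContDiffAt.sum fun _ _ => ContDiffAt.sum fun _ _ =>
    ((contDiffAt_prod fun _ _ => h.smooth_inv hz _ _).mul (hτ.smooth h _ z hz)).mul
      (hτ'.smooth h _ z hz)
  covariant h := (hτ.covariant h).pairing h (hτ'.covariant h)

theorem covDeriv (hτ : Natural τ) : Natural fun G => BachFlat.covDeriv G (τ G) where
  smooth h := (hτ.smooth h).covDeriv h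
  covariant h := (hτ.covariant h).covDeriv h (hτ.smooth h.target)

end Natural

/-! ### Ricci, scalar and Weyl curvature as natural tensors -/

/-- The Ricci tensor as a tensor field. -/
def ricT (G : LocalMetric) : TensorField 2 := contr G (reindex ![0, 2, 1, 3] (riemT G))

/-- The scalar curvature as a tensor field of rank 0. -/
def scalT (G : LocalMetric) : TensorField 0 := contr G (ricT G)

/-- The trace-free Ricci tensor as a tensor field. -/
def tracefreeRicT (G : LocalMetric) : TensorField 2 :=
  ricT G - (1 / 4 : ℝ) • mulT ![] ![0, 1] (scalT G) (metricT G)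

/-- The Kulkarni-Nomizu product of two tensor fields of rank 2. -/
def kulkarniNomizuT (h k : TensorField 2) : TensorField 4 :=
  mulT ![0, 2] ![1, 3] h k + mulT ![1, 3] ![0, 2] h k - mulT ![0, 3] ![1, 2] h k
    - mulT ![1, 2] ![0, 3] h k

theorem ricT_apply (G : LocalMetric) (y : E4) (I : Fin 2 → Fin 4) :
    ricT G y I = ric G y (I 0) (I 1) := by
  simp [ricT, contr, reindex, riemT, ric]

theorem scalT_apply (G : LocalMetric) (y : E4) (I : Fin 0 → Fin 4) :
    scalT G y I = scal G y := by
  simp [scalT, contr, ricT_apply, scal]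

theorem tracefreeRicT_apply (G : LocalMetric) (y : E4) (I : Fin 2 → Fin 4) :
    tracefreeRicT G y I = tracefreeRic G y (I 0) (I 1) := by
  simp [tracefreeRicT, ricT_apply, mulT, scalT_apply, metricT, tracefreeRic, mul_assoc]

/-- Writes W through operations under which naturality is closed, so that its naturality becomes
formal. -/
theorem weyl_eq (G : LocalMetric) : weyl G = riemT G
    - (1 / 2 : ℝ) • kulkarniNomizuT (tracefreeRicT G) (metricT G)
    - (1 / 24 : ℝ) • mulT ![] id (scalT G) (kulkarniNomizuT (metricT G) (metricT G)) := by
  funext y I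
  simp [weyl, kulkarniNomizuT, kulkarniNomizu, mulT, tracefreeRicT_apply, riemT, metricT,
    scalT_apply]
  ring

theorem natural_ricT : Natural ricT := (Natural.riemT.reindex (by decide)).contr

theorem natural_scalT : Natural scalT := natural_ricT.contr

theorem natural_tracefreeRicT : Natural tracefreeRicT :=
  natural_ricT.sub ((natural_scalT.mulT Natural.metricT (by decide)).smul _)

theorem Natural.kulkarniNomizuT {τ τ' : LocalMetric → TensorField 2} (h : Natural τ)
    (h' : Natural τ') : Natural fun G => kulkarniNomizuT (τ G) (τ' G) :=
  (((h.mulT h' (by decide)).add (h.mulT h' (by decide))).sub (h.mulT h' (by decide))).sub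
    (h.mulT h' (by decide))

theorem natural_weyl : Natural weyl := by
  rw [funext weyl_eq]
  exact (Natural.riemT.sub ((natural_tracefreeRicT.kulkarniNomizuT Natural.metricT).smul _)).sub
    ((natural_scalT.mulT (Natural.metricT.kulkarniNomizuT Natural.metricT) (by decide)).smul _)

/-! ### Normal coordinates -/

/-- The metric `G` is defined near `0`, where it is the identity up to first order. -/
structure IsNormal (G : LocalMetric) (U : Set E4) : Prop extends IsMetricOn G U where
  zero_mem : (0 : E4) ∈ U
  apply_zero : G 0 = 1
  pderiv_zero : ∀ k i j, pderiv k (fun z => G z i j) 0 = 0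

/-- The quadratic coordinate change
`φ^c(z) = y^c + (A z)^c - ½ Γ^c_{ab} (A z)^a (A z)^b`. -/
def normalMap (y : E4) (A : Matrix (Fin 4) (Fin 4) ℝ) (Γ : Fin 4 → Fin 4 → Fin 4 → ℝ) (z : E4) : E4 :=
  WithLp.toLp 2 fun c => y c + ∑ i, A c i * z i
    - (1 / 2) * ∑ a, ∑ b, Γ c a b * (∑ i, A a i * z i) * (∑ i, A b i * z i)

theorem pderiv_coord (k i : Fin 4) (y : E4) :
    pderiv k (fun z : E4 => z i) y = if i = k then 1 else 0 := by
  have : fderiv ℝ (fun z : E4 => z i) y = (EuclideanSpace.proj i : E4 →L[ℝ] ℝ) :=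
    (EuclideanSpace.proj i : E4 →L[ℝ] ℝ).hasFDerivAt.fderiv
  simp [pderiv, this, basisVec]

theorem contDiff_coord (i : Fin 4) : ContDiff ℝ ∞ (fun z : E4 => z i) :=
  (EuclideanSpace.proj i : E4 →L[ℝ] ℝ).contDiff

theorem contDiff_linear (A : Matrix (Fin 4) (Fin 4) ℝ) (c : Fin 4) :
    ContDiff ℝ ∞ (fun z : E4 => ∑ i, A c i * z i) :=
  ContDiff.sum fun i _ => contDiff_const.mul (contDiff_coord i)

theorem pderiv_linear (A : Matrix (Fin 4) (Fin 4) ℝ) (c k : Fin 4) (y : E4) :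
    pderiv k (fun z : E4 => ∑ i, A c i * z i) y = A c k := by
  have h : ∀ i, DifferentiableAt ℝ (fun z : E4 => z i) y := fun i =>
    (contDiff_coord i).contDiffAt.differentiableAt (by simp)
  rw [pderiv_sum _ fun i _ => (h i).const_mul _]
  simp [pderiv_const_mul _ (h _), pderiv_coord]

theorem contDiff_normalMap (y : E4) (A : Matrix (Fin 4) (Fin 4) ℝ) (Γ : Fin 4 → Fin 4 → Fin 4 → ℝ) :
    ContDiff ℝ ∞ (normalMap y A Γ) := by
  rw [contDiff_euclidean]
  intro c
  exact (contDiff_const.add (contDiff_linear A c)).sub <| contDiff_const.mul <|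
    ContDiff.sum fun a _ => ContDiff.sum fun b _ =>
      (contDiff_const.mul (contDiff_linear A a)).mul (contDiff_linear A b)

theorem normalMap_zero (y : E4) (A : Matrix (Fin 4) (Fin 4) ℝ) (Γ : Fin 4 → Fin 4 → Fin 4 → ℝ) :
    normalMap y A Γ 0 = y := by
  ext c
  simp [normalMap]

theorem jac_normalMap (y : E4) (A : Matrix (Fin 4) (Fin 4) ℝ) {Γ : Fin 4 → Fin 4 → Fin 4 → ℝ}
    (hΓ : ∀ c a b, Γ c a b = Γ c b a) (z : E4) (c i : Fin 4) :
    jac (normalMap y A Γ) z c i = A c i - ∑ a, ∑ b, Γ c a b * A a i * ∑ j, A b j * z j := by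
  have d : ∀ c, DifferentiableAt ℝ (fun z : E4 => ∑ i, A c i * z i) z := fun c =>
    (contDiff_linear A c).contDiffAt.differentiableAt (by simp)
  have d2 : ∀ a b, DifferentiableAt ℝ
      (fun z : E4 => Γ c a b * (∑ i, A a i * z i) * (∑ i, A b i * z i)) z :=
    fun a b => ((d a).const_mul _).fun_mul (d b)
  have e : ∀ a b, pderiv i (fun z : E4 => Γ c a b * (∑ i, A a i * z i) * (∑ i, A b i * z i)) z
      = Γ c a b * A a i * (∑ j, A b j * z j) + Γ c b a * A b i * (∑ j, A a j * z j) := fun a b => by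
    rw [pderiv_mul ((d a).const_mul _) (d b), pderiv_const_mul _ (d a), pderiv_linear, pderiv_linear,
      hΓ c b a]
    ring
  show pderiv i (fun z : E4 => y c + ∑ i, A c i * z i
    - (1 / 2) * ∑ a, ∑ b, Γ c a b * (∑ i, A a i * z i) * (∑ i, A b i * z i)) z = _
  rw [pderiv_sub ((differentiableAt_const _).fun_add (d c)) (DifferentiableAt.const_mul
      (DifferentiableAt.fun_sum fun a _ => DifferentiableAt.fun_sum fun b _ => d2 a b) _),
    pderiv_add (differentiableAt_const _) (d c), pderiv_const, pderiv_linear, pderiv_const_mul _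
      (DifferentiableAt.fun_sum fun a _ => DifferentiableAt.fun_sum fun b _ => d2 a b),
    pderiv_sum _ fun a _ => DifferentiableAt.fun_sum fun b _ => d2 a b]
  simp only [pderiv_sum _ fun b _ => d2 _ b, e, Finset.sum_add_distrib]
  rw [Finset.sum_comm (f := fun a b => Γ c b a * A b i * (∑ j, A a j * z j))]
  ring

theorem pderiv_jac_normalMap_zero (y : E4) (A : Matrix (Fin 4) (Fin 4) ℝ)
    {Γ : Fin 4 → Fin 4 → Fin 4 → ℝ} (hΓ : ∀ c a b, Γ c a b = Γ c b a) (c i j : Fin 4) (z : E4) :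
    pderiv i (fun z => jac (normalMap y A Γ) z c j) z = -∑ a, ∑ b, Γ c a b * A a i * A b j := by
  have d : ∀ c, DifferentiableAt ℝ (fun z : E4 => ∑ i, A c i * z i) z := fun c =>
    (contDiff_linear A c).contDiffAt.differentiableAt (by simp)
  simp only [jac_normalMap y A hΓ]
  rw [pderiv_sub (differentiableAt_const _)
      (DifferentiableAt.fun_sum fun a _ => DifferentiableAt.fun_sum fun b _ => (d b).const_mul _),
    pderiv_const, pderiv_sum _ fun a _ => DifferentiableAt.fun_sum fun b _ => (d b).const_mul _]
  simp only [pderiv_sum _ fun b _ => (d b).const_mul _, pderiv_const_mul _ (d _), pderiv_linear]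
  rw [zero_sub, Finset.sum_comm]
  congr 1
  refine Finset.sum_congr rfl fun a _ => Finset.sum_congr rfl fun b _ => ?_
  rw [hΓ c b a]
  ring

open scoped MatrixOrder ComplexOrder in
-- A factorization A = BᵀB exists by positivity. If det B < 0, a reflection of the first row changes
-- the sign of the determinant and leaves BᵀB unchanged.
theorem exists_eq_transpose_mul_self {A : Matrix (Fin 4) (Fin 4) ℝ} (hA : A.PosDef) :
    ∃ B : Matrix (Fin 4) (Fin 4) ℝ, 0 < B.det ∧ A = B.transpose * B := by
  obtain ⟨B, hB⟩ := CStarAlgebra.nonneg_iff_eq_star_mul_self.mp hA.posSemidef.nonneg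
  rw [Matrix.star_eq_conjTranspose, Matrix.conjTranspose_eq_transpose_of_trivial] at hB
  have hd : B.det ≠ 0 := fun h => by
    have := hA.det_pos
    rw [hB, Matrix.det_mul, h, mul_zero] at this
    exact lt_irrefl _ this
  rcases lt_or_gt_of_ne hd with h | h
  · set D : Matrix (Fin 4) (Fin 4) ℝ := Matrix.diagonal ![-1, 1, 1, 1] with hD
    have hDD : D * D = 1 := by
      rw [hD, Matrix.diagonal_mul_diagonal, ← Matrix.diagonal_one]
      congr 1
      ext i
      fin_cases i <;> simp
    have hDet : D.det = -1 := by simp [hD, Matrix.det_diagonal, Fin.prod_univ_four]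
    refine ⟨D * B, by rw [Matrix.det_mul, hDet]; linarith, ?_⟩
    rw [Matrix.transpose_mul, hD, Matrix.diagonal_transpose, ← hD, mul_assoc, ← mul_assoc D, hDD,
      one_mul, ← hB]
  · exact ⟨B, h, hB⟩

/-- The linear part A = B⁻¹ makes the metric at y the identity. The second derivatives of the
quadratic part are −Γ(A·, A·), exactly what the Christoffel law needs for the symbols of the
pulled-back metric to vanish at 0. -/
theorem exists_isNormal {G : LocalMetric} {U : Set E4} (hG : IsMetricOn G U) {y : E4} (hy : y ∈ U) :
    ∃ φ V H, IsPullback φ V U H G ∧ IsNormal H V ∧ φ 0 = y := by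
  obtain ⟨B, hB0, hBG⟩ := exists_eq_transpose_mul_self (hG.posDef y hy)
  have hB : IsUnit B.det := hB0.ne'.isUnit
  set A := B⁻¹ with hA
  have hAdet : A.det ≠ 0 := by
    rw [hA, Matrix.det_nonsing_inv]
    simpa using hB.ne_zero
  have hAG : A.transpose * G y * A = 1 := by
    rw [hBG, ← mul_assoc, ← Matrix.transpose_mul, Matrix.mul_nonsing_inv _ hB,
      Matrix.transpose_one, one_mul, Matrix.mul_nonsing_inv _ hB]
  set Γ := christoffel G y with hΓ
  have hs : ∀ c a b, Γ c a b = Γ c b a := fun c a b => christoffel_symm hG hy c a b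
  set φ := normalMap y A Γ with hφ
  have hφ0 : φ 0 = y := normalMap_zero y A Γ
  have hφs : ContDiff ℝ ∞ φ := contDiff_normalMap y A Γ
  have hJs : ∀ c i z, ContDiffAt ℝ ∞ (fun z => jac φ z c i) z := fun c i z =>
    contDiffAt_pderiv (contDiffAt_component hφs.contDiffAt c) i
  -- On this open set the map stays in U and has invertible Jacobian, so the pulled-back metric is
  -- positive definite.
  set V : Set E4 := φ ⁻¹' U ∩ {z | (jac φ z).det ≠ 0} with hV
  set H : LocalMetric := fun z => (jac φ z).transpose * G (φ z) * jac φ z with hH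
  have hHe : ∀ z i j, H z i j = ∑ a, ∑ b, jac φ z a i * jac φ z b j * G (φ z) a b := by
    intro z i j
    simp only [hH, Matrix.mul_apply, Finset.sum_mul, Matrix.transpose_apply]
    rw [Finset.sum_comm]
    exact Finset.sum_congr rfl fun _ _ => Finset.sum_congr rfl fun _ _ => by ring
  have hHV : IsMetricOn H V := by
    refine ⟨?_, ?_, ?_⟩
    · refine (hG.isOpen.preimage hφs.continuous).inter (isOpen_ne_fun ?_ continuous_const)
      exact continuous_iff_continuousAt.2 fun z =>
        (contDiffAt_det fun i j => hJs i j z).continuousAt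
    · intro z hz i j
      simp only [hHe]
      exact ContDiffAt.sum fun a _ => ContDiffAt.sum fun b _ =>
        ((hJs a i z).mul (hJs b j z)).mul ((hG.smooth _ hz.1 a b).comp z hφs.contDiffAt)
    · intro z hz
      have := (hG.posDef _ hz.1).conjTranspose_mul_mul_same (B := jac φ z)
        (Matrix.mulVec_injective_of_isUnit <| by
          rw [Matrix.isUnit_iff_isUnit_det]; exact IsUnit.mk0 _ hz.2)
      simpa [hH, Matrix.conjTranspose_eq_transpose_of_trivial] using this
  have hP : IsPullback φ V U H G :=
    ⟨hHV, hG, fun z hz => hz.1, fun z _ => hφs.contDiffAt, fun z _ => hHe z⟩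
  have hJ0 : jac φ 0 = A := by
    ext c i
    rw [hφ, jac_normalMap y A hs]
    simp
  have h0 : (0 : E4) ∈ V := by
    refine ⟨?_, ?_⟩
    · simpa [hφ0] using hy
    · simpa [hJ0] using hAdet
  have hchr : ∀ s i j, christoffel H 0 s i j = 0 := by
    intro s i j
    have h1 : A.mulVec (fun s => christoffel H 0 s i j) = 0 := by
      funext c
      have h2 := hP.christoffel h0 c i j
      rw [hφ, pderiv_jac_normalMap_zero y A hs, ← hφ, hJ0, hφ0] at h2
      simp only [Matrix.mulVec, dotProduct, Pi.zero_apply]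
      linarith
    have h3 := Matrix.mulVec_injective_of_isUnit (A := A)
      ((Matrix.isUnit_iff_isUnit_det _).2 (IsUnit.mk0 _ hAdet)) (h1.trans (Matrix.mulVec_zero A).symm)
    exact congrFun h3 s
  refine ⟨φ, V, H, hP, ⟨hHV, h0, ?_, ?_⟩, hφ0⟩
  · simp only [hH, hJ0, hφ0, hAG]
  · intro k i j
    -- Metric compatibility: ∂_k g_ij is a sum of two lowered Christoffel symbols, and these vanish.
    have h1 := fun a i j => sum_metric_christoffel hHV h0 a i j
    simp only [hchr, mul_zero, Finset.sum_const_zero] at h1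
    have s := hHV.pderiv_symm h0
    have e1 := h1 j i k
    have e2 := h1 i j k
    rw [s k i j] at *
    linarith [s i k j, s j k i, s k j i]

theorem pullComp_pullComp {k : ℕ} (K L : Matrix (Fin 4) (Fin 4) ℝ) (T : (Fin k → Fin 4) → ℝ)
    (I : Fin k → Fin 4) : pullComp K (pullComp L T) I = pullComp (L * K) T I := by
  simp only [pullComp, Finset.mul_sum, Matrix.mul_apply]
  rw [Finset.sum_comm]
  refine Finset.sum_congr rfl fun P _ => ?_
  rw [← sum_prod_eq_prod_sum fun a j => L (P a) j * K j (I a), Finset.sum_mul]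
  refine Finset.sum_congr rfl fun Q _ => ?_
  rw [Finset.prod_mul_distrib]
  ring

theorem pullComp_one {k : ℕ} (T : (Fin k → Fin 4) → ℝ) (I : Fin k → Fin 4) :
    pullComp 1 T I = T I := by
  rw [pullComp, Finset.sum_eq_single I]
  · simp
  · intro P _ hP
    obtain ⟨a, ha⟩ := Function.ne_iff.1 hP
    rw [Finset.prod_eq_zero (Finset.mem_univ a) (by simp [ha]), zero_mul]
  · simp

/-- A natural tensor that vanishes at the origin of normal coordinates vanishes identically. -/
theorem Natural.eq_zero {k : ℕ} {τ : LocalMetric → TensorField k} (hτ : Natural τ)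
    (h : ∀ H V, IsNormal H V → ∀ I, τ H 0 I = 0) {G : LocalMetric} {U : Set E4}
    (hG : IsMetricOn G U) {y : E4} (hy : y ∈ U) (I : Fin k → Fin 4) : τ G y I = 0 := by
  obtain ⟨φ, V, H, hφ, hH, rfl⟩ := exists_isNormal hG hy
  have e : pullComp (jac φ 0) (τ G (φ 0)) = 0 := by
    funext P
    rw [← hτ.covariant hφ 0 hH.zero_mem P, h H V hH]
    rfl
  -- Pulling back by the inverse Jacobian recovers the value in the original coordinates.
  have e2 := pullComp_pullComp (jac φ 0)⁻¹ (jac φ 0) (τ G (φ 0)) I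
  rw [e, Matrix.mul_nonsing_inv _ (hφ.det_jac_ne_zero hH.zero_mem).isUnit, pullComp_one] at e2
  rw [← e2]
  simp [pullComp]

/-! ### Curvature and covariant derivatives at the origin of normal coordinates -/

section AtOrigin

variable {G : LocalMetric} {U : Set E4}

theorem IsNormal.christoffel (hG : IsNormal G U) (k i j : Fin 4) : christoffel G 0 k i j = 0 := by
  simp [BachFlat.christoffel, hG.pderiv_zero]

theorem IsNormal.inv (hG : IsNormal G U) : (G 0)⁻¹ = 1 := by
  rw [hG.apply_zero, inv_one]

theorem IsNormal.differentiableAt_inv (hG : IsNormal G U) (i j : Fin 4) :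
    DifferentiableAt ℝ (fun z => (G z)⁻¹ i j) 0 :=
  (hG.smooth_inv hG.zero_mem i j).differentiableAt (by simp)

theorem IsNormal.pderiv_inv (hG : IsNormal G U) (k i j : Fin 4) :
    pderiv k (fun z => (G z)⁻¹ i j) 0 = 0 := by
  have hd := fun i j => hG.differentiableAt hG.zero_mem i j
  have hi := hG.differentiableAt_inv
  have h : pderiv k (fun z => ∑ s, (G z)⁻¹ i s * G z s j) 0 = 0 := by
    rw [pderiv_congr (h := fun _ => (1 : Matrix (Fin 4) (Fin 4) ℝ) i j), pderiv_const]
    filter_upwards [hG.isOpen.mem_nhds hG.zero_mem] with z hz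
    rw [← hG.inv_mul hz, Matrix.mul_apply]
  rw [pderiv_sum _ fun s _ => (hi i s).fun_mul (hd s j)] at h
  simpa [pderiv_mul (hi _ _) (hd _ _), hG.pderiv_zero, hG.apply_zero, Matrix.one_apply] using h

theorem covDeriv_vecCons {k : ℕ} (G : LocalMetric) (T : TensorField k) (y : E4) (m : Fin 4)
    (I : Fin k → Fin 4) : covDeriv G T y (Matrix.vecCons m I) = pderiv m (fun z => T z I) y
      - ∑ a : Fin k, ∑ s, christoffel G y s m (I a) * T y (Function.update I a s) := rfl

theorem IsNormal.covDeriv (hG : IsNormal G U) {k : ℕ} (T : TensorField k) (m : Fin 4)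
    (I : Fin k → Fin 4) :
    covDeriv G T 0 (Matrix.vecCons m I) = pderiv m (fun z => T z I) 0 := by
  simp [covDeriv_vecCons, hG.christoffel]

theorem IsNormal.contr (hG : IsNormal G U) {k : ℕ} (T : TensorField (k + 2))
    (I : Fin k → Fin 4) :
    contr G T 0 I = ∑ s, T 0 (Matrix.vecCons s (Matrix.vecCons s I)) := by
  simp [BachFlat.contr, hG.inv, Matrix.one_apply]

theorem SmoothOn.differentiableAt {k : ℕ} {T : TensorField k} (hT : SmoothOn T U) {y : E4}
    (hy : y ∈ U) (I : Fin k → Fin 4) : DifferentiableAt ℝ (fun z => T z I) y :=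
  (hT I y hy).differentiableAt (by simp)

/-- At the origin the inverse metric is the identity and its first derivatives vanish, so a first
derivative passes through a contraction. This lets symmetries of traces be differentiated and
divergences be computed by the Leibniz rule. -/
theorem IsNormal.pderiv_contr (hG : IsNormal G U) {k : ℕ} {T : TensorField (k + 2)}
    (hT : SmoothOn T U) (m : Fin 4) (I : Fin k → Fin 4) :
    pderiv m (fun z => BachFlat.contr G T z I) 0
      = ∑ s, pderiv m (fun z => T z (Matrix.vecCons s (Matrix.vecCons s I))) 0 := by
  have hi := hG.differentiableAt_inv
  have hd := fun I => hT.differentiableAt hG.zero_mem I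
  unfold BachFlat.contr
  rw [pderiv_sum _ fun a _ => DifferentiableAt.fun_sum fun b _ => (hi a b).fun_mul (hd _)]
  simp [pderiv_sum _ fun b _ => (hi _ b).fun_mul (hd _), pderiv_mul (hi _ _) (hd _),
    hG.pderiv_inv, hG.inv, Matrix.one_apply]

theorem IsNormal.pderiv_mulT (hG : IsNormal G U) {k l n : ℕ} {a : Fin k → Fin n}
    {b : Fin l → Fin n} {T : TensorField k} {S : TensorField l} (hT : SmoothOn T U)
    (hS : SmoothOn S U) (m : Fin 4) (I : Fin n → Fin 4) :
    pderiv m (fun z => mulT a b T S z I) 0 = pderiv m (fun z => T z (I ∘ a)) 0 * S 0 (I ∘ b)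
      + T 0 (I ∘ a) * pderiv m (fun z => S z (I ∘ b)) 0 :=
  pderiv_mul (hT.differentiableAt hG.zero_mem _) (hS.differentiableAt hG.zero_mem _)

theorem IsNormal.pderiv_christoffel (hG : IsNormal G U) (i k j l : Fin 4) :
    pderiv i (fun z => BachFlat.christoffel G z k j l) 0
      = 1 / 2 * (pderiv i (pderiv j fun z => G z l k) 0 + pderiv i (pderiv l fun z => G z j k) 0
        - pderiv i (pderiv k fun z => G z j l) 0) := by
  have hi := hG.differentiableAt_inv
  have h2 : ∀ a b c, DifferentiableAt ℝ (pderiv a fun z => G z b c) 0 := fun a b c =>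
    (contDiffAt_pderiv (hG.smooth 0 hG.zero_mem b c) a).differentiableAt (by simp)
  have h3 : ∀ s, DifferentiableAt ℝ (fun z => pderiv j (fun z => G z l s) z
      + pderiv l (fun z => G z j s) z - pderiv s (fun z => G z j l) z) 0 := fun s =>
    ((h2 _ _ _).fun_add (h2 _ _ _)).fun_sub (h2 _ _ _)
  unfold BachFlat.christoffel
  rw [pderiv_const_mul _ (DifferentiableAt.fun_sum fun s _ => (hi k s).fun_mul (h3 s)),
    pderiv_sum _ fun s _ => (hi k s).fun_mul (h3 s)]
  simp only [pderiv_mul (hi k _) (h3 _), hG.pderiv_inv, hG.inv, Matrix.one_apply]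
  simp [pderiv_sub ((h2 _ _ _).fun_add (h2 _ _ _)) (h2 _ _ _), pderiv_add (h2 _ _ _) (h2 _ _ _)]

theorem IsNormal.curv (hG : IsNormal G U) (l k i j : Fin 4) : curv G 0 l k i j =
    pderiv i (fun z => BachFlat.christoffel G z l j k) 0
      - pderiv j (fun z => BachFlat.christoffel G z l i k) 0 := by
  simp [BachFlat.curv, hG.christoffel]

theorem IsNormal.riem (hG : IsNormal G U) (i j k l : Fin 4) :
    riem G 0 i j k l = BachFlat.curv G 0 k l i j := by
  simp [BachFlat.riem, hG.apply_zero, Matrix.one_apply]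

theorem IsNormal.differentiableAt_christoffel (hG : IsNormal G U) (k i j : Fin 4) :
    DifferentiableAt ℝ (fun z => BachFlat.christoffel G z k i j) 0 :=
  (smooth_christoffel hG.toIsMetricOn hG.zero_mem k i j).differentiableAt (by simp)

/-- The ΓΓ terms of the curvature vanish to second order at the origin, so its first derivatives
involve only second derivatives of Γ. -/
theorem IsNormal.pderiv_riem (hG : IsNormal G U) (m i j k l : Fin 4) :
    pderiv m (fun z => BachFlat.riem G z i j k l) 0
      = pderiv m (pderiv i fun z => BachFlat.christoffel G z k j l) 0
        - pderiv m (pderiv j fun z => BachFlat.christoffel G z k i l) 0 := by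
  have hc := hG.differentiableAt_christoffel
  have h2 : ∀ a b c d, DifferentiableAt ℝ (pderiv a fun z => BachFlat.christoffel G z b c d) 0 :=
    fun a b c d => (contDiffAt_pderiv
      (smooth_christoffel hG.toIsMetricOn hG.zero_mem b c d) a).differentiableAt (by simp)
  have hR : ∀ s, DifferentiableAt ℝ (fun z => BachFlat.curv G z s l i j) 0 := fun s =>
    (smooth_curv hG.toIsMetricOn hG.zero_mem s l i j).differentiableAt (by simp)
  have hd := fun i j => hG.differentiableAt hG.zero_mem i j
  unfold BachFlat.riem
  rw [pderiv_sum _ fun s _ => (hd k s).fun_mul (hR s)]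
  simp only [pderiv_mul (hd k _) (hR _), hG.pderiv_zero, hG.apply_zero, Matrix.one_apply]
  simp only [zero_mul, zero_add, ite_mul, one_mul, Finset.sum_ite_eq, Finset.mem_univ, if_true]
  have hp : ∀ s, DifferentiableAt ℝ (fun z => BachFlat.christoffel G z k i s *
      BachFlat.christoffel G z s j l - BachFlat.christoffel G z k j s *
      BachFlat.christoffel G z s i l) 0 := fun s =>
    ((hc k i s).fun_mul (hc s j l)).fun_sub ((hc k j s).fun_mul (hc s i l))
  unfold BachFlat.curv
  rw [pderiv_add ((h2 _ _ _ _).fun_sub (h2 _ _ _ _)) (DifferentiableAt.fun_sum fun s _ => hp s),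
    pderiv_sub (h2 _ _ _ _) (h2 _ _ _ _), pderiv_sum _ fun s _ => hp s]
  simp [pderiv_sub ((hc k i _).fun_mul (hc _ j l)) ((hc k j _).fun_mul (hc _ i l)),
    pderiv_mul (hc _ _ _) (hc _ _ _), hG.christoffel]

/-- The second Bianchi identity. -/
theorem IsNormal.second_bianchi (hG : IsNormal G U) (m i j k l : Fin 4) :
    pderiv m (fun z => BachFlat.riem G z i j k l) 0 + pderiv i (fun z => BachFlat.riem G z j m k l) 0
      + pderiv j (fun z => BachFlat.riem G z m i k l) 0 = 0 := by
  have s := fun a b c => smooth_christoffel hG.toIsMetricOn hG.zero_mem a b c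
  simp only [hG.pderiv_riem]
  -- The six second derivatives of Γ cancel in pairs once partial derivatives are commuted.
  rw [pderiv_comm (s k j l) m i, pderiv_comm (s k i l) m j, pderiv_comm (s k m l) i j]
  ring

/-- The Ricci identity. -/
theorem IsNormal.ricci_identity (hG : IsNormal G U) {k : ℕ} {T : TensorField k}
    (hT : SmoothOn T U) (a b : Fin 4) (I : Fin k → Fin 4) :
    BachFlat.covDeriv G (BachFlat.covDeriv G T) 0 (Matrix.vecCons a (Matrix.vecCons b I))
      - BachFlat.covDeriv G (BachFlat.covDeriv G T) 0 (Matrix.vecCons b (Matrix.vecCons a I))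
      = -∑ c : Fin k, ∑ s, BachFlat.riem G 0 a b s (I c) * T 0 (Function.update I c s) := by
  have hc := hG.differentiableAt_christoffel
  have hd := fun I => hT.differentiableAt hG.zero_mem I
  have h2 : ∀ a I, DifferentiableAt ℝ (pderiv a fun z => T z I) 0 :=
    fun a I => (contDiffAt_pderiv (hT I 0 hG.zero_mem) a).differentiableAt (by simp)
  -- The outer derivative is a plain partial derivative here, and only ∂Γ·T survives from the inner
  -- correction terms; the skew part of ∂Γ in a, b is the curvature.
  have e : ∀ a b, BachFlat.covDeriv G (BachFlat.covDeriv G T) 0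
      (Matrix.vecCons a (Matrix.vecCons b I)) = pderiv a (pderiv b fun z => T z I) 0
        - ∑ c : Fin k, ∑ s, pderiv a (fun z => BachFlat.christoffel G z s b (I c)) 0 *
          T 0 (Function.update I c s) := by
    intro a b
    rw [hG.covDeriv]
    simp only [covDeriv_vecCons]
    rw [pderiv_sub (h2 _ _) (DifferentiableAt.fun_sum fun c _ => DifferentiableAt.fun_sum
      fun s _ => (hc _ _ _).fun_mul (hd _)), pderiv_sum _ fun c _ => DifferentiableAt.fun_sum
      fun s _ => (hc _ _ _).fun_mul (hd _)]
    simp [pderiv_sum _ fun s _ => (hc _ _ _).fun_mul (hd _), pderiv_mul (hc _ _ _) (hd _),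
      hG.christoffel]
  rw [e, e, pderiv_comm (hT I 0 hG.zero_mem) a b]
  simp only [hG.riem, hG.curv, sub_mul, Finset.sum_sub_distrib]
  ring

end AtOrigin

/-! ### Symmetries of the curvature -/

section Symmetries

variable {G : LocalMetric} {U : Set E4} {y : E4}

theorem riem_swap (G : LocalMetric) (y : E4) (i j k l : Fin 4) :
    riem G y i j k l = -riem G y j i k l := by
  unfold riem
  rw [← Finset.sum_neg_distrib]
  refine Finset.sum_congr rfl fun s _ => ?_
  rw [curv_swap G y s l i j, mul_neg]

/-- Curvature as a combination of second derivatives of the metric; its algebraic symmetries can be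
read off from this form. -/
theorem IsNormal.riem_eq (hG : IsNormal G U) (i j k l : Fin 4) :
    BachFlat.riem G 0 i j k l = 1 / 2 * (pderiv i (pderiv l fun z => G z j k) 0
      - pderiv i (pderiv k fun z => G z j l) 0 - pderiv j (pderiv l fun z => G z i k) 0
      + pderiv j (pderiv k fun z => G z i l) 0) := by
  rw [hG.riem, hG.curv, hG.pderiv_christoffel, hG.pderiv_christoffel,
    pderiv_comm (hG.smooth 0 hG.zero_mem l k) i j]
  ring

theorem IsNormal.pderiv_pderiv_symm (hG : IsNormal G U) (a b i j : Fin 4) :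
    pderiv a (pderiv b fun z => G z i j) 0 = pderiv a (pderiv b fun z => G z j i) 0 :=
  pderiv_congr <| by
    filter_upwards [hG.isOpen.mem_nhds hG.zero_mem] with z hz using hG.pderiv_symm hz b i j

/-- The difference of the two sides is a natural tensor, so it suffices to look at the Hessian
formula `IsNormal.riem_eq` at the origin. The cyclic identity below is obtained in the same way. -/
theorem riem_pair (hG : IsMetricOn G U) (hy : y ∈ U) (i j k l : Fin 4) :
    riem G y i j k l = riem G y k l i j := by
  have h := Natural.eq_zero (Natural.riemT.sub
    (Natural.riemT.reindex (a := ![2, 3, 0, 1]) (by decide))) (fun H V hH I => ?_) hG hy ![i, j, k, l]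
  · simp [riemT, reindex] at h
    linarith
  · simp [riemT, reindex, hH.riem_eq]
    rw [hH.pderiv_pderiv_symm _ _ (I 1) (I 2), hH.pderiv_pderiv_symm _ _ (I 1) (I 3),
      hH.pderiv_pderiv_symm _ _ (I 0) (I 2), hH.pderiv_pderiv_symm _ _ (I 0) (I 3),
      pderiv_comm (hH.smooth 0 hH.zero_mem _ _) (I 2) (I 1),
      pderiv_comm (hH.smooth 0 hH.zero_mem _ _) (I 2) (I 0),
      pderiv_comm (hH.smooth 0 hH.zero_mem _ _) (I 3) (I 1),
      pderiv_comm (hH.smooth 0 hH.zero_mem _ _) (I 3) (I 0)]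
    ring

theorem riem_cyclic (hG : IsMetricOn G U) (hy : y ∈ U) (i j k l : Fin 4) :
    riem G y i j k l + riem G y j k i l + riem G y k i j l = 0 := by
  have h := Natural.eq_zero ((Natural.riemT.add
    (Natural.riemT.reindex (a := ![1, 2, 0, 3]) (by decide))).add
    (Natural.riemT.reindex (a := ![2, 0, 1, 3]) (by decide))) (fun H V hH I => ?_) hG hy ![i, j, k, l]
  · simpa [riemT, reindex] using h
  · simp [riemT, reindex, hH.riem_eq]
    rw [hH.pderiv_pderiv_symm _ _ (I 1) (I 0), hH.pderiv_pderiv_symm _ _ (I 2) (I 0),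
      hH.pderiv_pderiv_symm _ _ (I 2) (I 1),
      pderiv_comm (hH.smooth 0 hH.zero_mem _ _) (I 2) (I 1),
      pderiv_comm (hH.smooth 0 hH.zero_mem _ _) (I 2) (I 0),
      pderiv_comm (hH.smooth 0 hH.zero_mem _ _) (I 1) (I 0)]
    ring

theorem ric_symm (hG : IsMetricOn G U) (hy : y ∈ U) (i j : Fin 4) :
    ric G y i j = ric G y j i := by
  unfold ric
  rw [Finset.sum_comm]
  refine Finset.sum_congr rfl fun a _ => Finset.sum_congr rfl fun b _ => ?_
  rw [hG.inv_symm hy b a, riem_pair hG hy b i a j]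

end Symmetries

/-! ### Algebraic Weyl tensors in an orthonormal frame -/

/-- The components of a 4-tensor in an orthonormal frame have the symmetries of a Weyl tensor. -/
structure IsWeyl (W : Fin 4 → Fin 4 → Fin 4 → Fin 4 → ℝ) : Prop where
  swap : ∀ i j k l, W i j k l = -W j i k l
  pair : ∀ i j k l, W i j k l = W k l i j
  cyclic : ∀ i j k l, W i j k l + W j k i l + W k i j l = 0
  trace : ∀ j l, ∑ i, W i j i l = 0

/-- The Kronecker symbol. -/
abbrev δ (i j : Fin 4) : ℝ := (1 : Matrix (Fin 4) (Fin 4) ℝ) i j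

namespace IsWeyl

variable {W : Fin 4 → Fin 4 → Fin 4 → Fin 4 → ℝ} (h : IsWeyl W)
include h

theorem swap' (i j k l : Fin 4) : W i j k l = -W i j l k := by
  rw [h.pair, h.swap, h.pair]

theorem diag (i k l : Fin 4) : W i i k l = 0 := by linarith [h.swap i i k l]

theorem diag' (i j k : Fin 4) : W i j k k = 0 := by linarith [h.swap' i j k k]

theorem trace₂ (i k : Fin 4) : ∑ j, W i j k j = 0 := by
  rw [← h.trace i k]
  exact Finset.sum_congr rfl fun j _ => by rw [h.swap, h.swap']; ring

theorem trace₃ (i l : Fin 4) : ∑ j, W i j j l = 0 := by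
  rw [← neg_eq_zero, ← Finset.sum_neg_distrib, ← h.trace i l]
  exact Finset.sum_congr rfl fun j _ => by rw [h.swap]; ring

theorem trace₄ (j k : Fin 4) : ∑ i, W i j k i = 0 := by
  rw [← neg_eq_zero, ← Finset.sum_neg_distrib, ← h.trace j k]
  exact Finset.sum_congr rfl fun i _ => by rw [h.swap']; ring

/-- All components in terms of ten of them. -/
theorem normalForm :
    ((∀ k l, W 1 0 k l = -W 0 1 k l) ∧ (∀ k l, W 2 0 k l = -W 0 2 k l) ∧
      (∀ k l, W 3 0 k l = -W 0 3 k l) ∧ (∀ k l, W 2 1 k l = -W 1 2 k l) ∧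
      (∀ k l, W 3 1 k l = -W 1 3 k l) ∧ (∀ k l, W 3 2 k l = -W 2 3 k l)) ∧
    ((∀ i j, W i j 1 0 = -W i j 0 1) ∧ (∀ i j, W i j 2 0 = -W i j 0 2) ∧
      (∀ i j, W i j 3 0 = -W i j 0 3) ∧ (∀ i j, W i j 2 1 = -W i j 1 2) ∧
      (∀ i j, W i j 3 1 = -W i j 1 3) ∧ (∀ i j, W i j 3 2 = -W i j 2 3)) ∧
    (W 0 2 0 1 = W 0 1 0 2 ∧ W 0 3 0 1 = W 0 1 0 3 ∧ W 0 3 0 2 = W 0 2 0 3 ∧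
      W 2 3 0 1 = W 0 1 2 3 ∧ W 1 3 0 2 = W 0 2 1 3 ∧ W 0 3 1 2 = W 0 2 1 3 - W 0 1 2 3 ∧
      W 1 2 0 3 = W 0 2 1 3 - W 0 1 2 3) ∧
    (W 1 2 1 2 = -W 0 1 0 1 - W 0 2 0 2 ∧ W 0 3 0 3 = -W 0 1 0 1 - W 0 2 0 2 ∧
      W 1 3 1 3 = W 0 2 0 2 ∧ W 2 3 2 3 = W 0 1 0 1) ∧
    (W 0 3 1 3 = -W 0 2 1 2 ∧ W 1 3 0 3 = -W 0 2 1 2 ∧ W 1 2 0 2 = W 0 2 1 2 ∧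
      W 0 3 2 3 = W 0 1 1 2 ∧ W 2 3 0 3 = W 0 1 1 2 ∧ W 1 2 0 1 = W 0 1 1 2 ∧
      W 0 2 2 3 = -W 0 1 1 3 ∧ W 2 3 0 2 = -W 0 1 1 3 ∧ W 1 3 0 1 = W 0 1 1 3) ∧
    (W 1 3 2 3 = -W 0 1 0 2 ∧ W 2 3 1 3 = -W 0 1 0 2 ∧ W 1 2 2 3 = W 0 1 0 3 ∧
      W 2 3 1 2 = W 0 1 0 3 ∧ W 1 2 1 3 = -W 0 2 0 3 ∧ W 1 3 1 2 = -W 0 2 0 3) := by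
  have t := h.trace
  simp only [Fin.sum_univ_four] at t
  have s := h.swap
  have s' := h.swap'
  have p := h.pair
  have d := h.diag
  have d' := h.diag'
  have l10 := s 1 0
  have l20 := s 2 0
  have l30 := s 3 0
  have l21 := s 2 1
  have l31 := s 3 1
  have l32 := s 3 2
  have r10 : ∀ i j, W i j 1 0 = -W i j 0 1 := fun i j => s' i j 1 0
  have r20 : ∀ i j, W i j 2 0 = -W i j 0 2 := fun i j => s' i j 2 0
  have r30 : ∀ i j, W i j 3 0 = -W i j 0 3 := fun i j => s' i j 3 0
  have r21 : ∀ i j, W i j 2 1 = -W i j 1 2 := fun i j => s' i j 2 1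
  have r31 : ∀ i j, W i j 3 1 = -W i j 1 3 := fun i j => s' i j 3 1
  have r32 : ∀ i j, W i j 3 2 = -W i j 2 3 := fun i j => s' i j 3 2
  have p1 := p 0 2 0 1
  have p2 := p 0 3 0 1
  have p3 := p 0 3 0 2
  have p4 := p 1 2 0 1
  have p5 := p 1 3 0 1
  have p6 := p 2 3 0 1
  have p7 := p 1 2 0 2
  have p8 := p 1 3 0 2
  have p9 := p 2 3 0 2
  have p10 := p 1 2 0 3
  have p11 := p 1 3 0 3
  have p12 := p 2 3 0 3
  have p13 := p 1 3 1 2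
  have p14 := p 2 3 1 2
  have p15 := p 2 3 1 3
  -- Given the other symmetries, only the cyclic identity with four distinct indices carries
  -- information in dimension four.
  have c := h.cyclic 0 1 2 3
  have t00 := t 0 0
  have t11 := t 1 1
  have t22 := t 2 2
  have t33 := t 3 3
  have t01 := t 0 1
  have t02 := t 0 2
  have t03 := t 0 3
  have t12 := t 1 2
  have t13 := t 1 3
  have t23 := t 2 3
  simp only [d, d', l10, l20, l30, l21, l31, l32, r10, r20, r30, r21, r31, r32, p1, p2, p3, p4, p5,
    p6, p7, p8, p9, p10, p11, p12, p13, p14, p15, implies_true, true_and, and_true]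
    at c t00 t11 t22 t33 t01 t02 t03 t12 t13 t23 ⊢
  repeat' apply And.intro
  all_goals linarith

theorem normSq_eq : ∑ i, ∑ j, ∑ k, ∑ l, W i j k l ^ 2
    = 16 * (W 0 1 0 1 ^ 2 + W 0 2 0 2 ^ 2 + W 0 1 0 1 * W 0 2 0 2 + W 0 1 0 2 ^ 2 + W 0 1 0 3 ^ 2
      + W 0 2 0 3 ^ 2 + W 0 1 1 2 ^ 2 + W 0 1 1 3 ^ 2 + W 0 2 1 2 ^ 2 + W 0 1 2 3 ^ 2
      + W 0 2 1 3 ^ 2 - W 0 1 2 3 * W 0 2 1 3) := by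
  obtain ⟨⟨_, _, _, _, _, _⟩, ⟨_, _, _, _, _, _⟩, ⟨_, _, _, _, _, _, _⟩, ⟨_, _, _, _⟩,
    ⟨_, _, _, _, _, _, _, _, _⟩, _, _, _, _, _, _⟩ := h.normalForm
  have d := h.diag
  have d' := h.diag'
  clear h
  simp only [Fin.sum_univ_four]
  simp only [*]
  ring

set_option maxHeartbeats 1000000 in
-- Special to dimension four: the triple contraction of W with itself is pure trace. Both sides are
-- compared in the ten components of `normalForm`.
theorem quadratic (i s : Fin 4) : ∑ j, ∑ k, ∑ l, W i j k l * W s j k l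
    = 1 / 4 * (∑ i, ∑ j, ∑ k, ∑ l, W i j k l ^ 2) * δ i s := by
  rw [h.normSq_eq]
  obtain ⟨⟨_, _, _, _, _, _⟩, ⟨_, _, _, _, _, _⟩, ⟨_, _, _, _, _, _, _⟩, ⟨_, _, _, _⟩,
    ⟨_, _, _, _, _, _, _, _, _⟩, _, _, _, _, _, _⟩ := h.normalForm
  have d := h.diag
  have d' := h.diag'
  clear h
  simp only [Fin.sum_univ_four, δ, Matrix.one_apply]
  fin_cases i <;> fin_cases s <;> simp only [Fin.reduceFinMk, Fin.isValue, Fin.zero_eta, Fin.mk_one,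
    Fin.reduceEq, if_true, if_false, *] <;> ring

/-- In dimension four the cubic invariants of W that do not depend on an orientation form a line, so
these two full contractions are proportional. The factor ½ is verified in the ten components. -/
theorem cubic : ∑ i, ∑ j, ∑ m, ∑ k, ∑ l, ∑ s, W i j k l * W m i s k * W m j s l
    = 1 / 2 * ∑ i, ∑ j, ∑ k, ∑ l, ∑ m, ∑ n, W i j k l * W k l m n * W m n i j := by
  obtain ⟨⟨_, _, _, _, _, _⟩, ⟨_, _, _, _, _, _⟩, ⟨_, _, _, _, _, _, _⟩, ⟨_, _, _, _⟩,
    ⟨_, _, _, _, _, _, _, _, _⟩, _, _, _, _, _, _⟩ := h.normalForm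
  have d := h.diag
  have d' := h.diag'
  clear h
  simp only [Fin.sum_univ_four]
  simp only [*, mul_zero, zero_mul, add_zero, zero_add]
  ring

end IsWeyl

theorem δ_symm (i j : Fin 4) : δ i j = δ j i := by
  simp [Matrix.one_apply, eq_comm]

theorem sum_mul_δ (f : Fin 4 → ℝ) (j : Fin 4) : ∑ i, f i * δ j i = f j := by
  simp [Matrix.one_apply]

theorem sum_rot₃ (f : Fin 4 → Fin 4 → Fin 4 → ℝ) :
    ∑ a, ∑ b, ∑ c, f a b c = ∑ c, ∑ a, ∑ b, f a b c :=
  (Finset.sum_congr rfl fun _ _ => Finset.sum_comm).trans Finset.sum_comm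

theorem sum_rot₄ (f : Fin 4 → Fin 4 → Fin 4 → Fin 4 → ℝ) :
    ∑ a, ∑ b, ∑ c, ∑ d, f a b c d = ∑ d, ∑ a, ∑ b, ∑ c, f a b c d :=
  (Finset.sum_congr rfl fun _ _ => sum_rot₃ _).trans Finset.sum_comm

theorem sum_rot₅ (f : Fin 4 → Fin 4 → Fin 4 → Fin 4 → Fin 4 → ℝ) :
    ∑ a, ∑ b, ∑ c, ∑ d, ∑ e, f a b c d e = ∑ e, ∑ a, ∑ b, ∑ c, ∑ d, f a b c d e :=
  (Finset.sum_congr rfl fun _ _ => sum_rot₄ _).trans Finset.sum_comm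

namespace IsWeyl

variable {W : Fin 4 → Fin 4 → Fin 4 → Fin 4 → ℝ} (h : IsWeyl W)
include h

/-- The cyclic identity splits W_{sjkl} as W_{skjl} + W_{slkj}. The two halves contract equally with
W_{ijkl} by skew-symmetry in k, l, so each is half of `quadratic`. -/
theorem quadratic_swap (i s : Fin 4) : ∑ j, ∑ k, ∑ l, W i j k l * W s l k j
    = 1 / 8 * (∑ i, ∑ j, ∑ k, ∑ l, W i j k l ^ 2) * δ i s := by
  have h1 := h.quadratic i s
  have h2 : ∑ j, ∑ k, ∑ l, W i j k l * W s k j l = ∑ j, ∑ k, ∑ l, W i j k l * W s l k j := by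
    refine Finset.sum_congr rfl fun j _ => ?_
    rw [Finset.sum_comm]
    refine Finset.sum_congr rfl fun k _ => Finset.sum_congr rfl fun l _ => ?_
    rw [h.swap' i j l k, h.swap' s l j k]
    ring
  have h3 : ∑ j, ∑ k, ∑ l, W i j k l * W s j k l = ∑ j, ∑ k, ∑ l, W i j k l * W s k j l
      + ∑ j, ∑ k, ∑ l, W i j k l * W s l k j := by
    simp only [← Finset.sum_add_distrib]
    refine Finset.sum_congr rfl fun j _ => Finset.sum_congr rfl fun k _ =>
      Finset.sum_congr rfl fun l _ => ?_
    have c := h.cyclic j k l s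
    rw [h.pair j k l s, h.pair k l j s, h.pair l j k s, h.swap l s, h.swap j s, h.swap k s] at c
    rw [h.swap' s k j l, h.swap' s l k j]
    linear_combination (- W i j k l) * c
  linarith

/-- A Weyl tensor is orthogonal to the products with the metric. -/
theorem kulkarniNomizu_orth (a b c d : Fin 4 → Fin 4 → ℝ) :
    ∑ i, ∑ j, ∑ k, ∑ l, W i j k l * (a i k * δ j l + b j l * δ i k - c i l * δ j k - d j k * δ i l)
      = 0 := by
  have e1 : ∑ i, ∑ j, ∑ k, ∑ l, W i j k l * (a i k * δ j l) = 0 := by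
    refine Finset.sum_eq_zero fun i _ => ?_
    rw [Finset.sum_comm]
    refine Finset.sum_eq_zero fun k _ => ?_
    simp only [← mul_assoc, sum_mul_δ, ← Finset.sum_mul, h.trace₂, zero_mul]
  have e2 : ∑ i, ∑ j, ∑ k, ∑ l, W i j k l * (b j l * δ i k) = 0 := by
    rw [Finset.sum_comm]
    refine Finset.sum_eq_zero fun j _ => ?_
    rw [Finset.sum_congr rfl fun _ _ => Finset.sum_comm, Finset.sum_comm]
    refine Finset.sum_eq_zero fun l _ => ?_
    simp only [← mul_assoc, sum_mul_δ, ← Finset.sum_mul, h.trace, zero_mul]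
  have e3 : ∑ i, ∑ j, ∑ k, ∑ l, W i j k l * (c i l * δ j k) = 0 := by
    refine Finset.sum_eq_zero fun i _ => ?_
    rw [Finset.sum_congr rfl fun _ _ => Finset.sum_comm, Finset.sum_comm]
    refine Finset.sum_eq_zero fun l _ => ?_
    simp only [← mul_assoc, sum_mul_δ, ← Finset.sum_mul, h.trace₃, zero_mul]
  have e4 : ∑ i, ∑ j, ∑ k, ∑ l, W i j k l * (d j k * δ i l) = 0 := by
    rw [Finset.sum_comm]
    refine Finset.sum_eq_zero fun j _ => ?_
    rw [Finset.sum_comm]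
    refine Finset.sum_eq_zero fun k _ => ?_
    simp only [← mul_assoc, sum_mul_δ, ← Finset.sum_mul, h.trace₄, zero_mul]
  simp only [mul_add, mul_sub, Finset.sum_add_distrib, Finset.sum_sub_distrib, e1, e2, e3, e4]
  ring

/-- The curvature term in the Weitzenböck formula for the Weyl tensor. -/
theorem weitzenbock {P : Fin 4 → Fin 4 → ℝ} (hP : ∀ i j, P i j = P j i)
    {R : Fin 4 → Fin 4 → Fin 4 → Fin 4 → ℝ}
    (hR : ∀ i j k l, R i j k l = W i j k l + (P i k * δ j l + P j l * δ i k - P i l * δ j k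
      - P j k * δ i l)) :
    ∑ i, ∑ j, ∑ k, ∑ l, W i j k l * ∑ m, ∑ s, (R m i s m * W s j k l + R m i s j * W m s k l
      + R m i s k * W m j s l + R m i s l * W m j k s)
      = 3 / 2 * ∑ i, ∑ j, ∑ k, ∑ l, ∑ m, ∑ n, W i j k l * W k l m n * W m n i j
        - 3 / 2 * (∑ i, P i i) * ∑ i, ∑ j, ∑ k, ∑ l, W i j k l ^ 2 := by
  set N := ∑ i, ∑ j, ∑ k, ∑ l, W i j k l ^ 2 with hN
  set T := ∑ i, ∑ j, ∑ k, ∑ l, ∑ m, ∑ n, W i j k l * W k l m n * W m n i j with hT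
  have q := h.quadratic
  have q' := h.quadratic_swap
  rw [← hN] at q q'
  have tr : ∀ c : ℝ, ∑ i, ∑ s, P i s * (c * N * δ i s) = c * N * ∑ i, P i i := by
    intro c
    rw [Finset.mul_sum (Finset.univ : Finset (Fin 4)) (fun i => P i i) (c * N)]
    refine Finset.sum_congr rfl fun i _ => ?_
    have e : ∀ s, P i s * (c * N * δ i s) = (c * N * P i s) * δ i s := fun s => by ring
    simp only [e, sum_mul_δ]
  -- P is the Schouten tensor, R = W + P ∧ g. The four curvature terms are treated one by one; in
  -- this first one R enters only through its Ricci contraction, with a minus sign because the first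
  -- and last indices are traced.
  have ha : ∑ i, ∑ j, ∑ k, ∑ l, W i j k l * ∑ m, ∑ s, R m i s m * W s j k l
      = -(3 / 2) * (∑ i, P i i) * N := by
    have hr : ∀ i s, ∑ m, R m i s m = -(2 * P i s + (∑ i, P i i) * δ i s) := by
      intro i s
      simp only [hR, Finset.sum_add_distrib, Finset.sum_sub_distrib, h.trace₄, sum_mul_δ,
        ← Finset.sum_mul]
      simp [Matrix.one_apply]
      ring
    have e : ∑ i, ∑ j, ∑ k, ∑ l, W i j k l * ∑ m, ∑ s, R m i s m * W s j k l
        = ∑ i, ∑ s, (∑ m, R m i s m) * ∑ j, ∑ k, ∑ l, W i j k l * W s j k l := by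
      refine Finset.sum_congr rfl fun i _ => ?_
      simp only [Finset.mul_sum, Finset.sum_mul]
      refine (sum_rot₅ _).trans ?_
      exact Finset.sum_congr rfl fun _ _ => Finset.sum_congr rfl fun _ _ =>
        Finset.sum_congr rfl fun _ _ => Finset.sum_congr rfl fun _ _ =>
        Finset.sum_congr rfl fun _ _ => by ring
    rw [e]
    simp only [hr, q]
    have e2 : ∀ i s, -(2 * P i s + (∑ i, P i i) * δ i s) * (1 / 4 * N * δ i s)
        = P i s * (-(1 / 2) * N * δ i s) + (-(1 / 4) * N * (∑ i, P i i)) * (δ i s * δ i s) := by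
      intro i s; ring
    simp only [e2, Finset.sum_add_distrib, tr, ← Finset.mul_sum]
    simp [Matrix.one_apply]
    ring
  -- The cyclic identity writes T as twice this sum.
  have hbW : ∑ i, ∑ j, ∑ k, ∑ l, ∑ m, ∑ s, W i j k l * W m i s j * W m s k l = 1 / 2 * T := by
    have e1 : ∑ i, ∑ j, ∑ k, ∑ l, ∑ m, ∑ s, W i j k l * W m i s j * W m s k l
        = -∑ i, ∑ j, ∑ k, ∑ l, ∑ m, ∑ s, W i j k l * W s i m j * W m s k l := by
      simp only [← Finset.sum_neg_distrib]
      refine Finset.sum_congr rfl fun i _ => Finset.sum_congr rfl fun j _ =>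
        Finset.sum_congr rfl fun k _ => Finset.sum_congr rfl fun l _ => ?_
      rw [Finset.sum_comm]
      refine Finset.sum_congr rfl fun m _ => Finset.sum_congr rfl fun s _ => ?_
      rw [h.swap s m k l]
      ring
    have e2 : T = ∑ i, ∑ j, ∑ k, ∑ l, ∑ m, ∑ s, W i j k l * W m i s j * W m s k l
        - ∑ i, ∑ j, ∑ k, ∑ l, ∑ m, ∑ s, W i j k l * W s i m j * W m s k l := by
      simp only [hT, ← Finset.sum_sub_distrib]
      refine Finset.sum_congr rfl fun i _ => Finset.sum_congr rfl fun j _ =>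
        Finset.sum_congr rfl fun k _ => Finset.sum_congr rfl fun l _ =>
        Finset.sum_congr rfl fun m _ => Finset.sum_congr rfl fun s _ => ?_
      have c := h.cyclic m i s j
      rw [h.swap i s, h.swap s m] at c
      rw [h.pair k l m s]
      linear_combination (- W i j k l * W m s k l) * c
    linarith
  -- Terms with δ_{ij} or δ_{ms} meet a skew pair of W and vanish; the other two are contractions of
  -- P with `quadratic`.
  have hbP : ∑ i, ∑ j, ∑ k, ∑ l, W i j k l * ∑ m, ∑ s, (P m s * δ i j + P i j * δ m s
      - P m j * δ i s - P i s * δ m j) * W m s k l = 1 / 2 * (∑ i, P i i) * N := by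
    have e : ∀ i j k l, W i j k l * ∑ m, ∑ s, (P m s * δ i j + P i j * δ m s
        - P m j * δ i s - P i s * δ m j) * W m s k l
        = ∑ m, P j m * (W j i k l * W m i k l) + ∑ s, P i s * (W i j k l * W s j k l) := by
      intro i j k l
      have e1 : W i j k l * δ i j = 0 := by
        by_cases hij : i = j
        · rw [hij, h.diag, zero_mul]
        · simp [hij]
      have e2 : ∀ m s, δ m s * W m s k l = 0 := fun m s => by
        by_cases hij : m = s
        · rw [hij, h.diag, mul_zero]
        · simp [hij]
      have e3 : ∑ m, ∑ s, W m s k l * P m j * δ i s = ∑ m, W m i k l * P m j := by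
        simp only [sum_mul_δ]
      have e4 : ∑ m, ∑ s, W m s k l * P i s * δ m j = ∑ s, W j s k l * P i s := by
        rw [Finset.sum_comm]
        simp only [δ_symm _ j, sum_mul_δ]
      have e5 : W i j k l * ∑ m, ∑ s, (P m s * δ i j + P i j * δ m s
          - P m j * δ i s - P i s * δ m j) * W m s k l
          = -W i j k l * (∑ m, ∑ s, W m s k l * P m j * δ i s)
            - W i j k l * (∑ m, ∑ s, W m s k l * P i s * δ m j) := by
        simp only [Finset.mul_sum, ← Finset.sum_sub_distrib]
        refine Finset.sum_congr rfl fun m _ => Finset.sum_congr rfl fun s _ => ?_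
        linear_combination (P m s * W m s k l) * e1 + (W i j k l * P i j) * e2 m s
      rw [e5, e3, e4, h.swap j i k l]
      simp only [Finset.mul_sum, ← Finset.sum_sub_distrib, ← Finset.sum_add_distrib]
      refine Finset.sum_congr rfl fun m _ => ?_
      rw [h.swap j m, hP j m]
      ring
    have g : ∀ i, ∑ j, ∑ k, ∑ l, ∑ s, P i s * (W i j k l * W s j k l)
        = ∑ s, P i s * (1 / 4 * N * δ i s) := by
      intro i
      rw [sum_rot₄]
      simp only [← Finset.mul_sum, q]
    simp only [e, Finset.sum_add_distrib]
    rw [Finset.sum_comm]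
    simp only [g, tr]
    ring
  have hcW : ∑ i, ∑ j, ∑ k, ∑ l, ∑ m, ∑ s, W i j k l * W m i s k * W m j s l = 1 / 2 * T := by
    rw [← h.cubic]
    exact Finset.sum_congr rfl fun i _ => Finset.sum_congr rfl fun j _ => sum_rot₃ _
  -- The δ_{ms} term is a trace of W, and the δ_{ik} term vanishes by orthogonality to products with
  -- the metric. Each of the other two gives −⅛ tr P |W|² by `quadratic_swap`.
  have hcP : ∑ i, ∑ j, ∑ k, ∑ l, W i j k l * ∑ m, ∑ s, (P m s * δ i k + P i k * δ m s
      - P m k * δ i s - P i s * δ m k) * W m j s l = -(1 / 4) * (∑ i, P i i) * N := by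
    have e : ∀ i j k l, ∑ m, ∑ s, (P m s * δ i k + P i k * δ m s
        - P m k * δ i s - P i s * δ m k) * W m j s l
        = (∑ m, ∑ s, P m s * W m j s l) * δ i k - ∑ m, P k m * W m j i l
          - ∑ s, P i s * W k j s l := by
      intro i j k l
      have e2 : ∑ m, ∑ s, W m j s l * δ m s = 0 := by
        simp only [sum_mul_δ, h.trace]
      have e3 : ∑ m, ∑ s, W m j s l * P m k * δ i s = ∑ m, P k m * W m j i l := by
        simp only [sum_mul_δ, hP k, mul_comm]
      have e4 : ∑ m, ∑ s, W m j s l * P i s * δ m k = ∑ s, P i s * W k j s l := by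
        rw [Finset.sum_comm]
        simp only [δ_symm _ k, sum_mul_δ, mul_comm]
      have e5 : ∑ m, ∑ s, (P m s * δ i k + P i k * δ m s
          - P m k * δ i s - P i s * δ m k) * W m j s l
          = (∑ m, ∑ s, P m s * W m j s l) * δ i k + P i k * (∑ m, ∑ s, W m j s l * δ m s)
            - (∑ m, ∑ s, W m j s l * P m k * δ i s) - ∑ m, ∑ s, W m j s l * P i s * δ m k := by
        simp only [Finset.mul_sum, Finset.sum_mul, ← Finset.sum_sub_distrib,
          ← Finset.sum_add_distrib]
        exact Finset.sum_congr rfl fun m _ => Finset.sum_congr rfl fun s _ => by ring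
      rw [e5, e2, e3, e4]
      ring
    have o := h.kulkarniNomizu_orth 0 (fun j l => ∑ m, ∑ s, P m s * W m j s l) 0 0
    simp only [Pi.zero_apply, zero_mul, zero_add, sub_zero] at o
    have g : ∀ i, ∑ j, ∑ k, ∑ l, W i j k l * ∑ s, P i s * W k j s l
        = ∑ s, P i s * (1 / 8 * N * δ i s) := by
      intro i
      simp only [← q', Finset.mul_sum]
      refine (sum_rot₄ _).trans ?_
      refine Finset.sum_congr rfl fun s _ => Finset.sum_congr rfl fun j _ =>
        Finset.sum_congr rfl fun k _ => Finset.sum_congr rfl fun l _ => ?_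
      rw [h.pair k j s l]
      ring
    have g' : ∑ i, ∑ j, ∑ k, ∑ l, W i j k l * ∑ m, P k m * W m j i l
        = ∑ k, ∑ m, P k m * (1 / 8 * N * δ k m) := by
      simp only [← q', Finset.mul_sum]
      refine (sum_rot₃ _).trans (Finset.sum_congr rfl fun k _ => (sum_rot₄ _).trans ?_)
      refine Finset.sum_congr rfl fun m _ => (sum_rot₃ _).trans ?_
      refine Finset.sum_congr rfl fun l _ => Finset.sum_congr rfl fun i _ =>
        Finset.sum_congr rfl fun j _ => ?_
      rw [h.pair i j k l]
      ring
    simp only [e, mul_sub, Finset.sum_sub_distrib, o, g, g', tr]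
    ring
  -- The fourth term equals the third, by skew-symmetry of W in its last two indices.
  have hd : ∑ i, ∑ j, ∑ k, ∑ l, W i j k l * ∑ m, ∑ s, R m i s l * W m j k s
      = ∑ i, ∑ j, ∑ k, ∑ l, W i j k l * ∑ m, ∑ s, R m i s k * W m j s l := by
    refine Finset.sum_congr rfl fun i _ => Finset.sum_congr rfl fun j _ => ?_
    rw [Finset.sum_comm]
    refine Finset.sum_congr rfl fun k _ => Finset.sum_congr rfl fun l _ => ?_
    rw [h.swap' i j l k]
    simp only [Finset.mul_sum]
    refine Finset.sum_congr rfl fun m _ => Finset.sum_congr rfl fun s _ => ?_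
    rw [h.swap' m j l s]
    ring
  have hb : ∑ i, ∑ j, ∑ k, ∑ l, W i j k l * ∑ m, ∑ s, R m i s j * W m s k l
      = 1 / 2 * T + 1 / 2 * (∑ i, P i i) * N := by
    rw [← hbW, ← hbP]
    simp only [Finset.mul_sum, ← Finset.sum_add_distrib, hR]
    refine Finset.sum_congr rfl fun i _ => Finset.sum_congr rfl fun j _ =>
        Finset.sum_congr rfl fun k _ => Finset.sum_congr rfl fun l _ =>
        Finset.sum_congr rfl fun m _ => Finset.sum_congr rfl fun s _ => by ring
  have hc : ∑ i, ∑ j, ∑ k, ∑ l, W i j k l * ∑ m, ∑ s, R m i s k * W m j s l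
      = 1 / 2 * T + -(1 / 4) * (∑ i, P i i) * N := by
    rw [← hcW, ← hcP]
    simp only [Finset.mul_sum, ← Finset.sum_add_distrib, hR]
    refine Finset.sum_congr rfl fun i _ => Finset.sum_congr rfl fun j _ =>
        Finset.sum_congr rfl fun k _ => Finset.sum_congr rfl fun l _ =>
        Finset.sum_congr rfl fun m _ => Finset.sum_congr rfl fun s _ => by ring
  simp only [mul_add, Finset.sum_add_distrib]
  rw [hd, ha, hb, hc]
  ring

end IsWeyl

/-! ### First derivatives of the curvature: contracted Bianchi identities -/

/-- The components of the covariant derivative of a curvature tensor in an orthonormal frame. -/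
structure IsCurvatureDerivative (N : Fin 4 → Fin 4 → Fin 4 → Fin 4 → Fin 4 → ℝ) : Prop where
  swap : ∀ m i j k l, N m i j k l = -N m j i k l
  pair : ∀ m i j k l, N m i j k l = N m k l i j
  bianchi : ∀ m i j k l, N m i j k l + N i j m k l + N j m i k l = 0

namespace IsCurvatureDerivative

variable {N : Fin 4 → Fin 4 → Fin 4 → Fin 4 → Fin 4 → ℝ} (h : IsCurvatureDerivative N)
  {S : Fin 4 → Fin 4 → Fin 4 → ℝ} (hS : ∀ m j l, S m j l = ∑ i, N m i j i l)
  {r : Fin 4 → ℝ} (hr : ∀ m, r m = ∑ i, S m i i)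
  {P : Fin 4 → Fin 4 → Fin 4 → ℝ} (hP : ∀ m i j, P m i j = 1 / 2 * (S m i j - 1 / 6 * r m * δ i j))
  {D : Fin 4 → Fin 4 → Fin 4 → Fin 4 → Fin 4 → ℝ} (hD : ∀ m i j k l, D m i j k l = N m i j k l
    - (P m i k * δ j l + P m j l * δ i k - P m i l * δ j k - P m j k * δ i l))
  (hW : ∀ m, IsWeyl (D m))
  {V : Fin 4 → Fin 4 → Fin 4 → ℝ} (hV : ∀ j k l, V j k l = ∑ i, D i i j k l)

include h

theorem swap' (m i j k l : Fin 4) : N m i j k l = -N m i j l k := by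
  rw [h.pair, h.swap, h.pair]

include hS

theorem ric_symm (m j l : Fin 4) : S m j l = S m l j := by
  rw [hS, hS]
  exact Finset.sum_congr rfl fun i _ => h.pair _ _ _ _ _

/-- The second Bianchi identity contracted once. Throughout, N, S, r, P, D and V play the roles of
∇Riem, ∇Ric, dR, the derivative of the Schouten tensor, ∇W and div W at a point, the index of
differentiation coming first. -/
theorem div_riem (j k l : Fin 4) : ∑ i, N i i j k l = S k j l - S l j k := by
  rw [hS, hS, ← Finset.sum_sub_distrib]
  refine Finset.sum_congr rfl fun i _ => ?_
  have b := h.bianchi i k l i j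
  rw [h.pair i k l i j, h.swap k l i, h.pair k i l i j, h.pair l i k i j] at b
  linarith

include hr

/-- The twice contracted Bianchi identity, div Ric = ½ dR. -/
theorem div_ric (k : Fin 4) : ∑ i, S i i k = 1 / 2 * r k := by
  have e : ∑ j, ∑ i, N i i j k j = ∑ i, S i i k := by
    rw [Finset.sum_comm]
    refine Finset.sum_congr rfl fun i _ => ?_
    rw [hS]
    refine Finset.sum_congr rfl fun j _ => ?_
    rw [h.swap, h.swap']
    ring
  simp only [h.div_riem hS, Finset.sum_sub_distrib, ← hr] at e
  linarith

omit hr in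
include hP in
theorem schouten_symm (m i j : Fin 4) : P m i j = P m j i := by
  rw [hP, hP, h.ric_symm hS, δ_symm]

include hP hD hV

/-- The divergence of W is the Cotton tensor, the skew derivative of the Schouten tensor. In
dimension n the factor is n − 3, which is 1 here. -/
theorem div_weyl (j k l : Fin 4) : V j k l = P k j l - P l j k := by
  have e : ∀ k, ∑ i, P i i k = 1 / 6 * r k := by
    intro k
    simp only [hP, ← Finset.mul_sum, Finset.sum_sub_distrib, h.div_ric hS hr]
    have : ∀ i, 1 / 6 * r i * δ i k = 1 / 6 * r i * δ k i := fun i => by rw [δ_symm]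
    simp only [this, sum_mul_δ]
    ring
  have e' : ∀ f : Fin 4 → ℝ, ∀ k, ∑ i, f i * δ i k = f k := fun f k => by
    simp only [δ_symm _ k, sum_mul_δ]
  rw [hV]
  simp only [hD, Finset.sum_sub_distrib, Finset.sum_add_distrib, h.div_riem hS, ← Finset.sum_mul,
    e, e']
  simp only [hP]
  rw [h.ric_symm hS k j l]
  ring

include hW

/-- The quadratic form of the derivative of the Weyl tensor, by the second Bianchi identity. -/
theorem normSq_weyl : ∑ m, ∑ i, ∑ j, ∑ k, ∑ l, D m i j k l ^ 2
    = 2 * ∑ m, ∑ i, ∑ j, ∑ k, ∑ l, D m i j k l * D i m j k l + 2 * ∑ j, ∑ k, ∑ l, V j k l ^ 2 := by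
  have hp := h.schouten_symm hS hP
  have hv := h.div_weyl hS hr hP hD hV
  -- ∇Riem satisfies the Bianchi identity, so the cyclic sum of ∇W comes from ∇P ∧ g alone. It is
  -- grouped into products with the metric in the slots i, j, k, l and two terms containing div W.
  have cyc : ∀ m i j k l, D m i j k l + D i j m k l + D j m i k l =
      -((((P m i k - P i m k) * δ j l + (P m j l - P j m l) * δ i k - (P m i l - P i m l) * δ j k
        - (P m j k - P j m k) * δ i l)) + V k i j * δ m l - V l i j * δ m k) := by
    intro m i j k l
    rw [hD, hD, hD, hv, hv]
    rw [hp i k j, hp j k i, hp i l j, hp j l i]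
    linear_combination h.bianchi m i j k l
  have e1 : ∑ m, ∑ i, ∑ j, ∑ k, ∑ l, D m i j k l * (D m i j k l + D i j m k l + D j m i k l)
      = 2 * ∑ j, ∑ k, ∑ l, V j k l ^ 2 := by
    -- The grouped products are orthogonal to the Weyl tensor D m; each of the two remaining terms
    -- contributes one |div W|².
    have o : ∀ m, ∑ i, ∑ j, ∑ k, ∑ l, D m i j k l *
        ((P m i k - P i m k) * δ j l + (P m j l - P j m l) * δ i k - (P m i l - P i m l) * δ j k
        - (P m j k - P j m k) * δ i l) = 0 := fun m =>
      (hW m).kulkarniNomizu_orth (fun i k => P m i k - P i m k) (fun j l => P m j l - P j m l)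
        (fun i l => P m i l - P i m l) (fun j k => P m j k - P j m k)
    have e0 : ∑ m, ∑ i, ∑ j, ∑ k, D m m k i j * V k i j = ∑ j, ∑ k, ∑ l, V j k l ^ 2 := by
      refine (sum_rot₄ fun i j k m => D m m k i j * V k i j).symm.trans ((sum_rot₃ _).trans ?_)
      simp only [← Finset.sum_mul, ← hV, ← pow_two]
    have e2 : ∑ m, ∑ i, ∑ j, ∑ k, ∑ l, D m i j k l * (V k i j * δ m l)
        = -∑ j, ∑ k, ∑ l, V j k l ^ 2 := by
      have : ∀ m i j k, ∑ l, D m i j k l * (V k i j * δ m l) = -(D m m k i j * V k i j) := by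
        intro m i j k
        simp only [← mul_assoc, sum_mul_δ]
        rw [(hW m).swap', (hW m).pair]
        ring
      simp only [this, Finset.sum_neg_distrib, e0]
    have e3 : ∑ m, ∑ i, ∑ j, ∑ k, ∑ l, D m i j k l * (V l i j * δ m k)
        = ∑ j, ∑ k, ∑ l, V j k l ^ 2 := by
      rw [← e0]
      refine Finset.sum_congr rfl fun m _ => Finset.sum_congr rfl fun i _ =>
        Finset.sum_congr rfl fun j _ => ?_
      rw [Finset.sum_comm]
      refine Finset.sum_congr rfl fun l _ => ?_
      simp only [← mul_assoc, sum_mul_δ]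
      rw [(hW m).pair]
    simp only [cyc, mul_neg, Finset.sum_neg_distrib, mul_sub _ _ (V _ _ _ * _),
      mul_add _ _ (V _ _ _ * _), Finset.sum_sub_distrib, Finset.sum_add_distrib, o, e2, e3]
    simp
    ring
  -- Both rotated terms of the cyclic sum have the same inner product with D, by skew-symmetry in i,
  -- j.
  have e4 : ∑ m, ∑ i, ∑ j, ∑ k, ∑ l, D m i j k l * D j m i k l
      = ∑ m, ∑ i, ∑ j, ∑ k, ∑ l, D m i j k l * D i j m k l := by
    refine Finset.sum_congr rfl fun m _ => ?_
    rw [Finset.sum_comm]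
    refine Finset.sum_congr rfl fun i _ => Finset.sum_congr rfl fun j _ =>
      Finset.sum_congr rfl fun k _ => Finset.sum_congr rfl fun l _ => ?_
    rw [(hW m).swap j i, (hW i).swap j m]
    ring
  have e5 : ∑ m, ∑ i, ∑ j, ∑ k, ∑ l, D m i j k l * D i j m k l
      = -∑ m, ∑ i, ∑ j, ∑ k, ∑ l, D m i j k l * D i m j k l := by
    simp only [← Finset.sum_neg_distrib]
    refine Finset.sum_congr rfl fun m _ => Finset.sum_congr rfl fun i _ =>
      Finset.sum_congr rfl fun j _ =>
      Finset.sum_congr rfl fun k _ => Finset.sum_congr rfl fun l _ => ?_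
    rw [(hW i).swap j m]
    ring
  simp only [mul_add, Finset.sum_add_distrib, e4, e5, ← pow_two] at e1
  linarith

/-- The inner contraction of D is −V_{jki}. E differs from 2P by a multiple of the metric, which V
does not see because it is trace-free. As V is the skew part of the derivative of P, the pairing of
P with V is half of |V|², and the factors 2 and ½ cancel. -/
theorem ric_weyl {E : Fin 4 → Fin 4 → Fin 4 → ℝ}
    (hE : ∀ m i j, E m i j = S m i j - 1 / 4 * r m * δ i j) :
    ∑ k, ∑ i, ∑ j, E k i j * ∑ l, D l k i j l = -∑ j, ∑ k, ∑ l, V j k l ^ 2 := by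
  have hp := h.schouten_symm hS hP
  have hv := h.div_weyl hS hr hP hD hV
  have e1 : ∀ k i j, ∑ l, D l k i j l = -V j k i := by
    intro k i j
    rw [hV, ← Finset.sum_neg_distrib]
    refine Finset.sum_congr rfl fun l _ => ?_
    rw [(hW l).pair, (hW l).swap]
  have tr : ∀ k, ∑ j, V j k j = 0 := by
    intro k
    simp only [hV]
    rw [Finset.sum_comm]
    exact Finset.sum_eq_zero fun m _ => (hW m).trace₂ _ _
  have e2 : ∀ k i j, E k i j = 2 * P k i j + 1 / 12 * -r k * δ i j := by
    intro k i j
    rw [hE, hP]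
    ring
  have e3 : ∑ k, ∑ i, ∑ j, 1 / 12 * -r k * δ i j * -V j k i = 0 := by
    refine Finset.sum_eq_zero fun k _ => ?_
    have : ∀ i, ∑ j, 1 / 12 * -r k * δ i j * -V j k i = 1 / 12 * r k * V i k i := by
      intro i
      rw [← sum_mul_δ (fun j => 1 / 12 * r k * V j k i) i]
      exact Finset.sum_congr rfl fun _ _ => by ring
    simp only [this, ← Finset.mul_sum, tr, mul_zero]
  have e4 : ∑ k, ∑ i, ∑ j, P k i j * V j k i = -∑ k, ∑ i, ∑ j, P i j k * V j k i := by
    rw [← Finset.sum_neg_distrib, Finset.sum_comm]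
    refine Finset.sum_congr rfl fun k _ => ?_
    rw [← Finset.sum_neg_distrib]
    refine Finset.sum_congr rfl fun i _ => ?_
    rw [← Finset.sum_neg_distrib]
    refine Finset.sum_congr rfl fun j _ => ?_
    rw [hv, hv, hp i k j]
    ring
  have e5 : ∑ j, ∑ k, ∑ l, V j k l ^ 2 = ∑ k, ∑ i, ∑ j, P k i j * V j k i
      - ∑ k, ∑ i, ∑ j, P i j k * V j k i := by
    simp only [← Finset.sum_sub_distrib]
    refine (sum_rot₃ fun k i j => V j k i ^ 2).symm.trans ?_
    refine Finset.sum_congr rfl fun k _ => Finset.sum_congr rfl fun i _ =>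
      Finset.sum_congr rfl fun j _ => ?_
    rw [hv, hp k i j]
    ring
  simp only [e1, e2, add_mul, Finset.sum_add_distrib, e3]
  rw [e5]
  have e6 : ∑ k, ∑ i, ∑ j, 2 * P k i j * -V j k i = -2 * ∑ k, ∑ i, ∑ j, P k i j * V j k i := by
    simp only [Finset.mul_sum]
    exact Finset.sum_congr rfl fun _ _ => Finset.sum_congr rfl fun _ _ =>
      Finset.sum_congr rfl fun _ _ => by ring
  rw [e6]
  linarith

end IsCurvatureDerivative

/-! ### Symmetries of the Weyl tensor and of its first derivatives -/

section WeylSymmetries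

variable {G : LocalMetric} {U : Set E4} {y : E4}

theorem weyl_apply (G : LocalMetric) (y : E4) (i j k l : Fin 4) :
    weyl G y ![i, j, k, l] = riem G y i j k l
      - (1 / 2) * kulkarniNomizu (tracefreeRic G y) (G y) i j k l
      - (1 / 24) * scal G y * kulkarniNomizu (G y) (G y) i j k l := rfl

theorem tracefreeRic_symm (hG : IsMetricOn G U) (hy : y ∈ U) (i j : Fin 4) :
    tracefreeRic G y i j = tracefreeRic G y j i := by
  unfold tracefreeRic
  rw [ric_symm hG hy, hG.symm hy i j]

theorem weyl_pair (hG : IsMetricOn G U) (hy : y ∈ U) (i j k l : Fin 4) :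
    weyl G y ![i, j, k, l] = weyl G y ![k, l, i, j] := by
  simp only [weyl_apply, kulkarniNomizu]
  rw [riem_pair hG hy i j k l, hG.symm hy j l, hG.symm hy i k, hG.symm hy i l, hG.symm hy j k,
    tracefreeRic_symm hG hy i k, tracefreeRic_symm hG hy j l, tracefreeRic_symm hG hy i l,
    tracefreeRic_symm hG hy j k]
  ring

theorem weyl_cyclic (hG : IsMetricOn G U) (hy : y ∈ U) (i j k l : Fin 4) :
    weyl G y ![i, j, k, l] + weyl G y ![j, k, i, l] + weyl G y ![k, i, j, l] = 0 := by
  simp only [weyl_apply, kulkarniNomizu]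
  rw [hG.symm hy j i, hG.symm hy k i, hG.symm hy k j,
    tracefreeRic_symm hG hy j i, tracefreeRic_symm hG hy k i, tracefreeRic_symm hG hy k j]
  linear_combination riem_cyclic hG hy i j k l

theorem IsNormal.ric (hG : IsNormal G U) (j l : Fin 4) :
    ric G 0 j l = ∑ i, BachFlat.riem G 0 i j i l := by
  simp [BachFlat.ric, hG.inv, Matrix.one_apply]

theorem IsNormal.scal (hG : IsNormal G U) : scal G 0 = ∑ i, BachFlat.ric G 0 i i := by
  simp [BachFlat.scal, hG.inv, Matrix.one_apply]

theorem IsNormal.trace_tracefreeRic (hG : IsNormal G U) : ∑ i, tracefreeRic G 0 i i = 0 := by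
  simp [tracefreeRic, hG.apply_zero, hG.scal]

theorem weyl_trace (hG : IsMetricOn G U) (hy : y ∈ U) (I : Fin 2 → Fin 4) :
    contr G (reindex ![0, 2, 1, 3] (weyl G)) y I = 0 := by
  refine Natural.eq_zero (natural_weyl.reindex (by decide)).contr (fun H V hH I => ?_) hG hy I
  have t := hH.trace_tracefreeRic
  have e : ∀ s : Fin 4, ((Matrix.vecCons s (Matrix.vecCons s I)) ∘ ![0, 2, 1, 3] : Fin 4 → Fin 4)
      = ![s, I 0, s, I 1] := fun s => by
    ext a; fin_cases a <;> rfl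
  simp only [hH.contr, reindex, e, weyl_apply, kulkarniNomizu, hH.apply_zero,
    Finset.sum_sub_distrib, ← hH.ric]
  generalize I 0 = j, I 1 = l
  have hs := tracefreeRic_symm hH.toIsMetricOn hH.zero_mem
  -- The traces of E ∧ g and g ∧ g are (n−2)E and 2(n−1)g. For n = 4 this matches the coefficients ½
  -- and 1/24 in the definition of W.
  have e1 : ∑ s, (tracefreeRic H 0 s s * δ j l + tracefreeRic H 0 j l * δ s s
      - tracefreeRic H 0 s l * δ j s - tracefreeRic H 0 j s * δ s l) = 2 * tracefreeRic H 0 j l := by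
    simp only [Finset.sum_sub_distrib, Finset.sum_add_distrib, ← Finset.sum_mul, t, sum_mul_δ,
      δ_symm _ l]
    simp [Matrix.one_apply]
    ring
  have e2 : ∑ s : Fin 4, (δ s s * δ j l + δ j l * δ s s - δ s l * δ j s - δ j s * δ s l)
      = 6 * δ j l := by
    simp only [Finset.sum_sub_distrib, Finset.sum_add_distrib, ← Finset.sum_mul, sum_mul_δ,
      mul_comm (δ j _) (δ _ l)]
    simp [Matrix.one_apply]
    split_ifs <;> norm_num
  rw [← Finset.mul_sum, ← Finset.mul_sum, e1, e2]
  simp only [tracefreeRic, hH.apply_zero]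
  ring

theorem isWeyl_weyl (hG : IsNormal G U) : IsWeyl fun i j k l => weyl G 0 ![i, j, k, l] where
  swap := weyl_swap G 0
  pair := weyl_pair hG.toIsMetricOn hG.zero_mem
  cyclic := weyl_cyclic hG.toIsMetricOn hG.zero_mem
  trace j l := by
    rw [← weyl_trace hG.toIsMetricOn hG.zero_mem ![j, l], hG.contr]
    refine Finset.sum_congr rfl fun s _ => ?_
    simp only [reindex]
    congr 1
    ext a; fin_cases a <;> rfl

/-- The symmetries hold on a neighbourhood of the origin and can be differentiated; for the trace
condition this uses that differentiation passes through the contraction. -/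
theorem isWeyl_pderiv_weyl (hG : IsNormal G U) (m : Fin 4) :
    IsWeyl fun i j k l => pderiv m (fun z => weyl G z ![i, j, k, l]) 0 where
  swap i j k l := by
    rw [← pderiv_neg]
    congr 1
    funext z
    exact weyl_swap G z i j k l
  pair i j k l := pderiv_congr <| by
    filter_upwards [hG.isOpen.mem_nhds hG.zero_mem] with z hz using weyl_pair hG.toIsMetricOn hz _ _ _ _
  cyclic i j k l := by
    have hd := fun I => (natural_weyl.smooth hG.toIsMetricOn).differentiableAt hG.zero_mem I
    rw [← pderiv_add (hd _) (hd _), ← pderiv_add ((hd _).fun_add (hd _)) (hd _), ← pderiv_const 0]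
    refine pderiv_congr ?_
    filter_upwards [hG.isOpen.mem_nhds hG.zero_mem] with z hz using weyl_cyclic hG.toIsMetricOn hz _ _ _ _
  trace j l := by
    have h := hG.pderiv_contr
      ((natural_weyl.reindex (a := ![0, 2, 1, 3]) (by decide)).smooth hG.toIsMetricOn) m ![j, l]
    rw [pderiv_congr (h := fun _ => 0), pderiv_const] at h
    · rw [h]
      simp only [reindex]
      congr 1
    · filter_upwards [hG.isOpen.mem_nhds hG.zero_mem] with z hz using weyl_trace hG.toIsMetricOn hz _

theorem isCurvatureDerivative_pderiv_riem (hG : IsNormal G U) :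
    IsCurvatureDerivative fun m i j k l => pderiv m (fun z => BachFlat.riem G z i j k l) 0 where
  swap m i j k l := by
    rw [← pderiv_neg]
    congr 1
    funext z
    exact riem_swap G z i j k l
  pair m i j k l := pderiv_congr <| by
    filter_upwards [hG.isOpen.mem_nhds hG.zero_mem] with z hz using riem_pair hG.toIsMetricOn hz _ _ _ _
  bianchi := hG.second_bianchi

theorem IsNormal.pderiv_ric (hG : IsNormal G U) (m j l : Fin 4) :
    pderiv m (fun z => BachFlat.ric G z j l) 0
      = ∑ i, pderiv m (fun z => BachFlat.riem G z i j i l) 0 := by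
  have h := hG.pderiv_contr
    ((Natural.riemT.reindex (a := ![0, 2, 1, 3]) (by decide)).smooth hG.toIsMetricOn) m ![j, l]
  have e : (fun z => BachFlat.ric G z j l)
      = fun z => BachFlat.contr G (reindex ![0, 2, 1, 3] (riemT G)) z ![j, l] := by
    funext z
    exact (ricT_apply G z ![j, l]).symm
  rw [e, h]
  rfl

theorem IsNormal.pderiv_scal (hG : IsNormal G U) (m : Fin 4) :
    pderiv m (fun z => BachFlat.scal G z) 0 = ∑ i, pderiv m (fun z => BachFlat.ric G z i i) 0 := by
  have h := hG.pderiv_contr (natural_ricT.smooth hG.toIsMetricOn) m ![]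
  have e : (fun z => BachFlat.scal G z) = fun z => BachFlat.contr G (ricT G) z ![] := by
    funext z
    exact (scalT_apply G z ![]).symm
  rw [e, h]
  simp [ricT_apply]

theorem IsNormal.differentiableAt_ric (hG : IsNormal G U) (i j : Fin 4) :
    DifferentiableAt ℝ (fun z => BachFlat.ric G z i j) 0 := by
  have := (natural_ricT.smooth hG.toIsMetricOn).differentiableAt hG.zero_mem ![i, j]
  simp only [ricT_apply] at this
  exact this

theorem IsNormal.differentiableAt_scal (hG : IsNormal G U) :
    DifferentiableAt ℝ (fun z => BachFlat.scal G z) 0 := by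
  have := (natural_scalT.smooth hG.toIsMetricOn).differentiableAt hG.zero_mem ![]
  simpa only [scalT_apply] using this

theorem IsNormal.pderiv_tracefreeRic (hG : IsNormal G U) (m i j : Fin 4) :
    pderiv m (fun z => tracefreeRic G z i j) 0 = pderiv m (fun z => BachFlat.ric G z i j) 0
      - 1 / 4 * pderiv m (fun z => BachFlat.scal G z) 0 * δ i j := by
  have hg := hG.differentiableAt hG.zero_mem i j
  have hs := hG.differentiableAt_scal
  unfold tracefreeRic
  rw [pderiv_sub (hG.differentiableAt_ric i j) ((hs.const_mul _).fun_mul hg),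
    pderiv_mul (hs.const_mul _) hg, pderiv_const_mul _ hs, hG.pderiv_zero, hG.apply_zero]
  ring

theorem IsNormal.differentiableAt_tracefreeRic (hG : IsNormal G U) (i j : Fin 4) :
    DifferentiableAt ℝ (fun z => tracefreeRic G z i j) 0 := by
  have := (natural_tracefreeRicT.smooth hG.toIsMetricOn).differentiableAt hG.zero_mem ![i, j]
  simp only [tracefreeRicT_apply] at this
  exact this

theorem IsNormal.pderiv_weyl (hG : IsNormal G U) (m i j k l : Fin 4) :
    pderiv m (fun z => weyl G z ![i, j, k, l]) 0 = pderiv m (fun z => BachFlat.riem G z i j k l) 0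
      - 1 / 2 * kulkarniNomizu (fun a b => pderiv m (fun z => tracefreeRic G z a b) 0) δ i j k l
      - 1 / 24 * pderiv m (fun z => BachFlat.scal G z) 0 * kulkarniNomizu δ δ i j k l := by
  have hg := fun i j => hG.differentiableAt hG.zero_mem i j
  have hs := hG.differentiableAt_scal
  have he := hG.differentiableAt_tracefreeRic
  have hr : DifferentiableAt ℝ (fun z => BachFlat.riem G z i j k l) 0 :=
    (smooth_riem hG.toIsMetricOn hG.zero_mem i j k l).differentiableAt (by simp)
  have hKN : ∀ {h h' : E4 → Fin 4 → Fin 4 → ℝ},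
      (∀ i j, DifferentiableAt ℝ (fun z => h z i j) 0) →
      (∀ i j, DifferentiableAt ℝ (fun z => h' z i j) 0) → DifferentiableAt ℝ
        (fun z => kulkarniNomizu (h z) (h' z) i j k l) 0 := fun a b =>
    ((((a _ _).fun_mul (b _ _)).fun_add ((a _ _).fun_mul (b _ _))).fun_sub
      ((a _ _).fun_mul (b _ _))).fun_sub ((a _ _).fun_mul (b _ _))
  have hKN' : ∀ {h h' : E4 → Fin 4 → Fin 4 → ℝ},
      (∀ i j, DifferentiableAt ℝ (fun z => h z i j) 0) →
      (∀ i j, DifferentiableAt ℝ (fun z => h' z i j) 0) →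
      (∀ i j, pderiv m (fun z => h' z i j) 0 = 0) → pderiv m
        (fun z => kulkarniNomizu (h z) (h' z) i j k l) 0
        = kulkarniNomizu (fun i j => pderiv m (fun z => h z i j) 0) (h' 0) i j k l := by
    intro h h' a b c
    unfold kulkarniNomizu
    rw [pderiv_sub ((((a _ _).fun_mul (b _ _)).fun_add ((a _ _).fun_mul (b _ _))).fun_sub
      ((a _ _).fun_mul (b _ _))) ((a _ _).fun_mul (b _ _)), pderiv_sub (((a _ _).fun_mul
      (b _ _)).fun_add ((a _ _).fun_mul (b _ _))) ((a _ _).fun_mul (b _ _)),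
      pderiv_add ((a _ _).fun_mul (b _ _)) ((a _ _).fun_mul (b _ _)), pderiv_mul (a _ _) (b _ _),
      pderiv_mul (a _ _) (b _ _), pderiv_mul (a _ _) (b _ _), pderiv_mul (a _ _) (b _ _)]
    simp [c]
  simp only [weyl_apply]
  have k1 := hKN he hg
  have k2 := hKN hg hg
  rw [pderiv_sub (hr.fun_sub (k1.const_mul _)) ((hs.const_mul _).fun_mul k2), pderiv_sub hr
    (k1.const_mul _), pderiv_const_mul _ k1, pderiv_mul (hs.const_mul _) k2, pderiv_const_mul _ hs,
    hKN' he hg (hG.pderiv_zero m), hKN' hg hg (hG.pderiv_zero m)]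
  simp only [hG.pderiv_zero, hG.apply_zero]
  simp [kulkarniNomizu]

end WeylSymmetries

/-! ### The divergence identity -/

/-- The covector field `W^{ijkl} ∇_i W_{mjkl}`. -/
def weylGradT (G : LocalMetric) : TensorField 1 :=
  contr G <| contr G <| contr G <| contr G <|
    (mulT ![0, 2, 4, 6] ![1, 8, 3, 5, 7] (weyl G) (covDeriv G (weyl G)) : TensorField 9)

/-- The covector field `W_i^{jkl} ∇^m W_{mjkl}`. -/
def weylDivT (G : LocalMetric) : TensorField 1 :=
  contr G <| contr G <| contr G <| contr G <|
    (mulT ![8, 0, 2, 4] ![6, 7, 1, 3, 5] (weyl G) (covDeriv G (weyl G)) : TensorField 9)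

/-- The covector field `E^{ij} ∇^l W_{kijl}`. -/
def ricDivT (G : LocalMetric) : TensorField 1 :=
  contr G <| contr G <| contr G <|
    (mulT ![0, 2] ![4, 6, 1, 3, 5] (tracefreeRicT G) (covDeriv G (weyl G)) : TensorField 7)

/-- The Bach tensor as a tensor field. -/
def bachT (G : LocalMetric) : TensorField 2 :=
  (contr G <| contr G <| reindex ![3, 1, 2, 4, 5, 0] (covDeriv G (covDeriv G (weyl G))))
    + (1 / 2 : ℝ) • (contr G <| contr G <|
      (mulT ![3, 1] ![2, 4, 5, 0] (ricT G) (weyl G) : TensorField 6))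

/-- The square `W_{ij}^{kl} W_{klmn}` of the Weyl tensor. -/
def weylSqT (G : LocalMetric) : TensorField 4 :=
  contr G <| contr G <| (mulT ![4, 5, 0, 2] ![1, 3, 6, 7] (weyl G) (weyl G) : TensorField 8)

/-- The scalar `W_{ij}^{kl} W_{kl}^{mn} W_{mn}^{ij}`. -/
def weylCubeT (G : LocalMetric) : TensorField 0 :=
  pairing G (weylSqT G) (reindex ![2, 3, 0, 1] (weyl G))

/-- The scalar `W_{ijkl} E^{ik} E^{jl}`. -/
def weylRicRicT (G : LocalMetric) : TensorField 0 :=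
  pairing G (weyl G) (mulT ![0, 2] ![1, 3] (tracefreeRicT G) (tracefreeRicT G))

/-- The scalar `|W|²`. -/
def normSqWeylT (G : LocalMetric) : TensorField 0 := pairing G (weyl G) (weyl G)

/-- The scalar `|∇W|²`. -/
def normSqCovDerivWeylT (G : LocalMetric) : TensorField 0 :=
  pairing G (covDeriv G (weyl G)) (covDeriv G (weyl G))

/-- The right-hand side `3 W³ - ½ R |W|² + 2 W E E` of the integral formula. -/
def weylPotentialT (G : LocalMetric) : TensorField 0 :=
  (3 : ℝ) • weylCubeT G - (1 / 2 : ℝ) • mulT ![] ![] (scalT G) (normSqWeylT G)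
    + (2 : ℝ) • weylRicRicT G

/-- The covector field whose divergence occurs in the integral formula. -/
def fluxT (G : LocalMetric) : TensorField 1 :=
  (2 : ℝ) • weylGradT G - (2 : ℝ) • weylDivT G - (4 : ℝ) • ricDivT G

theorem natural_covDeriv_weyl : Natural fun G => covDeriv G (weyl G) := natural_weyl.covDeriv

theorem natural_weylGradT : Natural weylGradT :=
  (natural_weyl.mulT natural_covDeriv_weyl (by decide)).contr.contr.contr.contr

theorem natural_weylDivT : Natural weylDivT :=
  (natural_weyl.mulT natural_covDeriv_weyl (by decide)).contr.contr.contr.contr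

theorem natural_ricDivT : Natural ricDivT :=
  (natural_tracefreeRicT.mulT natural_covDeriv_weyl (by decide)).contr.contr.contr

theorem natural_bachT : Natural bachT :=
  (natural_covDeriv_weyl.covDeriv.reindex (by decide)).contr.contr.add
    ((natural_ricT.mulT natural_weyl (by decide)).contr.contr.smul _)

theorem natural_weylSqT : Natural weylSqT :=
  (natural_weyl.mulT natural_weyl (by decide)).contr.contr

theorem natural_weylCubeT : Natural weylCubeT :=
  natural_weylSqT.pairing (natural_weyl.reindex (by decide))

theorem natural_weylRicRicT : Natural weylRicRicT :=
  natural_weyl.pairing (natural_tracefreeRicT.mulT natural_tracefreeRicT (by decide))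

theorem natural_normSqWeylT : Natural normSqWeylT := natural_weyl.pairing natural_weyl

theorem natural_normSqCovDerivWeylT : Natural normSqCovDerivWeylT :=
  natural_covDeriv_weyl.pairing natural_covDeriv_weyl

theorem natural_weylPotentialT : Natural weylPotentialT :=
  ((natural_weylCubeT.smul _).sub
    ((natural_scalT.mulT natural_normSqWeylT (by decide)).smul _)).add (natural_weylRicRicT.smul _)

theorem natural_fluxT : Natural fluxT :=
  ((natural_weylGradT.smul _).sub (natural_weylDivT.smul _)).sub (natural_ricDivT.smul _)

theorem natural_div_fluxT : Natural fun G => contr G (covDeriv G (fluxT G)) :=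
  natural_fluxT.covDeriv.contr

/-- Evaluates the slot placements of `mulT` and `reindex`. In the definitions above the slots 0, 1,
then 2, 3, and so on are contracted in this order, and the last slots stay free. -/
theorem comp_vecCons {k n : ℕ} (f : Fin n → Fin 4) (a : Fin n) (v : Fin k → Fin n) :
    f ∘ Matrix.vecCons a v = Matrix.vecCons (f a) (f ∘ v) := by
  funext i
  refine Fin.cases ?_ (fun i => ?_) i <;> rfl

theorem comp_vecEmpty {n : ℕ} (f : Fin n → Fin 4) (v : Fin 0 → Fin n) : f ∘ v = ![] :=
  Subsingleton.elim _ _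

theorem bachT_apply (G : LocalMetric) (y : E4) (i j : Fin 4) :
    bachT G y ![i, j] = bach G y i j := by
  simp only [bachT, bach, contr, reindex, mulT, Pi.add_apply, Pi.smul_apply, smul_eq_mul,
    ricT_apply, comp_vecCons, comp_vecEmpty, Matrix.cons_val, Finset.mul_sum]
  congr 1
  · refine Finset.sum_congr rfl fun c _ => ?_
    rw [Finset.sum_comm]
    exact Finset.sum_congr rfl fun _ _ => Finset.sum_congr rfl fun _ _ =>
      Finset.sum_congr rfl fun _ _ => by ring
  · refine Finset.sum_congr rfl fun c _ => ?_
    rw [Finset.sum_comm]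
    exact Finset.sum_congr rfl fun _ _ => Finset.sum_congr rfl fun _ _ =>
      Finset.sum_congr rfl fun _ _ => by ring

/-! ### The three divergences at the origin of normal coordinates -/

section AtOrigin

variable {G : LocalMetric} {U : Set E4}

theorem sum_four {f : (Fin 4 → Fin 4) → ℝ} : ∑ I, f I = ∑ i, ∑ j, ∑ k, ∑ l, f ![i, j, k, l] := by
  simp only [sum_cons, sum_nil]

theorem sum_five {f : (Fin 5 → Fin 4) → ℝ} :
    ∑ I, f I = ∑ m, ∑ i, ∑ j, ∑ k, ∑ l, f ![m, i, j, k, l] := by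
  simp only [sum_cons, sum_nil]

theorem IsNormal.pairing (hG : IsNormal G U) {k : ℕ} (T S : TensorField k) (I : Fin 0 → Fin 4) :
    pairing G T S 0 I = ∑ I, T 0 I * S 0 I := by
  simp only [BachFlat.pairing, hG.inv]
  refine Finset.sum_congr rfl fun I _ => ?_
  rw [Finset.sum_eq_single I]
  · simp
  · intro P _ hP
    obtain ⟨a, ha⟩ := Function.ne_iff.1 hP
    have e : ∏ x, (1 : Matrix (Fin 4) (Fin 4) ℝ) (I x) (P x) = 0 :=
      Finset.prod_eq_zero (Finset.mem_univ a) (Matrix.one_apply_ne ha.symm)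
    rw [e, zero_mul, zero_mul]
  · simp

/-- At the origin differentiation passes through the contractions, so the divergence is the Leibniz
rule: a product of two first derivatives plus W times a second derivative. The next two lemmas treat
the other parts of the flux likewise. -/
theorem div_weylGradT (hG : IsNormal G U) (I : Fin 0 → Fin 4) :
    contr G (covDeriv G (weylGradT G)) 0 I = ∑ m, ∑ l, ∑ k, ∑ j, ∑ i,
      (covDeriv G (weyl G) 0 ![m, i, j, k, l] * covDeriv G (weyl G) 0 ![i, m, j, k, l]
        + weyl G 0 ![i, j, k, l] * covDeriv G (covDeriv G (weyl G)) 0 ![m, i, m, j, k, l]) := by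
  have n1 := natural_weyl.mulT natural_covDeriv_weyl (n := 9) (a := ![0, 2, 4, 6])
    (b := ![1, 8, 3, 5, 7]) (by decide)
  have s1 := natural_weyl.smooth hG.toIsMetricOn
  have s2 := natural_covDeriv_weyl.smooth hG.toIsMetricOn
  rw [hG.contr]
  refine Finset.sum_congr rfl fun m _ => ?_
  rw [hG.covDeriv]
  unfold weylGradT
  rw [hG.pderiv_contr (n1.contr.contr.contr.smooth hG.toIsMetricOn)]
  refine Finset.sum_congr rfl fun l _ => ?_
  rw [hG.pderiv_contr (n1.contr.contr.smooth hG.toIsMetricOn)]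
  refine Finset.sum_congr rfl fun k _ => ?_
  rw [hG.pderiv_contr (n1.contr.smooth hG.toIsMetricOn)]
  refine Finset.sum_congr rfl fun j _ => ?_
  rw [hG.pderiv_contr (n1.smooth hG.toIsMetricOn)]
  refine Finset.sum_congr rfl fun i _ => ?_
  rw [hG.pderiv_mulT s1 s2, ← hG.covDeriv, ← hG.covDeriv]
  simp only [comp_vecCons, comp_vecEmpty, Matrix.cons_val]

theorem div_weylDivT (hG : IsNormal G U) (I : Fin 0 → Fin 4) :
    contr G (covDeriv G (weylDivT G)) 0 I = ∑ i, ∑ m, ∑ l, ∑ k, ∑ j,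
      (covDeriv G (weyl G) 0 ![i, i, j, k, l] * covDeriv G (weyl G) 0 ![m, m, j, k, l]
        + weyl G 0 ![i, j, k, l] * covDeriv G (covDeriv G (weyl G)) 0 ![i, m, m, j, k, l]) := by
  have n1 := natural_weyl.mulT natural_covDeriv_weyl (n := 9) (a := ![8, 0, 2, 4])
    (b := ![6, 7, 1, 3, 5]) (by decide)
  have s1 := natural_weyl.smooth hG.toIsMetricOn
  have s2 := natural_covDeriv_weyl.smooth hG.toIsMetricOn
  rw [hG.contr]
  refine Finset.sum_congr rfl fun i _ => ?_
  rw [hG.covDeriv]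
  unfold weylDivT
  rw [hG.pderiv_contr (n1.contr.contr.contr.smooth hG.toIsMetricOn)]
  refine Finset.sum_congr rfl fun m _ => ?_
  rw [hG.pderiv_contr (n1.contr.contr.smooth hG.toIsMetricOn)]
  refine Finset.sum_congr rfl fun l _ => ?_
  rw [hG.pderiv_contr (n1.contr.smooth hG.toIsMetricOn)]
  refine Finset.sum_congr rfl fun k _ => ?_
  rw [hG.pderiv_contr (n1.smooth hG.toIsMetricOn)]
  refine Finset.sum_congr rfl fun j _ => ?_
  rw [hG.pderiv_mulT s1 s2, ← hG.covDeriv, ← hG.covDeriv]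
  simp only [comp_vecCons, comp_vecEmpty, Matrix.cons_val]

theorem div_ricDivT (hG : IsNormal G U) (I : Fin 0 → Fin 4) :
    contr G (covDeriv G (ricDivT G)) 0 I = ∑ k, ∑ l, ∑ j, ∑ i,
      (pderiv k (fun z => tracefreeRic G z i j) 0 * covDeriv G (weyl G) 0 ![l, k, i, j, l]
        + tracefreeRic G 0 i j * covDeriv G (covDeriv G (weyl G)) 0 ![k, l, k, i, j, l]) := by
  have n1 := natural_tracefreeRicT.mulT natural_covDeriv_weyl (n := 7) (a := ![0, 2])
    (b := ![4, 6, 1, 3, 5]) (by decide)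
  have s1 := natural_tracefreeRicT.smooth hG.toIsMetricOn
  have s2 := natural_covDeriv_weyl.smooth hG.toIsMetricOn
  rw [hG.contr]
  refine Finset.sum_congr rfl fun k _ => ?_
  rw [hG.covDeriv]
  unfold ricDivT
  rw [hG.pderiv_contr (n1.contr.contr.smooth hG.toIsMetricOn)]
  refine Finset.sum_congr rfl fun l _ => ?_
  rw [hG.pderiv_contr (n1.contr.smooth hG.toIsMetricOn)]
  refine Finset.sum_congr rfl fun j _ => ?_
  rw [hG.pderiv_contr (n1.smooth hG.toIsMetricOn)]
  refine Finset.sum_congr rfl fun i _ => ?_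
  rw [hG.pderiv_mulT s1 s2, ← hG.covDeriv (covDeriv G (weyl G))]
  simp only [comp_vecCons, comp_vecEmpty, Matrix.cons_val, tracefreeRicT_apply]

end AtOrigin

section AtOrigin

variable {G : LocalMetric} {U : Set E4}

theorem sum_rev₄ (f : Fin 4 → Fin 4 → Fin 4 → Fin 4 → ℝ) :
    ∑ a, ∑ b, ∑ c, ∑ d, f a b c d = ∑ d, ∑ c, ∑ b, ∑ a, f a b c d :=
  (sum_rot₄ _).trans <| Finset.sum_congr rfl fun _ _ => (sum_rot₃ _).trans <|
    Finset.sum_congr rfl fun _ _ => Finset.sum_comm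

theorem IsNormal.weylSqT (hG : IsNormal G U) (i j m n : Fin 4) :
    weylSqT G 0 ![i, j, m, n] = ∑ l, ∑ k, weyl G 0 ![i, j, k, l] * weyl G 0 ![k, l, m, n] := by
  unfold BachFlat.weylSqT
  simp only [hG.contr, mulT, comp_vecCons, comp_vecEmpty, Matrix.cons_val]

theorem IsNormal.weylCubeT (hG : IsNormal G U) (I : Fin 0 → Fin 4) :
    weylCubeT G 0 I = ∑ i, ∑ j, ∑ k, ∑ l, ∑ m, ∑ n,
      weyl G 0 ![i, j, k, l] * weyl G 0 ![k, l, m, n] * weyl G 0 ![m, n, i, j] := by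
  unfold BachFlat.weylCubeT
  rw [hG.pairing, sum_four]
  simp only [hG.weylSqT, reindex, comp_vecCons, comp_vecEmpty, Matrix.cons_val]
  refine Finset.sum_congr rfl fun i _ => Finset.sum_congr rfl fun j _ => ?_
  simp only [Finset.sum_mul]
  exact (sum_rot₄ _).trans (Finset.sum_congr rfl fun _ _ => sum_rot₃ _)

theorem IsNormal.weylRicRicT (hG : IsNormal G U) (I : Fin 0 → Fin 4) :
    weylRicRicT G 0 I = ∑ i, ∑ j, ∑ k, ∑ l,
      weyl G 0 ![i, j, k, l] * (tracefreeRic G 0 i k * tracefreeRic G 0 j l) := by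
  unfold BachFlat.weylRicRicT
  rw [hG.pairing, sum_four]
  simp only [mulT, tracefreeRicT_apply, comp_vecCons, comp_vecEmpty, Matrix.cons_val]

theorem IsNormal.normSqWeylT (hG : IsNormal G U) (I : Fin 0 → Fin 4) :
    normSqWeylT G 0 I = ∑ i, ∑ j, ∑ k, ∑ l, weyl G 0 ![i, j, k, l] ^ 2 := by
  unfold BachFlat.normSqWeylT
  rw [hG.pairing, sum_four]
  simp only [pow_two]

theorem weylPotentialT_apply (G : LocalMetric) (y : E4) (I : Fin 0 → Fin 4) :
    weylPotentialT G y I = 3 * weylCubeT G y I - 1 / 2 * (scal G y * normSqWeylT G y I)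
      + 2 * weylRicRicT G y I := by
  simp only [weylPotentialT, Pi.add_apply, Pi.sub_apply, Pi.smul_apply, smul_eq_mul, mulT,
    scalT_apply, Subsingleton.elim (I ∘ ![]) I]

theorem IsNormal.normSqCovDerivWeylT (hG : IsNormal G U) (I : Fin 0 → Fin 4) :
    normSqCovDerivWeylT G 0 I = ∑ m, ∑ i, ∑ j, ∑ k, ∑ l,
      pderiv m (fun z => weyl G z ![i, j, k, l]) 0 ^ 2 := by
  unfold BachFlat.normSqCovDerivWeylT
  rw [hG.pairing, sum_five]
  simp only [pow_two, hG.covDeriv]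

theorem IsNormal.div_fluxT (hG : IsNormal G U) (I : Fin 0 → Fin 4) :
    BachFlat.contr G (BachFlat.covDeriv G (fluxT G)) 0 I
      = 2 * BachFlat.contr G (BachFlat.covDeriv G (weylGradT G)) 0 I
        - 2 * BachFlat.contr G (BachFlat.covDeriv G (weylDivT G)) 0 I
        - 4 * BachFlat.contr G (BachFlat.covDeriv G (ricDivT G)) 0 I := by
  have h1 := fun I => (natural_weylGradT.smooth hG.toIsMetricOn).differentiableAt hG.zero_mem I
  have h2 := fun I => (natural_weylDivT.smooth hG.toIsMetricOn).differentiableAt hG.zero_mem I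
  have h3 := fun I => (natural_ricDivT.smooth hG.toIsMetricOn).differentiableAt hG.zero_mem I
  simp only [hG.contr, hG.covDeriv, fluxT, Pi.sub_apply, Pi.smul_apply, smul_eq_mul,
    Finset.mul_sum, ← Finset.sum_sub_distrib]
  refine Finset.sum_congr rfl fun s _ => ?_
  rw [pderiv_sub (((h1 _).const_mul _).fun_sub ((h2 _).const_mul _)) ((h3 _).const_mul _),
    pderiv_sub ((h1 _).const_mul _) ((h2 _).const_mul _), pderiv_const_mul _ (h1 _),
    pderiv_const_mul _ (h2 _), pderiv_const_mul _ (h3 _)]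

theorem half_sum_swap (W : Fin 4 → Fin 4 → Fin 4 → Fin 4 → ℝ) (E : Fin 4 → Fin 4 → ℝ) :
    ∑ i, ∑ j, 1 / 2 * ∑ k, ∑ l, W i k j l * (E i j * E k l)
      = 1 / 2 * ∑ i, ∑ j, ∑ k, ∑ l, W i j k l * (E i k * E j l) := by
  simp only [← Finset.mul_sum]
  rw [Finset.sum_congr rfl fun i _ => Finset.sum_comm]

/-- In the curvature term of B the pure trace part of Ric drops out, since W is trace-free;
exchanging the first two indices of W then produces −½ W(E,E). This is what turns E^{ij} ∇^k ∇^l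
W_{kijl} into known terms. -/
theorem IsNormal.bach_tracefreeRic (hG : IsNormal G U) (I : Fin 0 → Fin 4) :
    BachFlat.pairing G (bachT G) (tracefreeRicT G) 0 I
      = ∑ i, ∑ j, tracefreeRic G 0 i j * ∑ k, ∑ l,
          BachFlat.covDeriv G (BachFlat.covDeriv G (weyl G)) 0 ![k, l, k, i, j, l]
        - 1 / 2 * BachFlat.weylRicRicT G 0 I := by
  have hW := isWeyl_weyl hG
  have e : ∀ i j, BachFlat.bach G 0 i j = (∑ k, ∑ l,
      BachFlat.covDeriv G (BachFlat.covDeriv G (weyl G)) 0 ![k, l, k, i, j, l])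
      + 1 / 2 * ∑ k, ∑ l, BachFlat.ric G 0 k l * weyl G 0 ![k, i, j, l] := by
    intro i j
    simp [BachFlat.bach, hG.inv, Matrix.one_apply]
  have e2 : ∀ i j, ∑ k, ∑ l, BachFlat.ric G 0 k l * weyl G 0 ![k, i, j, l]
      = -∑ k, ∑ l, weyl G 0 ![i, k, j, l] * tracefreeRic G 0 k l := by
    intro i j
    have e3 : ∀ k l, BachFlat.ric G 0 k l * weyl G 0 ![k, i, j, l]
        = 1 / 4 * BachFlat.scal G 0 * (weyl G 0 ![k, i, j, l] * δ k l)
          - weyl G 0 ![i, k, j, l] * tracefreeRic G 0 k l := by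
      intro k l
      rw [weyl_swap G 0 i k j l]
      simp only [tracefreeRic, hG.apply_zero]
      ring
    simp only [e3, Finset.sum_sub_distrib, ← Finset.mul_sum, sum_mul_δ, hW.trace₄]
    ring
  rw [hG.pairing, hG.weylRicRicT]
  simp only [sum_cons, sum_nil]
  have e4 : ∀ i j, bachT G 0 ![i, j] * tracefreeRicT G 0 ![i, j]
      = tracefreeRic G 0 i j * (∑ k, ∑ l,
        BachFlat.covDeriv G (BachFlat.covDeriv G (weyl G)) 0 ![k, l, k, i, j, l])
        - 1 / 2 * ∑ k, ∑ l, weyl G 0 ![i, k, j, l] *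
          (tracefreeRic G 0 i j * tracefreeRic G 0 k l) := by
    intro i j
    rw [bachT_apply, e, e2, tracefreeRicT_apply]
    simp only [Matrix.cons_val]
    have : ∑ k, ∑ l, weyl G 0 ![i, k, j, l] * (tracefreeRic G 0 i j * tracefreeRic G 0 k l)
        = tracefreeRic G 0 i j * ∑ k, ∑ l, weyl G 0 ![i, k, j, l] * tracefreeRic G 0 k l := by
      simp only [Finset.mul_sum]
      exact Finset.sum_congr rfl fun _ _ => Finset.sum_congr rfl fun _ _ => by ring
    rw [this]
    ring
  simp only [e4, Finset.sum_sub_distrib]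
  have e5 : ∑ i, ∑ j, 1 / 2 * ∑ k, ∑ l, weyl G 0 ![i, k, j, l] *
      (tracefreeRic G 0 i j * tracefreeRic G 0 k l) = 1 / 2 * ∑ i, ∑ j, ∑ k, ∑ l,
      weyl G 0 ![i, j, k, l] * (tracefreeRic G 0 i k * tracefreeRic G 0 j l) := by
    exact half_sum_swap (fun i j k l => weyl G 0 ![i, j, k, l]) (tracefreeRic G 0)
  rw [e5]

theorem IsNormal.ricci_weyl (hG : IsNormal G U) (m i j k l : Fin 4) :
    BachFlat.covDeriv G (BachFlat.covDeriv G (weyl G)) 0 ![m, i, m, j, k, l]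
      - BachFlat.covDeriv G (BachFlat.covDeriv G (weyl G)) 0 ![i, m, m, j, k, l]
      = -∑ s, (BachFlat.riem G 0 m i s m * weyl G 0 ![s, j, k, l]
        + BachFlat.riem G 0 m i s j * weyl G 0 ![m, s, k, l]
        + BachFlat.riem G 0 m i s k * weyl G 0 ![m, j, s, l]
        + BachFlat.riem G 0 m i s l * weyl G 0 ![m, j, k, s]) := by
  rw [hG.ricci_identity (natural_weyl.smooth hG.toIsMetricOn), Fin.sum_univ_four]
  have u0 : ∀ s, Function.update ![m, j, k, l] 0 s = ![s, j, k, l] := fun s => by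
    ext a; fin_cases a <;> rfl
  have u1 : ∀ s, Function.update ![m, j, k, l] 1 s = ![m, s, k, l] := fun s => by
    ext a; fin_cases a <;> rfl
  have u2 : ∀ s, Function.update ![m, j, k, l] 2 s = ![m, j, s, l] := fun s => by
    ext a; fin_cases a <;> rfl
  have u3 : ∀ s, Function.update ![m, j, k, l] 3 s = ![m, j, k, s] := fun s => by
    ext a; fin_cases a <;> rfl
  simp only [u0, u1, u2, u3, Finset.sum_add_distrib]
  rfl

set_option maxHeartbeats 1000000 in
-- The analytic core. `b1` is the Bianchi formula for |∇W|², `b2` evaluates ∇E·∇W, and `b3`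
-- evaluates the commutator of covariant derivatives on W. The three divergences are expanded and
-- the result is linear in these facts.
theorem IsNormal.divergence_identity (hG : IsNormal G U) (I : Fin 0 → Fin 4) :
    BachFlat.normSqCovDerivWeylT G 0 I = BachFlat.weylPotentialT G 0 I
      + BachFlat.contr G (BachFlat.covDeriv G (fluxT G)) 0 I
      + 4 * BachFlat.pairing G (bachT G) (tracefreeRicT G) 0 I := by
  set W := fun i j k l => weyl G 0 ![i, j, k, l] with hWdef
  set D := fun m i j k l => pderiv m (fun z => weyl G z ![i, j, k, l]) 0 with hDdef
  set DD := fun a b i j k l => BachFlat.covDeriv G (BachFlat.covDeriv G (weyl G)) 0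
    ![a, b, i, j, k, l] with hDDdef
  set E := fun i j => tracefreeRic G 0 i j with hEdef
  set S := fun m j l => pderiv m (fun z => BachFlat.ric G z j l) 0 with hSdef
  set r := fun m => pderiv m (fun z => BachFlat.scal G z) 0 with hrdef
  set V := fun j k l => ∑ i, D i i j k l with hVdef
  have hW : IsWeyl W := isWeyl_weyl hG
  have hWD : ∀ m, IsWeyl (D m) := isWeyl_pderiv_weyl hG
  have hN := isCurvatureDerivative_pderiv_riem hG
  have hS : ∀ m j l, S m j l = ∑ i, pderiv m (fun z => BachFlat.riem G z i j i l) 0 := hG.pderiv_ric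
  have hr : ∀ m, r m = ∑ i, S m i i := hG.pderiv_scal
  have hDE : ∀ m i j, pderiv m (fun z => tracefreeRic G z i j) 0 = S m i j - 1 / 4 * r m * δ i j :=
    hG.pderiv_tracefreeRic
  have hD : ∀ m i j k l, D m i j k l = pderiv m (fun z => BachFlat.riem G z i j k l) 0
      - (1 / 2 * (S m i k - 1 / 6 * r m * δ i k) * δ j l
        + 1 / 2 * (S m j l - 1 / 6 * r m * δ j l) * δ i k
        - 1 / 2 * (S m i l - 1 / 6 * r m * δ i l) * δ j k
        - 1 / 2 * (S m j k - 1 / 6 * r m * δ j k) * δ i l) := by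
    intro m i j k l
    simp only [hDdef, hG.pderiv_weyl, kulkarniNomizu, hDE]
    ring
  have b1 := hN.normSq_weyl (S := S) hS (r := r) hr
    (P := fun m i j => 1 / 2 * (S m i j - 1 / 6 * r m * δ i j)) (fun _ _ _ => rfl) (D := D) hD hWD
    (V := V) (fun _ _ _ => rfl)
  have b2 := hN.ric_weyl (S := S) hS (r := r) hr
    (P := fun m i j => 1 / 2 * (S m i j - 1 / 6 * r m * δ i j)) (fun _ _ _ => rfl) (D := D) hD hWD
    (V := V) (fun _ _ _ => rfl) hDE
  -- The Schouten tensor in dimension four is ½E + (R/24)g; its trace is R/6.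
  have b3 := hW.weitzenbock (P := fun i j => 1 / 2 * E i j + 1 / 24 * BachFlat.scal G 0 * δ i j)
    (fun i j => by
      simp only [hEdef, δ_symm i j, tracefreeRic_symm hG.toIsMetricOn hG.zero_mem i j])
    (R := BachFlat.riem G 0) (fun i j k l => by
      simp only [hWdef, hEdef, weyl_apply, kulkarniNomizu, hG.apply_zero]
      ring)
  have tr : ∑ i, (1 / 2 * E i i + 1 / 24 * BachFlat.scal G 0 * δ i i) = 1 / 6 * BachFlat.scal G 0 := by
    simp only [Finset.sum_add_distrib, ← Finset.mul_sum, hEdef, hG.trace_tracefreeRic]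
    simp
    ring
  rw [tr] at b3
  rw [hG.normSqCovDerivWeylT, BachFlat.weylPotentialT_apply, hG.weylCubeT, hG.normSqWeylT, hG.div_fluxT,
    div_weylGradT hG, div_weylDivT hG, div_ricDivT hG, hG.bach_tracefreeRic, hG.weylRicRicT]
  simp only [hG.covDeriv (weyl G), Finset.sum_add_distrib, hDE]
  have c1 : ∑ m, ∑ l, ∑ k, ∑ j, ∑ i, D m i j k l * D i m j k l
      = ∑ m, ∑ i, ∑ j, ∑ k, ∑ l, D m i j k l * D i m j k l :=
    Finset.sum_congr rfl fun _ _ => sum_rev₄ _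
  have c2 : ∑ i, ∑ m, ∑ l, ∑ k, ∑ j, D i i j k l * D m m j k l = ∑ j, ∑ k, ∑ l, V j k l ^ 2 := by
    refine (sum_rot₅ _).trans <| Finset.sum_congr rfl fun j _ => (sum_rot₄ _).trans <|
      Finset.sum_congr rfl fun k _ => (sum_rot₃ _).trans <| Finset.sum_congr rfl fun l _ => ?_
    rw [pow_two, hVdef, Finset.sum_mul_sum]
  -- The second-derivative terms of the first two divergences differ only by the order of
  -- differentiation, so the Ricci identity makes the difference algebraic.
  have c3 : ∑ m, ∑ l, ∑ k, ∑ j, ∑ i, W i j k l * DD m i m j k l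
      - ∑ i, ∑ m, ∑ l, ∑ k, ∑ j, W i j k l * DD i m m j k l
      = -∑ i, ∑ j, ∑ k, ∑ l, W i j k l * ∑ m, ∑ s, (BachFlat.riem G 0 m i s m * W s j k l
        + BachFlat.riem G 0 m i s j * W m s k l + BachFlat.riem G 0 m i s k * W m j s l
        + BachFlat.riem G 0 m i s l * W m j k s) := by
    have d1 : ∑ m, ∑ l, ∑ k, ∑ j, ∑ i, W i j k l * DD m i m j k l
        = ∑ i, ∑ j, ∑ k, ∑ l, ∑ m, W i j k l * DD m i m j k l :=
      (Finset.sum_congr rfl fun _ _ => sum_rev₄ _).trans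
        (sum_rot₅ fun i j k l m => W i j k l * DD m i m j k l).symm
    have d2 : ∑ i, ∑ m, ∑ l, ∑ k, ∑ j, W i j k l * DD i m m j k l
        = ∑ i, ∑ j, ∑ k, ∑ l, ∑ m, W i j k l * DD i m m j k l :=
      Finset.sum_congr rfl fun _ _ => sum_rev₄ _
    rw [d1, d2]
    simp only [← Finset.sum_sub_distrib, ← Finset.sum_neg_distrib, ← mul_sub, Finset.mul_sum]
    refine Finset.sum_congr rfl fun i _ => Finset.sum_congr rfl fun j _ =>
      Finset.sum_congr rfl fun k _ => Finset.sum_congr rfl fun l _ =>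
      Finset.sum_congr rfl fun m _ => ?_
    simp only [hDDdef, hG.ricci_weyl, mul_neg, Finset.mul_sum, Finset.sum_neg_distrib]
    rfl
  have c4 : ∑ k, ∑ l, ∑ j, ∑ i, (S k i j - 1 / 4 * r k * δ i j) * D l k i j l
      = ∑ k, ∑ i, ∑ j, (S k i j - 1 / 4 * r k * δ i j) * ∑ l, D l k i j l := by
    simp only [Finset.mul_sum]
    exact Finset.sum_congr rfl fun k _ => (sum_rot₃ _).trans <|
      Finset.sum_congr rfl fun i _ => Finset.sum_comm
  have c5 : ∑ k, ∑ l, ∑ j, ∑ i, E i j * DD k l k i j l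
      = ∑ i, ∑ j, E i j * ∑ k, ∑ l, DD k l k i j l := by
    simp only [Finset.mul_sum]
    exact (sum_rot₄ _).trans <| Finset.sum_congr rfl fun i _ => sum_rot₃ _
  have b2' : ∑ k, ∑ i, ∑ j, (S k i j - 1 / 4 * r k * δ i j) * ∑ l, D l k i j l
      = -∑ j, ∑ k, ∑ l, V j k l ^ 2 := by
    rw [← b2]
    simp only [hDE]
  rw [b2'] at c4
  rw [b3] at c3
  show ∑ m, ∑ i, ∑ j, ∑ k, ∑ l, D m i j k l ^ 2
    = 3 * ∑ i, ∑ j, ∑ k, ∑ l, ∑ m, ∑ n, W i j k l * W k l m n * W m n i j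
      - 1 / 2 * (BachFlat.scal G 0 * ∑ i, ∑ j, ∑ k, ∑ l, W i j k l ^ 2)
      + 2 * (∑ i, ∑ j, ∑ k, ∑ l, W i j k l * (E i k * E j l))
      + (2 * (∑ m, ∑ l, ∑ k, ∑ j, ∑ i, D m i j k l * D i m j k l
        + ∑ m, ∑ l, ∑ k, ∑ j, ∑ i, W i j k l * DD m i m j k l)
        - 2 * (∑ i, ∑ m, ∑ l, ∑ k, ∑ j, D i i j k l * D m m j k l
          + ∑ i, ∑ m, ∑ l, ∑ k, ∑ j, W i j k l * DD i m m j k l)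
        - 4 * (∑ k, ∑ l, ∑ j, ∑ i, (S k i j - 1 / 4 * r k * δ i j) * D l k i j l
          + ∑ k, ∑ l, ∑ j, ∑ i, E i j * DD k l k i j l))
      + 4 * (∑ i, ∑ j, E i j * (∑ k, ∑ l, DD k l k i j l)
        - 1 / 2 * ∑ i, ∑ j, ∑ k, ∑ l, W i j k l * (E i k * E j l))
  rw [c1, c2, c4, c5, b1]
  -- The |div W|² terms balance as 2 = −2 + 4, and the two contributions 2 W(E,E) and −2 W(E,E)
  -- cancel.
  linear_combination (-2) * c3

end AtOrigin

section General

variable {G : LocalMetric} {U : Set E4}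

/-- The general divergence identity, for a metric in arbitrary coordinates. -/
theorem IsMetricOn.divergence_identity (hG : IsMetricOn G U) {y : E4} (hy : y ∈ U)
    (I : Fin 0 → Fin 4) :
    normSqCovDerivWeylT G y I = weylPotentialT G y I + contr G (covDeriv G (fluxT G)) y I
      + 4 * pairing G (bachT G) (tracefreeRicT G) y I := by
  have h : Natural fun G => normSqCovDerivWeylT G - weylPotentialT G
      - contr G (covDeriv G (fluxT G)) - (4 : ℝ) • pairing G (bachT G) (tracefreeRicT G) :=
    ((natural_normSqCovDerivWeylT.sub natural_weylPotentialT).sub natural_div_fluxT).sub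
      ((natural_bachT.pairing natural_tracefreeRicT).smul 4)
  have h0 := h.eq_zero (fun {G U} (hG : IsNormal G U) I => by
    have := hG.divergence_identity I
    simp only [Pi.sub_apply, Pi.smul_apply, smul_eq_mul]
    linarith) hG hy I
  simp only [Pi.sub_apply, Pi.smul_apply, smul_eq_mul] at h0
  linarith

theorem IsMetricOn.normSqCovDerivWeylT_eq (hG : IsMetricOn G U) {y : E4} (hy : y ∈ U)
    (hB : ∀ i j, bach G y i j = 0) (I : Fin 0 → Fin 4) :
    normSqCovDerivWeylT G y I = weylPotentialT G y I + contr G (covDeriv G (fluxT G)) y I := by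
  have h0 : pairing G (bachT G) (tracefreeRicT G) y I = 0 := by
    refine Finset.sum_eq_zero fun P _ => Finset.sum_eq_zero fun Q _ => ?_
    have : P = ![P 0, P 1] := by ext a; fin_cases a <;> rfl
    rw [this, bachT_apply, hB]
    simp
  rw [hG.divergence_identity hy, h0]
  ring

end General

/-! ### The determinants of `W^±` -/

/-- The map `θ ↦ Jᵀ θ J` of 2-forms. -/
def twoFormsPull (J : Matrix (Fin 4) (Fin 4) ℝ) : twoForms →ₗ[ℝ] twoForms where
  toFun θ := ⟨J.transpose * θ.1 * J, fun i j => by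
    have h : θ.1.transpose = -θ.1 := by
      ext a b
      exact θ.2 b a
    have := congrFun (congrFun (congrArg Matrix.transpose
      (rfl : J.transpose * θ.1 * J = J.transpose * θ.1 * J)) i) j
    calc (J.transpose * θ.1 * J) i j = (J.transpose * θ.1 * J).transpose j i := rfl
      _ = _ := by
        rw [Matrix.transpose_mul, Matrix.transpose_mul, Matrix.transpose_transpose, h, mul_assoc]
        simp⟩
  map_add' θ η := by
    ext1
    simp [Matrix.mul_add, Matrix.add_mul]
  map_smul' c θ := by
    ext1
    simp

/-- The invertible map `θ ↦ Jᵀ θ J` of 2-forms. -/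
def twoFormsEquiv (J : Matrix (Fin 4) (Fin 4) ℝ) (hJ : IsUnit J.det) : twoForms ≃ₗ[ℝ] twoForms :=
  LinearEquiv.ofLinearMap (twoFormsPull J) (twoFormsPull J⁻¹)
    (by
      ext1 θ
      ext1
      simp only [twoFormsPull, LinearMap.comp_apply, LinearMap.coe_mk, AddHom.coe_mk,
        LinearMap.id_apply]
      calc J.transpose * (J⁻¹.transpose * θ.1 * J⁻¹) * J
          = (J⁻¹ * J).transpose * θ.1 * (J⁻¹ * J) := by
            simp only [Matrix.transpose_mul, mul_assoc]
        _ = θ.1 := by simp [Matrix.nonsing_inv_mul _ hJ])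
    (by
      ext1 θ
      ext1
      simp only [twoFormsPull, LinearMap.comp_apply, LinearMap.coe_mk, AddHom.coe_mk,
        LinearMap.id_apply]
      calc J⁻¹.transpose * (J.transpose * θ.1 * J) * J⁻¹
          = (J * J⁻¹).transpose * θ.1 * (J * J⁻¹) := by
            simp only [Matrix.transpose_mul, mul_assoc]
        _ = θ.1 := by simp [Matrix.mul_nonsing_inv _ hJ])

theorem pull_sum (u v : Fin 4 → ℝ) (Q : Fin 4 → Fin 4 → Fin 4 → Fin 4 → ℝ)
    (K : Matrix (Fin 4) (Fin 4) ℝ) :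
    1 / 2 * ∑ k, ∑ l, (∑ a, u a * ∑ b, v b * Q a b k l) * K k l
      = ∑ b, (∑ a, u a * (1 / 2 * ∑ k, ∑ l, Q a b k l * K k l)) * v b := by
  simp only [Finset.sum_mul, Finset.mul_sum]
  refine (sum_rev₄ fun k l a b => 1 / 2 * (u a * (v b * Q a b k l) * K k l)).trans ?_
  refine Finset.sum_congr rfl fun b _ => Finset.sum_congr rfl fun a _ => ?_
  rw [Finset.sum_comm]
  exact Finset.sum_congr rfl fun _ _ => Finset.sum_congr rfl fun _ _ => by ring

/-- Raising two indices with the inverse of A' produces inverse Jacobians that cancel those of Z' in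
its last two slots; only the pull-back of the output form is left. -/
theorem formOp_pull {J A A' : Matrix (Fin 4) (Fin 4) ℝ} (hJ : IsUnit J.det)
    (hA : A' = J.transpose * A * J)
    {Z Z' : Fin 4 → Fin 4 → Fin 4 → Fin 4 → ℝ} (hZ : ∀ i j k l, Z i j k l = -Z j i k l)
    (hZ' : ∀ i j k l, Z' i j k l = -Z' j i k l)
    (h : ∀ i j k l, Z' i j k l
      = ∑ a, J a i * ∑ b, J b j * ∑ c, J c k * ∑ d, J d l * Z a b c d) (θ : twoForms) :
    formOp A' Z' hZ' (twoFormsEquiv J hJ θ) = twoFormsEquiv J hJ (formOp A Z hZ θ) := by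
  ext i j
  have e1 : A'⁻¹ * (J.transpose * θ.1 * J) * A'⁻¹.transpose
      = J⁻¹ * (A⁻¹ * θ.1 * A⁻¹.transpose) * J⁻¹.transpose := by
    have hJt : IsUnit J.transpose.det := by rwa [Matrix.det_transpose]
    rw [hA, Matrix.mul_inv_rev, Matrix.mul_inv_rev]
    calc J⁻¹ * (A⁻¹ * J.transpose⁻¹) * (J.transpose * θ.1 * J)
          * (J⁻¹ * (A⁻¹ * J.transpose⁻¹)).transpose
        = J⁻¹ * (A⁻¹ * (J.transpose⁻¹ * J.transpose) * θ.1 * (J * J.transpose⁻¹.transpose)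
          * A⁻¹.transpose) * J⁻¹.transpose := by
          simp only [Matrix.transpose_mul, mul_assoc]
      _ = _ := by
          rw [Matrix.nonsing_inv_mul _ hJt, Matrix.transpose_nonsing_inv, Matrix.transpose_transpose,
            Matrix.mul_nonsing_inv _ hJ, mul_one, mul_one]
  set N := A⁻¹ * θ.1 * A⁻¹.transpose with hN
  have e2 : J * (J⁻¹ * N * J⁻¹.transpose) * J.transpose = N := by
    calc J * (J⁻¹ * N * J⁻¹.transpose) * J.transpose
        = (J * J⁻¹) * N * (J * J⁻¹).transpose := by
          simp only [Matrix.transpose_mul, mul_assoc]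
      _ = N := by simp [Matrix.mul_nonsing_inv _ hJ]
  set K := J⁻¹ * N * J⁻¹.transpose with hK
  have e3 : ∀ c d, N c d = ∑ k, ∑ l, J c k * J d l * K k l := by
    intro c d
    rw [← e2]
    simp only [Matrix.mul_apply, Matrix.transpose_apply, Finset.sum_mul]
    rw [Finset.sum_comm]
    exact Finset.sum_congr rfl fun _ _ => Finset.sum_congr rfl fun _ _ => by ring
  show 1 / 2 * ∑ k, ∑ l, Z' i j k l * (A'⁻¹ * (J.transpose * θ.1 * J) * A'⁻¹.transpose) k l
    = (J.transpose * (Matrix.of fun a b => 1 / 2 * ∑ c, ∑ d, Z a b c d * N c d) * J) i j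
  rw [e1]
  have e4 : ∀ a b, ∑ k, ∑ l, (∑ c, J c k * ∑ d, J d l * Z a b c d) * K k l
      = ∑ c, ∑ d, Z a b c d * N c d := by
    intro a b
    simp only [e3, Finset.sum_mul, Finset.mul_sum]
    rw [Finset.sum_congr rfl fun _ _ => Finset.sum_comm, Finset.sum_comm]
    refine Finset.sum_congr rfl fun c _ => ?_
    rw [Finset.sum_congr rfl fun _ _ => Finset.sum_comm, Finset.sum_comm]
    exact Finset.sum_congr rfl fun d _ => Finset.sum_congr rfl fun _ _ =>
      Finset.sum_congr rfl fun _ _ => by ring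
  simp only [Matrix.mul_apply, Matrix.transpose_apply, Matrix.of_apply, ← e4, h]
  exact pull_sum (fun a => J a i) (fun b => J b j)
    (fun a b k l => ∑ c, J c k * ∑ d, J d l * Z a b c d) K

/-- Both sides are the determinant of the matrix whose row r is column v r of J. The right side is
its multilinear expansion in unit vectors. -/
theorem pullComp_det (J : Matrix (Fin 4) (Fin 4) ℝ) (v : Fin 4 → Fin 4) :
    J.det * ((1 : Matrix (Fin 4) (Fin 4) ℝ).submatrix v id).det
      = pullComp J (fun P => ((1 : Matrix (Fin 4) (Fin 4) ℝ).submatrix P id).det) v := by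
  have h : J.det * ((1 : Matrix (Fin 4) (Fin 4) ℝ).submatrix v id).det
      = Matrix.det (fun r : Fin 4 => ∑ p, J p (v r) • (1 : Matrix (Fin 4) (Fin 4) ℝ) p) := by
    rw [← Matrix.det_transpose J, mul_comm, ← Matrix.det_mul]
    congr 1
    ext a b
    simp [Matrix.mul_apply, Matrix.one_apply, Finset.sum_apply]
  rw [h]
  refine ((Matrix.detRowAlternating (n := Fin 4) (R := ℝ)).toMultilinearMap.map_sum
    (fun r p => J p (v r) • (1 : Matrix (Fin 4) (Fin 4) ℝ) p)).trans ?_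
  refine Finset.sum_congr rfl fun P _ => ?_
  rw [MultilinearMap.map_smul_univ, smul_eq_mul]
  rfl

/-- The Levi-Civita symbol is a tensor density: its pull-back acquires the factor det J. -/
theorem leviCivita_pull (J : Matrix (Fin 4) (Fin 4) ℝ) (i j k l : Fin 4) :
    J.det * leviCivita i j k l
      = ∑ a, J a i * ∑ b, J b j * ∑ c, J c k * ∑ d, J d l * leviCivita a b c d := by
  refine (pullComp_det J ![i, j, k, l]).trans ?_
  simp only [pullComp_vecCons]
  simp only [pullComp_nil]
  rfl

section Conjugation

variable {V V' : Type*} [AddCommGroup V] [Module ℝ V] [AddCommGroup V'] [Module ℝ V']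

/-- L intertwines the operators P, P', so it restricts to an isomorphism of their ranges; it also
intertwines W and W', so the two compressions are conjugate. -/
theorem det_rangeRestrict_comp {P W : V →ₗ[ℝ] V} {P' W' : V' →ₗ[ℝ] V'} (L : V ≃ₗ[ℝ] V')
    (hP : ∀ v, P' (L v) = L (P v)) (hW : ∀ v, W' (L v) = L (W v)) :
    LinearMap.det (P'.rangeRestrict ∘ₗ W' ∘ₗ (LinearMap.range P').subtype)
      = LinearMap.det (P.rangeRestrict ∘ₗ W ∘ₗ (LinearMap.range P).subtype) := by
  have hmap : (LinearMap.range P).map (L : V →ₗ[ℝ] V') = LinearMap.range P' := by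
    ext x
    constructor
    · rintro ⟨_, ⟨v, rfl⟩, rfl⟩
      exact ⟨L v, hP v⟩
    · rintro ⟨v, rfl⟩
      exact ⟨P (L.symm v), ⟨_, rfl⟩, by
        rw [LinearEquiv.coe_coe, ← hP, L.apply_symm_apply]⟩
  set e : LinearMap.range P ≃ₗ[ℝ] LinearMap.range P' := L.ofSubmodules _ _ hmap with he
  rw [← LinearMap.det_conj _ e]
  congr 1
  refine LinearMap.ext fun x => ?_
  obtain ⟨y, rfl⟩ := e.surjective x
  apply Subtype.ext
  simp only [LinearMap.comp_apply, LinearEquiv.coe_coe, LinearEquiv.symm_apply_apply]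
  show P' (W' (L y)) = L (P (W y))
  rw [hW, hP]

end Conjugation

/-- The volume factor changes by |det J| and the Levi-Civita symbol by det J. Hence the Hodge star
commutes with pull-back exactly when the orientation sign changes by the sign of det J, which is
what `hst` says; W commutes with pull-back by naturality. -/
theorem IsPullback.det_weylPlus {φ : E4 → E4} {V U : Set E4} {H G : LocalMetric}
    (hφ : IsPullback φ V U H G) {z : E4} (hz : z ∈ V) {s t : ℝ}
    (hst : t * |(jac φ z).det| = s * (jac φ z).det) :
    LinearMap.det (M := selfDual (H z) t) (weylPlus H t z)
      = LinearMap.det (M := selfDual (G (φ z)) s) (weylPlus G s (φ z)) := by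
  have hJ := (hφ.det_jac_ne_zero hz).isUnit
  set J := jac φ z with hJdef
  have hA : H z = J.transpose * G (φ z) * J := hφ.metric_eq hz
  have hstar : ∀ θ, hodgeStar (H z) t (twoFormsEquiv J hJ θ)
      = twoFormsEquiv J hJ (hodgeStar (G (φ z)) s θ) := by
    refine formOp_pull hJ hA _ _ fun i j k l => ?_
    have hdet : √(H z).det = |J.det| * √(G (φ z)).det := by
      rw [hA, Matrix.det_mul, Matrix.det_mul, Matrix.det_transpose, mul_right_comm, ← pow_two,
        Real.sqrt_mul (sq_nonneg _), Real.sqrt_sq_eq_abs]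
    have e := leviCivita_pull J i j k l
    calc t * √(H z).det * leviCivita i j k l
        = t * |J.det| * √(G (φ z)).det * leviCivita i j k l := by rw [hdet]; ring
      _ = s * √(G (φ z)).det * (J.det * leviCivita i j k l) := by rw [hst]; ring
      _ = _ := by
        rw [e]
        simp only [Finset.mul_sum]
        refine Finset.sum_congr rfl fun _ _ => Finset.sum_congr rfl fun _ _ =>
          Finset.sum_congr rfl fun _ _ => Finset.sum_congr rfl fun _ _ => by ring
  refine det_rangeRestrict_comp (twoFormsEquiv J hJ) (fun θ => ?_) fun θ => ?_
  · simp only [sdProj, LinearMap.smul_apply, LinearMap.add_apply, LinearMap.id_apply, hstar, map_add,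
      map_smul]
  · refine formOp_pull hJ hA _ _ (fun i j k l => ?_) θ
    rw [natural_weyl.covariant hφ z hz]
    simp only [pullComp_vecCons]
    simp only [pullComp_nil]
    rfl

/-! ### Self-dual forms and the blocks of W in an orthonormal frame -/

/-- The Vandermonde product of the four indices is alternating; 12 is its value at 0, 1, 2, 3. The
identity is checked over the integers on all quadruples. -/
theorem leviCivita_eq (i j k l : Fin 4) : leviCivita i j k l
    = ((j : ℝ) - i) * ((k : ℝ) - i) * ((l : ℝ) - i) * ((k : ℝ) - j) * ((l : ℝ) - j)
      * ((l : ℝ) - k) / 12 := by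
  have h : leviCivita i j k l
      = (((1 : Matrix (Fin 4) (Fin 4) ℤ).submatrix ![i, j, k, l] id).det : ℝ) := by
    rw [leviCivita, Int.cast_det]
    generalize ![i, j, k, l] = v
    congr 1
    ext a b
    simp [Matrix.one_apply]
  have h2 : ∀ i j k l : Fin 4,
      12 * ((1 : Matrix (Fin 4) (Fin 4) ℤ).submatrix ![i, j, k, l] id).det
      = ((j : ℤ) - i) * ((k : ℤ) - i) * ((l : ℤ) - i) * ((k : ℤ) - j) * ((l : ℤ) - j)
        * ((l : ℤ) - k) := by
    intro i j k l
    rw [Matrix.det_succ_row_zero]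
    simp only [Matrix.det_fin_three, Fin.sum_univ_four]
    revert i j k l
    decide +kernel
  have h3 := congrArg (Int.cast (R := ℝ)) (h2 i j k l)
  push_cast at h3
  rw [h]
  push_cast
  linarith

theorem formOp_one {Z : Fin 4 → Fin 4 → Fin 4 → Fin 4 → ℝ}
    (hZ : ∀ i j k l, Z i j k l = -Z j i k l) (θ : twoForms) (i j : Fin 4) :
    (formOp 1 Z hZ θ).1 i j = (1 / 2) * ∑ k, ∑ l, Z i j k l * θ.1 k l := by
  simp [formOp]

theorem sdProj_one (s : ℝ) (θ : twoForms) (i j : Fin 4) :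
    (sdProj 1 s θ).1 i j
      = (1 / 2) * (θ.1 i j + (1 / 2) * s * ∑ k, ∑ l, leviCivita i j k l * θ.1 k l) := by
  have : (hodgeStar 1 s θ).1 i j = (1 / 2) * s * ∑ k, ∑ l, leviCivita i j k l * θ.1 k l := by
    rw [hodgeStar, formOp_one]
    simp [mul_assoc, Finset.mul_sum]
  simp only [sdProj, LinearMap.smul_apply, LinearMap.add_apply, LinearMap.id_apply, Submodule.coe_smul,
    Submodule.coe_add, Matrix.smul_apply, Matrix.add_apply, smul_eq_mul, this]

theorem sdProj_one_components (s : ℝ) (θ : twoForms) :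
    (sdProj 1 s θ).1 0 1 = 1 / 2 * (θ.1 0 1 + s * θ.1 2 3) ∧
    (sdProj 1 s θ).1 0 2 = 1 / 2 * (θ.1 0 2 - s * θ.1 1 3) ∧
    (sdProj 1 s θ).1 0 3 = 1 / 2 * (θ.1 0 3 + s * θ.1 1 2) ∧
    (sdProj 1 s θ).1 1 2 = 1 / 2 * (θ.1 1 2 + s * θ.1 0 3) ∧
    (sdProj 1 s θ).1 1 3 = 1 / 2 * (θ.1 1 3 - s * θ.1 0 2) ∧
    (sdProj 1 s θ).1 2 3 = 1 / 2 * (θ.1 2 3 + s * θ.1 0 1) := by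
  have h10 := θ.2 1 0
  have h20 := θ.2 2 0
  have h30 := θ.2 3 0
  have h21 := θ.2 2 1
  have h31 := θ.2 3 1
  have h32 := θ.2 3 2
  simp only [sdProj_one, leviCivita_eq, Fin.sum_univ_four, h10, h20, h30, h21, h31, h32]
  norm_num
  refine ⟨?_, ?_, ?_, ?_, ?_, ?_⟩ <;> ring

/-- The 2-form with given components. -/
def twoFormOf (a b c d e f : ℝ) : twoForms :=
  ⟨!![0, a, b, c; -a, 0, d, e; -b, -d, 0, f; -c, -e, -f, 0], fun i j => by
    fin_cases i <;> fin_cases j <;> simp⟩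

theorem twoForms_ext {θ η : twoForms} (h1 : θ.1 0 1 = η.1 0 1) (h2 : θ.1 0 2 = η.1 0 2)
    (h3 : θ.1 0 3 = η.1 0 3) (h4 : θ.1 1 2 = η.1 1 2) (h5 : θ.1 1 3 = η.1 1 3)
    (h6 : θ.1 2 3 = η.1 2 3) : θ = η := by
  have z : ∀ (θ : twoForms) i, θ.1 i i = 0 := fun θ i => by linarith [θ.2 i i]
  have s := θ.2
  have t := η.2
  ext i j
  fin_cases i <;> fin_cases j <;>
    simp only [Fin.reduceFinMk, Fin.isValue, Fin.zero_eta, Fin.mk_one, z, h1, h2, h3, h4, h5, h6,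
      s 1 0, s 2 0, s 3 0, s 2 1, s 3 1, s 3 2, t 1 0, t 2 0, t 3 0, t 2 1, t 3 1, t 3 2]

/-- The coordinates `(θ₀₁, θ₀₂, θ₀₃)` on the space of self-dual forms. -/
def selfDualEquiv (s : ℝ) (hs : s * s = 1) : selfDual 1 s ≃ₗ[ℝ] (Fin 3 → ℝ) where
  toFun θ := ![θ.1.1 0 1, θ.1.1 0 2, θ.1.1 0 3]
  map_add' θ η := by
    ext i
    fin_cases i <;> simp
  map_smul' c θ := by
    ext i
    fin_cases i <;> simp
  invFun v := ⟨twoFormOf (v 0) (v 1) (v 2) (s * v 2) (-(s * v 1)) (s * v 0), by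
    refine ⟨twoFormOf (v 0) (v 1) (v 2) (s * v 2) (-(s * v 1)) (s * v 0), ?_⟩
    obtain ⟨h1, h2, h3, h4, h5, h6⟩ := sdProj_one_components s
      (twoFormOf (v 0) (v 1) (v 2) (s * v 2) (-(s * v 1)) (s * v 0))
    apply twoForms_ext
    · rw [h1]; simp [twoFormOf]; linear_combination (1 / 2 * v 0) * hs
    · rw [h2]; simp [twoFormOf]; linear_combination (1 / 2 * v 1) * hs
    · rw [h3]; simp [twoFormOf]; linear_combination (1 / 2 * v 2) * hs
    · rw [h4]; simp [twoFormOf]; ring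
    · rw [h5]; simp [twoFormOf]; ring
    · rw [h6]; simp [twoFormOf]; ring⟩
  left_inv := by
    rintro ⟨_, θ, rfl⟩
    obtain ⟨h1, h2, h3, h4, h5, h6⟩ := sdProj_one_components s θ
    apply Subtype.ext
    apply twoForms_ext
    · simp [twoFormOf]
    · simp [twoFormOf]
    · simp [twoFormOf]
    · simp [twoFormOf, h3, h4]; linear_combination (1 / 2 * θ.1 1 2) * hs
    · simp [twoFormOf, h2, h5]; linear_combination (1 / 2 * θ.1 1 3) * hs
    · simp [twoFormOf, h1, h6]; linear_combination (1 / 2 * θ.1 2 3) * hs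
  right_inv v := by
    ext i
    fin_cases i <;> simp [twoFormOf]

theorem formOp_one_apply {Z : Fin 4 → Fin 4 → Fin 4 → Fin 4 → ℝ} (hZ : IsWeyl Z) (θ : twoForms)
    (i j : Fin 4) : (formOp 1 Z hZ.swap θ).1 i j
      = Z i j 0 1 * θ.1 0 1 + Z i j 0 2 * θ.1 0 2 + Z i j 0 3 * θ.1 0 3 + Z i j 1 2 * θ.1 1 2
        + Z i j 1 3 * θ.1 1 3 + Z i j 2 3 * θ.1 2 3 := by
  have h10 := θ.2 1 0
  have h20 := θ.2 2 0
  have h30 := θ.2 3 0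
  have h21 := θ.2 2 1
  have h31 := θ.2 3 1
  have h32 := θ.2 3 2
  have s := hZ.swap' i j
  simp only [formOp_one, Fin.sum_univ_four, h10, h20, h30, h21, h31, h32, s 1 0, s 2 0, s 3 0, s 2 1,
    s 3 1, s 3 2, hZ.diag']
  ring

/-- For s = ±1 a form in the range of the projection satisfies θ₂₃ = sθ₀₁, θ₁₃ = −sθ₀₂, θ₁₂ = sθ₀₃.
In the coordinates θ₀₁, θ₀₂, θ₀₃ the block therefore has this matrix, the symmetries of Z making the
projection harmless. -/
theorem IsWeyl.det_selfDual {Z : Fin 4 → Fin 4 → Fin 4 → Fin 4 → ℝ} (hZ : IsWeyl Z) {s : ℝ}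
    (hs : s * s = 1) :
    LinearMap.det (M := selfDual 1 s)
      ((sdProj 1 s).rangeRestrict ∘ₗ formOp 1 Z hZ.swap ∘ₗ (selfDual 1 s).subtype)
      = Matrix.det !![Z 0 1 0 1 + s * Z 0 1 2 3, Z 0 1 0 2 - s * Z 0 1 1 3, Z 0 1 0 3 + s * Z 0 1 1 2;
        Z 0 2 0 1 + s * Z 0 2 2 3, Z 0 2 0 2 - s * Z 0 2 1 3, Z 0 2 0 3 + s * Z 0 2 1 2;
        Z 0 3 0 1 + s * Z 0 3 2 3, Z 0 3 0 2 - s * Z 0 3 1 3, Z 0 3 0 3 + s * Z 0 3 1 2] := by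
  set N : Matrix (Fin 3) (Fin 3) ℝ := !![Z 0 1 0 1 + s * Z 0 1 2 3, Z 0 1 0 2 - s * Z 0 1 1 3,
      Z 0 1 0 3 + s * Z 0 1 1 2;
    Z 0 2 0 1 + s * Z 0 2 2 3, Z 0 2 0 2 - s * Z 0 2 1 3, Z 0 2 0 3 + s * Z 0 2 1 2;
    Z 0 3 0 1 + s * Z 0 3 2 3, Z 0 3 0 2 - s * Z 0 3 1 3, Z 0 3 0 3 + s * Z 0 3 1 2] with hN
  rw [← LinearMap.det_toLin', ← LinearMap.det_conj (N := selfDual 1 s) _ (selfDualEquiv s hs).symm]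
  congr 1
  refine LinearMap.ext fun θ => (selfDualEquiv s hs).injective ?_
  obtain ⟨v, rfl⟩ := (selfDualEquiv s hs).symm.surjective θ
  set θ := (selfDualEquiv s hs).symm v with hθ
  obtain ⟨h1, h2, h3, -, -, -⟩ := sdProj_one_components s (formOp 1 Z hZ.swap θ.1)
  obtain ⟨⟨_, _, _, _, _, _⟩, ⟨_, _, _, _, _, _⟩, ⟨_, _, _, _, _, _, _⟩, ⟨_, _, _, _⟩,
    ⟨_, _, _, _, _, _, _, _, _⟩, _, _, _, _, _, _⟩ := hZ.normalForm
  have t1 : θ.1.1 0 1 = v 0 := rfl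
  have t2 : θ.1.1 0 2 = v 1 := rfl
  have t3 : θ.1.1 0 3 = v 2 := rfl
  have t4 : θ.1.1 1 2 = s * v 2 := rfl
  have t5 : θ.1.1 1 3 = -(s * v 1) := rfl
  have t6 : θ.1.1 2 3 = s * v 0 := rfl
  simp only [formOp_one_apply hZ, t1, t2, t3, t4, t5, t6] at h1 h2 h3
  have e : ∀ i, selfDualEquiv s hs ((sdProj 1 s).rangeRestrict (formOp 1 Z hZ.swap θ.1)) i
      = ![(sdProj 1 s (formOp 1 Z hZ.swap θ.1)).1 0 1, (sdProj 1 s (formOp 1 Z hZ.swap θ.1)).1 0 2,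
        (sdProj 1 s (formOp 1 Z hZ.swap θ.1)).1 0 3] i := fun i => rfl
  ext i
  have r : selfDualEquiv s hs ((selfDualEquiv s hs).symm
      (Matrix.toLin' N (selfDualEquiv s hs θ))) i = ∑ j, N i j * v j := by
    rw [LinearEquiv.apply_symm_apply, hθ, LinearEquiv.apply_symm_apply, Matrix.toLin'_apply]
    rfl
  refine (e i).trans (Eq.trans ?_ r.symm)
  rw [h1, h2, h3]
  fin_cases i
  · simp [Fin.sum_univ_three, *]
    linear_combination (1 / 2 * (Z 0 1 0 3 * v 2 + Z 0 1 0 2 * v 1 + Z 0 1 0 1 * v 0)) * hs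
  · simp [Fin.sum_univ_three, *]
    linear_combination (1 / 2 * (Z 0 2 0 3 * v 2 + Z 0 2 0 2 * v 1 + Z 0 1 0 2 * v 0)) * hs
  · simp [Fin.sum_univ_three, *]
    linear_combination (1 / 2 * ((-Z 0 1 0 1 - Z 0 2 0 2) * v 2 + Z 0 2 0 3 * v 1
      + Z 0 1 0 3 * v 0)) * hs

/-- Each block is a trace-free 3×3 matrix, so the trace of its cube is three times its determinant.
The sum over ordered index pairs is 8 times the trace of Z³ on Λ², whence 72 = 3·8·3. The code
verifies this as a polynomial identity in the ten components. -/
theorem IsWeyl.det_add_det {Z : Fin 4 → Fin 4 → Fin 4 → Fin 4 → ℝ} (hZ : IsWeyl Z) {s : ℝ}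
    (hs : s * s = 1) :
    72 * LinearMap.det (M := selfDual 1 s)
        ((sdProj 1 s).rangeRestrict ∘ₗ formOp 1 Z hZ.swap ∘ₗ (selfDual 1 s).subtype)
      + 72 * LinearMap.det (M := selfDual 1 (-s))
        ((sdProj 1 (-s)).rangeRestrict ∘ₗ formOp 1 Z hZ.swap ∘ₗ (selfDual 1 (-s)).subtype)
      = 3 * ∑ i, ∑ j, ∑ k, ∑ l, ∑ m, ∑ n, Z i j k l * Z k l m n * Z m n i j := by
  rw [hZ.det_selfDual hs, hZ.det_selfDual (by linarith : (-s) * (-s) = 1)]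
  obtain ⟨⟨_, _, _, _, _, _⟩, ⟨_, _, _, _, _, _⟩, ⟨_, _, _, _, _, _, _⟩, ⟨_, _, _, _⟩,
    ⟨_, _, _, _, _, _, _, _, _⟩, _, _, _, _, _, _⟩ := hZ.normalForm
  have d := hZ.diag
  have d' := hZ.diag'
  clear hZ
  simp only [Matrix.det_fin_three, Matrix.of_apply, Matrix.cons_val]
  simp only [Fin.sum_univ_four]
  simp only [*, mul_zero, zero_mul, add_zero, zero_add]
  rcases mul_self_eq_one_iff.1 hs with rfl | rfl <;> ring

theorem IsNormal.det_weylPlus_add {G : LocalMetric} {U : Set E4} (hG : IsNormal G U) {s : ℝ}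
    (hs : s * s = 1) (I : Fin 0 → Fin 4) :
    72 * LinearMap.det (M := selfDual (G 0) s) (weylPlus G s 0)
      + 72 * LinearMap.det (M := selfDual (G 0) (-s)) (weylPlus G (-s) 0)
      = 3 * BachFlat.weylCubeT G 0 I := by
  -- The space of self-dual forms depends on the metric matrix, so the equality of that matrix with
  -- 1 is substituted for a variable A.
  have key : ∀ {A : Matrix (Fin 4) (Fin 4) ℝ} (_ : A = 1)
      {Z : Fin 4 → Fin 4 → Fin 4 → Fin 4 → ℝ} (hZ : IsWeyl Z),
      72 * LinearMap.det (M := selfDual A s)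
        ((sdProj A s).rangeRestrict ∘ₗ formOp A Z hZ.swap ∘ₗ (selfDual A s).subtype)
      + 72 * LinearMap.det (M := selfDual A (-s))
        ((sdProj A (-s)).rangeRestrict ∘ₗ formOp A Z hZ.swap ∘ₗ (selfDual A (-s)).subtype)
      = 3 * ∑ i, ∑ j, ∑ k, ∑ l, ∑ m, ∑ n, Z i j k l * Z k l m n * Z m n i j := by
    rintro A rfl Z hZ
    exact hZ.det_add_det hs
  rw [hG.weylCubeT]
  exact key hG.apply_zero (isWeyl_weyl hG)

theorem IsMetricOn.det_weylPlus_add {G : LocalMetric} {U : Set E4} (hG : IsMetricOn G U) {y : E4}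
    (hy : y ∈ U) {s : ℝ} (hs : s * s = 1) (I : Fin 0 → Fin 4) :
    72 * LinearMap.det (M := selfDual (G y) s) (weylPlus G s y)
      + 72 * LinearMap.det (M := selfDual (G y) (-s)) (weylPlus G (-s) y)
      = 3 * weylCubeT G y I := by
  obtain ⟨φ, V, H, hφ, hH, rfl⟩ := exists_isNormal hG hy
  have hJ := hφ.det_jac_ne_zero hH.zero_mem
  set d := (jac φ 0).det with hd
  have hd' : |d| ≠ 0 := abs_ne_zero.2 hJ
  -- The sign in the normal coordinates is s times the sign of the Jacobian determinant; both
  -- orientation signs are transported by it.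
  have e1 : s * (d / |d|) * |d| = s * d := by field_simp
  have e2 : s * (d / |d|) * (s * (d / |d|)) = 1 := by
    have : d / |d| * (d / |d|) = 1 := by
      rw [div_mul_div_comm, abs_mul_abs_self, div_self (mul_ne_zero hJ hJ)]
    linear_combination (d / |d| * (d / |d|)) * hs + this
  have e3 : -(s * (d / |d|)) * |d| = -s * d := by linear_combination -e1
  have h := hH.det_weylPlus_add e2 I
  rw [hφ.det_weylPlus hH.zero_mem e1, hφ.det_weylPlus hH.zero_mem e3,
    natural_weylCubeT.covariant hφ 0 hH.zero_mem, pullComp_nil] at h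
  rw [h, Subsingleton.elim I ![]]

theorem weylRicRicT_apply (G : LocalMetric) (y : E4) (I : Fin 0 → Fin 4) :
    weylRicRicT G y I = weylRicRic G y := by
  simp only [weylRicRicT, pairing, weylRicRic, sum_four]
  refine Finset.sum_congr rfl fun i _ => Finset.sum_congr rfl fun j _ =>
    Finset.sum_congr rfl fun k _ => Finset.sum_congr rfl fun l _ =>
    Finset.sum_congr rfl fun a _ => ?_
  rw [Finset.sum_comm]
  refine Finset.sum_congr rfl fun b _ => Finset.sum_congr rfl fun c _ =>
    Finset.sum_congr rfl fun d _ => ?_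
  simp only [Fin.prod_univ_four, mulT, tracefreeRicT_apply, comp_vecCons, comp_vecEmpty,
    Matrix.cons_val]
  ring

/-- The integrand on the right-hand side, in coordinates. -/
theorem IsMetricOn.weylPotentialT_eq {G : LocalMetric} {U : Set E4} (hG : IsMetricOn G U) {y : E4}
    (hy : y ∈ U) {s : ℝ} (hs : s * s = 1) (I : Fin 0 → Fin 4) :
    weylPotentialT G y I = 72 * LinearMap.det (M := selfDual (G y) s) (weylPlus G s y)
      + 72 * LinearMap.det (M := selfDual (G y) (-s)) (weylPlus G (-s) y)
      - 1 / 2 * scal G y * normSq G (weyl G) y + 2 * weylRicRic G y := by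
  have : normSqWeylT G y I = normSq G (weyl G) y := rfl
  rw [weylPotentialT_apply, hG.det_weylPlus_add hy hs I, weylRicRicT_apply, this]
  ring

/-! ### The metric in the charts of a manifold -/

theorem IsMetricOn.mono {G : LocalMetric} {U V : Set E4} (hG : IsMetricOn G U) (hV : IsOpen V)
    (h : V ⊆ U) : IsMetricOn G V :=
  ⟨hV, fun z hz => hG.smooth z (h hz), fun z hz => hG.posDef z (h hz)⟩

section Charts

variable {M : Type*} [TopologicalSpace M] {e e' : OpenPartialHomeomorph M E4}

/-- The domain of the coordinate change from `e` to `e'`. -/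
def overlap (e e' : OpenPartialHomeomorph M E4) : Set E4 := e.target ∩ e.symm ⁻¹' e'.source

theorem isOpen_overlap : IsOpen (overlap e e') := e.isOpen_inter_preimage_symm e'.open_source

variable [ChartedSpace E4 M]

theorem sum_smul_coordVec (y : E4) (x : Fin 4 → ℝ) :
    ∑ i, x i • coordVec e y i
      = mfderiv 𝓘(ℝ, E4) 𝓘(ℝ, E4) e.symm y (WithLp.toLp 2 x : E4) := by
  have : (WithLp.toLp 2 x : E4) = ∑ i, x i • basisVec i := by
    ext j
    simp [basisVec, Finset.sum_apply, Pi.single_apply]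
  rw [this]
  exact ((map_sum (mfderiv 𝓘(ℝ, E4) 𝓘(ℝ, E4) e.symm y) (fun i => x i • basisVec i) _).trans
    (Finset.sum_congr rfl fun i _ => map_smul _ _ _)).symm

variable [IsManifold 𝓘(ℝ, E4) ∞ M] (g : Metric M)

theorem contMDiffOn_symm (he : e ∈ atlas E4 M) :
    ContMDiffOn 𝓘(ℝ, E4) 𝓘(ℝ, E4) ∞ e.symm e.target :=
  contMDiffOn_symm_of_mem_maximalAtlas (IsManifold.subset_maximalAtlas he)

theorem contMDiffOn_chart (he : e ∈ atlas E4 M) :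
    ContMDiffOn 𝓘(ℝ, E4) 𝓘(ℝ, E4) ∞ e e.source :=
  contMDiffOn_of_mem_maximalAtlas (IsManifold.subset_maximalAtlas he)

/-- The coordinate field is the image of a constant vector field under the tangent map of the
inverse chart. -/
theorem contMDiffOn_coordVec (he : e ∈ atlas E4 M) (i : Fin 4) :
    ContMDiffOn 𝓘(ℝ, E4) (𝓘(ℝ, E4).prod 𝓘(ℝ, E4)) ∞
      (fun y => (Bundle.TotalSpace.mk' E4 (e.symm y) (coordVec e y i) : TangentBundle 𝓘(ℝ, E4) M))
      e.target := by
  have h1 := (contMDiffOn_symm he).contMDiffOn_tangentMapWithin (m := ∞) (by simp)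
    e.open_target.uniqueMDiffOn
  have h2 : ContMDiffOn 𝓘(ℝ, E4) (𝓘(ℝ, E4).prod 𝓘(ℝ, E4)) ∞
      (fun y : E4 => (Bundle.TotalSpace.mk' E4 y (basisVec i) : TangentBundle 𝓘(ℝ, E4) E4))
      e.target :=
    contMDiffOn_vectorSpace_iff_contDiffOn.2 contDiffOn_const
  refine (h1.comp h2 fun y hy => hy).congr fun y hy => ?_
  simp only [Function.comp_apply, tangentMapWithin, coordVec]
  rw [mfderivWithin_of_isOpen e.open_target hy]

theorem smooth_metricIn (he : e ∈ atlas E4 M) {y : E4} (hy : y ∈ e.target) (i j : Fin 4) :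
    ContDiffAt ℝ ∞ (fun z => metricIn g e z i j) y := by
  have hs := (contMDiffOn_symm he).contMDiffAt (e.open_target.mem_nhds hy)
  have h1 := (contMDiffOn_coordVec he i).contMDiffAt (e.open_target.mem_nhds hy)
  have h2 := (contMDiffOn_coordVec he j).contMDiffAt (e.open_target.mem_nhds hy)
  have h0 := (g.contMDiff (e.symm y)).comp y hs
  have h3 := ContMDiffAt.clm_bundle_apply₂ (F₁ := E4) (F₂ := E4) (F₃ := ℝ)
    (E₁ := fun x : M => TangentSpace 𝓘(ℝ, E4) x) (E₂ := fun x : M => TangentSpace 𝓘(ℝ, E4) x)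
    (E₃ := fun x : M => Bundle.Trivial M ℝ x)
    (b := e.symm) h0 h1 h2
  simp only [Bundle.contMDiffAt_totalSpace] at h3
  exact h3.2.contDiffAt

theorem isMetricOn_metricIn (he : e ∈ atlas E4 M) : IsMetricOn (metricIn g e) e.target where
  isOpen := e.open_target
  smooth y hy i j := smooth_metricIn g he hy i j
  posDef y hy := by
    refine Matrix.PosDef.of_dotProduct_mulVec_pos ?_ fun x hx => ?_
    · ext i j
      simp [metricIn, g.symm _ (coordVec e y i)]
    · have hinj := (mdifferentiable_of_mem_atlas (I := 𝓘(ℝ, E4)) he).symm.mfderiv_injective hy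
      have h := g.pos (e.symm y) (∑ i, x i • coordVec e y i) (by
        rw [sum_smul_coordVec]
        intro h
        refine hx ?_
        have h2 : (WithLp.toLp 2 x : E4) = 0 := hinj (h.trans (map_zero _).symm)
        simpa using h2)
      simp only [map_sum, map_smul, sum_apply, smul_apply,
        smul_eq_mul] at h
      simp only [dotProduct, Matrix.mulVec, metricIn, Matrix.of_apply, Finset.mul_sum,
        Pi.star_apply, star_trivial]
      rw [Finset.sum_comm]
      refine h.trans_eq (Finset.sum_congr rfl fun i _ => ?_)
      rw [Finset.mul_sum]
      refine Finset.sum_congr rfl fun j _ => ?_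
      ring

/-- All tangent spaces have the same underlying vector space `E4`, so vectors can be carried along
an equality of base points. -/
theorem metric_congr {p q : M} (h : p = q) (v w : E4) :
    g.inner p (v : TangentSpace 𝓘(ℝ, E4) p) (w : TangentSpace 𝓘(ℝ, E4) p)
      = g.inner q (v : TangentSpace 𝓘(ℝ, E4) q) (w : TangentSpace 𝓘(ℝ, E4) q) := by
  subst h
  rfl

theorem contDiffAt_transition (he : e ∈ atlas E4 M) (he' : e' ∈ atlas E4 M) {y : E4}
    (hy : y ∈ overlap e e') : ContDiffAt ℝ ∞ (e' ∘ e.symm) y :=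
  (((contMDiffOn_chart he').contMDiffAt (e'.open_source.mem_nhds hy.2)).comp y
    ((contMDiffOn_symm he).contMDiffAt (e.open_target.mem_nhds hy.1))).contDiffAt

/-- The chain rule for e⁻¹ = e'⁻¹ ∘ (e' ∘ e⁻¹), which holds near y. -/
theorem coordVec_transition (he : e ∈ atlas E4 M) (he' : e' ∈ atlas E4 M) {y : E4}
    (hy : y ∈ overlap e e') (i : Fin 4) :
    (coordVec e y i : E4) = ∑ a, jac (e' ∘ e.symm) y a i • (coordVec e' (e' (e.symm y)) a : E4) := by
  have hφ := contDiffAt_transition he he' hy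
  have h1 : MDifferentiableAt 𝓘(ℝ, E4) 𝓘(ℝ, E4) (e' ∘ e.symm) y :=
    (hφ.differentiableAt (by simp)).mdifferentiableAt
  have hy' : e' (e.symm y) ∈ e'.target := e'.map_source hy.2
  have h2 : MDifferentiableAt 𝓘(ℝ, E4) 𝓘(ℝ, E4) e'.symm ((e' ∘ e.symm) y) :=
    ((contMDiffOn_symm he').contMDiffAt (e'.open_target.mem_nhds hy')).mdifferentiableAt (by simp)
  have h3 : mfderiv 𝓘(ℝ, E4) 𝓘(ℝ, E4) e.symm y
      = mfderiv 𝓘(ℝ, E4) 𝓘(ℝ, E4) (e'.symm ∘ (e' ∘ e.symm)) y := by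
    refine Filter.EventuallyEq.mfderiv_eq ?_
    filter_upwards [isOpen_overlap.mem_nhds hy] with z hz
    simp [e'.left_inv hz.2]
  rw [mfderiv_comp y h2 h1, mfderiv_eq_fderiv] at h3
  have h4 : (coordVec e y i : E4) = mfderiv 𝓘(ℝ, E4) 𝓘(ℝ, E4) e'.symm ((e' ∘ e.symm) y)
      (fderiv ℝ (e' ∘ e.symm) y (basisVec i)) := by
    unfold coordVec
    exact congrArg (fun L : E4 →L[ℝ] E4 => L (basisVec i)) h3
  have h5 : HasFDerivAt (e' ∘ e.symm) (fderiv ℝ (e' ∘ e.symm) y) y :=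
    (hφ.differentiableAt (by simp)).hasFDerivAt
  have h6 : (WithLp.toLp 2 fun a => jac (e' ∘ e.symm) y a i : E4)
      = fderiv ℝ (e' ∘ e.symm) y (basisVec i) := by
    ext a
    have h7 := (EuclideanSpace.proj a : E4 →L[ℝ] ℝ).hasFDerivAt.comp y h5
    exact congrArg (fun L : E4 →L[ℝ] ℝ => L (basisVec i)) h7.fderiv
  refine h4.trans ((sum_smul_coordVec _ _).trans ?_).symm
  exact congrArg (mfderiv 𝓘(ℝ, E4) 𝓘(ℝ, E4) e'.symm ((e' ∘ e.symm) y)) h6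

/-- Makes the coordinate theory apply to the manifold: a natural tensor has consistent components in
any two charts. -/
theorem isPullback_transition (he : e ∈ atlas E4 M) (he' : e' ∈ atlas E4 M) :
    IsPullback (e' ∘ e.symm) (overlap e e') e'.target (metricIn g e) (metricIn g e') where
  source := (isMetricOn_metricIn g he).mono isOpen_overlap Set.inter_subset_left
  target := isMetricOn_metricIn g he'
  mapsTo y hy := e'.map_source hy.2
  smooth y hy := contDiffAt_transition he he' hy
  metric y hy i j := by
    have hp : e.symm y = e'.symm (e' (e.symm y)) := (e'.left_inv hy.2).symm
    have h1 : metricIn g e y i j = g.inner (e'.symm (e' (e.symm y)))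
        (∑ a, jac (e' ∘ e.symm) y a i • coordVec e' (e' (e.symm y)) a)
        (∑ a, jac (e' ∘ e.symm) y a j • coordVec e' (e' (e.symm y)) a) := by
      refine (metric_congr g hp _ _).trans ?_
      rw [coordVec_transition he he' hy i, coordVec_transition he he' hy j]
    rw [h1]
    simp only [map_sum, map_smul, sum_apply, smul_apply,
        smul_eq_mul]
    rw [Finset.sum_comm]
    refine Finset.sum_congr rfl fun a _ => ?_
    rw [Finset.mul_sum]
    refine Finset.sum_congr rfl fun b _ => ?_
    simp only [metricIn, Matrix.of_apply, Function.comp_apply]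
    ring

end Charts

/-! ### The divergence of a covector field -/

section Divergence

variable {G : LocalMetric} {U : Set E4} {y : E4}

/-- Jacobi's formula: the determinant is differentiated column by column, and each replaced column
is evaluated by Cramer's rule. -/
theorem pderiv_det {A : LocalMetric} (hA : ∀ i j, DifferentiableAt ℝ (fun z => A z i j) y)
    (k : Fin 4) : pderiv k (fun z => (A z).det) y
      = ∑ a, ∑ i, (A y).adjugate a i * pderiv k (fun z => A z i a) y := by
  have h : ∀ a, ∑ i, (A y).adjugate a i * pderiv k (fun z => A z i a) y
      = ((A y).updateCol a fun i => pderiv k (fun z => A z i a) y).det := fun a => by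
    rw [← Matrix.cramer_apply, Matrix.cramer_eq_adjugate_mulVec]
    rfl
  have hp : ∀ σ : Equiv.Perm (Fin 4), DifferentiableAt ℝ (fun z => ∏ i, A z (σ i) i) y := fun σ =>
    (HasFDerivAt.finsetProd fun i _ => (hA (σ i) i).hasFDerivAt).differentiableAt
  simp only [h, Matrix.det_apply', pderiv_sum _ fun σ _ => (hp σ).const_mul _,
    pderiv_const_mul _ (hp _), pderiv_prod _ fun i _ => hA _ i]
  rw [Finset.sum_comm]
  refine Finset.sum_congr rfl fun σ _ => ?_
  rw [Finset.mul_sum]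
  refine Finset.sum_congr rfl fun a _ => ?_
  rw [← Finset.prod_erase_mul _ _ (Finset.mem_univ a)]
  congr 2
  · refine Finset.prod_congr rfl fun b hb => ?_
    rw [Matrix.updateCol_ne (Finset.ne_of_mem_erase hb)]
  · rw [Matrix.updateCol_self]

theorem IsMetricOn.differentiableAt_inv (hG : IsMetricOn G U) (hy : y ∈ U) (i j : Fin 4) :
    DifferentiableAt ℝ (fun z => (G z)⁻¹ i j) y :=
  (hG.smooth_inv hy i j).differentiableAt (by simp)

theorem IsMetricOn.pderiv_inv (hG : IsMetricOn G U) (hy : y ∈ U) (k i j : Fin 4) :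
    pderiv k (fun z => (G z)⁻¹ i j) y
      = -∑ a, ∑ b, (G y)⁻¹ i a * pderiv k (fun z => G z a b) y * (G y)⁻¹ b j := by
  have hd := fun i j => hG.differentiableAt hy i j
  have hi := fun i j => hG.differentiableAt_inv hy i j
  have h : ∀ b, ∑ s, (pderiv k (fun z => (G z)⁻¹ i s) y * G y s b
      + (G y)⁻¹ i s * pderiv k (fun z => G z s b) y) = 0 := by
    intro b
    have : pderiv k (fun z => ∑ s, (G z)⁻¹ i s * G z s b) y = 0 := by
      rw [pderiv_congr (h := fun _ => (1 : Matrix (Fin 4) (Fin 4) ℝ) i b), pderiv_const]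
      filter_upwards [hG.isOpen.mem_nhds hy] with z hz
      rw [← hG.inv_mul hz, Matrix.mul_apply]
    rw [pderiv_sum _ fun s _ => (hi i s).fun_mul (hd s b)] at this
    simpa only [pderiv_mul (hi _ _) (hd _ _)] using this
  have h1 : ∀ s, ∑ b, G y s b * (G y)⁻¹ b j = if s = j then 1 else 0 := fun s => by
    rw [← Matrix.mul_apply, hG.mul_inv hy, Matrix.one_apply]
  calc pderiv k (fun z => (G z)⁻¹ i j) y
      = ∑ s, pderiv k (fun z => (G z)⁻¹ i s) y * ∑ b, G y s b * (G y)⁻¹ b j := by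
        simp [h1]
    _ = ∑ b, (∑ s, pderiv k (fun z => (G z)⁻¹ i s) y * G y s b) * (G y)⁻¹ b j := by
        simp only [Finset.mul_sum, Finset.sum_mul]
        rw [Finset.sum_comm]
        exact Finset.sum_congr rfl fun _ _ => Finset.sum_congr rfl fun _ _ => by ring
    _ = ∑ b, (-∑ s, (G y)⁻¹ i s * pderiv k (fun z => G z s b) y) * (G y)⁻¹ b j := by
        refine Finset.sum_congr rfl fun b _ => ?_
        have := h b
        rw [Finset.sum_add_distrib] at this
        rw [eq_neg_of_add_eq_zero_left this]
    _ = _ := by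
        simp only [neg_mul, Finset.sum_mul, Finset.sum_neg_distrib]
        rw [Finset.sum_comm]

theorem IsMetricOn.smooth_sqrt_det (hG : IsMetricOn G U) (hy : y ∈ U) :
    ContDiffAt ℝ ∞ (fun z => √(G z).det) y :=
  (contDiffAt_det (hG.smooth y hy)).sqrt (hG.posDef y hy).det_pos.ne'

theorem IsMetricOn.pderiv_sqrt_det (hG : IsMetricOn G U) (hy : y ∈ U) (k : Fin 4) :
    pderiv k (fun z => √(G z).det) y
      = 1 / 2 * √(G y).det * ∑ a, ∑ i, (G y)⁻¹ a i * pderiv k (fun z => G z i a) y := by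
  have hd := (contDiffAt_det (hG.smooth y hy)).differentiableAt (n := ∞) (by simp)
  have h0 := (hG.posDef y hy).det_pos
  have h1 : pderiv k (fun z => √(G z).det) y
      = 1 / (2 * √(G y).det) * pderiv k (fun z => (G z).det) y := by
    have := (hd.hasFDerivAt.sqrt h0.ne').fderiv
    simp only [pderiv]
    rw [this]
    simp
  have h2 : ∀ a i, (G y).adjugate a i = (G y).det * (G y)⁻¹ a i := fun a i => by
    rw [Matrix.inv_def, Matrix.smul_apply, Ring.inverse_eq_inv', smul_eq_mul, mul_inv_cancel_left₀ h0.ne']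
  rw [h1, pderiv_det (hG.differentiableAt hy) k]
  simp only [h2, mul_assoc, ← Finset.mul_sum]
  rw [← mul_assoc, ← mul_assoc]
  congr 1
  have h3 := Real.sqrt_ne_zero'.2 h0
  have h4 := Real.mul_self_sqrt h0.le
  field_simp
  linarith

/-- With h the inverse metric and d the derivatives of the metric, this is the contracted identity
(1/√g) ∂_k(√g g^{ks}) = −g^{ab} Γ^s_{ab}. -/
theorem divergence_algebra {h : Fin 4 → Fin 4 → ℝ} (hh : ∀ i j, h i j = h j i)
    {d : Fin 4 → Fin 4 → Fin 4 → ℝ} (hd : ∀ k i j, d k i j = d k j i) (s : Fin 4) :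
    ∑ k, 1 / 2 * (∑ a, ∑ i, h a i * d k i a) * h k s - ∑ k, ∑ a, ∑ b, h k a * d k a b * h b s
      = -∑ a, ∑ b, h a b * (1 / 2 * ∑ l, h s l * (d a b l + d b a l - d l a b)) := by
  have e1 : ∑ a, ∑ b, h a b * ∑ l, h s l * d b a l = ∑ a, ∑ b, h a b * ∑ l, h s l * d a b l := by
    rw [Finset.sum_comm]
    simp only [fun a b => hh b a]
  have e2 : ∑ a, ∑ b, h a b * ∑ l, h s l * d a b l = ∑ k, ∑ a, ∑ b, h k a * d k a b * h b s := by
    simp only [Finset.mul_sum, hh s]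
    exact Finset.sum_congr rfl fun _ _ => Finset.sum_congr rfl fun _ _ =>
      Finset.sum_congr rfl fun _ _ => by ring
  have e3 : ∑ a, ∑ b, h a b * ∑ l, h s l * d l a b = ∑ k, (∑ a, ∑ i, h a i * d k i a) * h k s := by
    simp only [Finset.mul_sum, Finset.sum_mul]
    refine (sum_rot₃ _).trans (Finset.sum_congr rfl fun l _ => Finset.sum_congr rfl fun a _ =>
      Finset.sum_congr rfl fun b _ => ?_)
    rw [hh s l, hd l a b]
    ring
  have e4 : ∑ a, ∑ b, h a b * (1 / 2 * ∑ l, h s l * (d a b l + d b a l - d l a b))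
      = 1 / 2 * (∑ a, ∑ b, h a b * ∑ l, h s l * d a b l + ∑ a, ∑ b, h a b * ∑ l, h s l * d b a l
        - ∑ a, ∑ b, h a b * ∑ l, h s l * d l a b) := by
    simp only [← Finset.sum_add_distrib, ← Finset.sum_sub_distrib, ← mul_add, ← mul_sub]
    rw [Finset.mul_sum]
    refine Finset.sum_congr rfl fun a _ => ?_
    rw [Finset.mul_sum]
    exact Finset.sum_congr rfl fun b _ => by ring
  rw [e4, e1, e2, e3]
  simp only [mul_assoc, ← Finset.mul_sum]
  ring

theorem covDeriv_covector (G : LocalMetric) (X : TensorField 1) (y : E4) (a b : Fin 4) :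
    covDeriv G X y ![a, b] = pderiv a (fun z => X z ![b]) y
      - ∑ s, christoffel G y s a b * X y ![s] := by
  rw [covDeriv_vecCons, Fin.sum_univ_one]
  have u : ∀ s, Function.update ![b] 0 s = ![s] := fun s => by
    ext a; fin_cases a; rfl
  simp only [u, Matrix.cons_val]

theorem sum_mul_comm₃ (h : Fin 4 → Fin 4 → ℝ) (Γ : Fin 4 → Fin 4 → Fin 4 → ℝ) (X : Fin 4 → ℝ) :
    ∑ a, ∑ b, h a b * ∑ s, Γ s a b * X s = ∑ s, (∑ a, ∑ b, h a b * Γ s a b) * X s := by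
  simp only [Finset.sum_mul, Finset.mul_sum]
  exact (sum_rot₃ _).trans (Finset.sum_congr rfl fun _ _ => Finset.sum_congr rfl fun _ _ =>
    Finset.sum_congr rfl fun _ _ => by ring)

/-- The classical formula √g div X = ∂_k(√g X^k): the derivatives of √g and of the inverse metric
combine to the Christoffel correction in ∇X. -/
theorem IsMetricOn.sqrt_det_mul_div (hG : IsMetricOn G U) {X : TensorField 1} (hX : SmoothOn X U)
    (hy : y ∈ U) (I : Fin 0 → Fin 4) :
    ∑ k, pderiv k (fun z => √(G z).det * ∑ j, (G z)⁻¹ k j * X z ![j]) y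
      = √(G y).det * contr G (covDeriv G X) y I := by
  have hXd := fun j => hX.differentiableAt hy ![j]
  have hi := fun i j => hG.differentiableAt_inv hy i j
  have hs := (hG.smooth_sqrt_det hy).differentiableAt (n := ∞) (by simp)
  have hS : ∀ k, DifferentiableAt ℝ (fun z => ∑ j, (G z)⁻¹ k j * X z ![j]) y := fun k =>
    DifferentiableAt.fun_sum fun j _ => (hi k j).fun_mul (hXd j)
  have e1 : ∀ k, pderiv k (fun z => √(G z).det * ∑ j, (G z)⁻¹ k j * X z ![j]) y
      = √(G y).det * ∑ j, ((1 / 2 * (∑ a, ∑ i, (G y)⁻¹ a i * pderiv k (fun z => G z i a) y)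
        * (G y)⁻¹ k j - ∑ a, ∑ b, (G y)⁻¹ k a * pderiv k (fun z => G z a b) y * (G y)⁻¹ b j)
        * X y ![j] + (G y)⁻¹ k j * pderiv k (fun z => X z ![j]) y) := by
    intro k
    rw [pderiv_mul hs (hS k), hG.pderiv_sqrt_det hy, pderiv_sum _ fun j _ => (hi k j).fun_mul (hXd j)]
    simp only [pderiv_mul (hi _ _) (hXd _), hG.pderiv_inv hy, Finset.mul_sum,
      ← Finset.sum_add_distrib]
    refine Finset.sum_congr rfl fun j _ => ?_
    simp only [← Finset.mul_sum]
    ring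
  have e2 : contr G (covDeriv G X) y I = ∑ a, ∑ b, (G y)⁻¹ a b * pderiv a (fun z => X z ![b]) y
      - ∑ s, (∑ a, ∑ b, (G y)⁻¹ a b * christoffel G y s a b) * X y ![s] := by
    rw [Subsingleton.elim I ![]]
    simp only [contr, covDeriv_covector, mul_sub, Finset.sum_sub_distrib]
    rw [sum_mul_comm₃ (fun a b => (G y)⁻¹ a b) (christoffel G y) fun s => X y ![s]]
  have e3 := divergence_algebra (hG.inv_symm hy) (d := fun k i j => pderiv k (fun z => G z i j) y)
    (fun k i j => hG.pderiv_symm hy k i j)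
  simp only [e1, ← Finset.mul_sum]
  congr 1
  simp only [e2, Finset.sum_add_distrib]
  rw [sub_eq_neg_add]
  congr 1
  rw [Finset.sum_comm, ← Finset.sum_neg_distrib]
  refine Finset.sum_congr rfl fun s _ => ?_
  rw [← Finset.sum_mul, ← neg_mul, Finset.sum_sub_distrib]
  exact congrArg (· * X y ![s]) (e3 s)

end Divergence

/-! ### The divergence theorem in a coordinate domain -/

section LocalDivergence

theorem integral_pderiv_eq_zero {h : E4 → ℝ} (hh : ContDiff ℝ ∞ h) (hc : HasCompactSupport h)
    (k : Fin 4) : ∫ y, pderiv k h y = 0 := by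
  have hd : Continuous fun y => fderiv ℝ h y (basisVec k) :=
    (hh.continuous_fderiv (by simp)).clm_apply continuous_const
  have hc' : HasCompactSupport fun y => fderiv ℝ h y (basisVec k) :=
    hc.fderiv_apply (𝕜 := ℝ) _
  have := integral_mul_fderiv_eq_neg_fderiv_mul_of_integrable (𝕜 := ℝ) (μ := (volume : Measure E4))
    (f := fun _ => (1 : ℝ)) (g := h) (v := basisVec k) (by simp)
    (by simpa using hd.integrable_of_hasCompactSupport hc')
    (by simpa using hh.continuous.integrable_of_hasCompactSupport hc)
    (fun x _ => differentiableAt_const _) (fun x _ => hh.contDiffAt.differentiableAt (by simp))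
  simpa [pderiv] using this

/-- U and the complement of K form an open cover; on the first the extension by zero is h, on the
second it is 0. -/
theorem contDiff_indicator {U K : Set E4} (hU : IsOpen U) (hK : IsCompact K) (hKU : K ⊆ U)
    {h : E4 → ℝ} (hh : ∀ y ∈ U, ContDiffAt ℝ ∞ h y) (h0 : ∀ y ∈ U \ K, h y = 0) :
    ContDiff ℝ ∞ (U.indicator h) ∧ HasCompactSupport (U.indicator h) := by
  have hz0 : ∀ y, y ∉ K → U.indicator h y = 0 := fun y hy => by
    by_cases hyU : y ∈ U
    · rw [Set.indicator_of_mem hyU, h0 y ⟨hyU, hy⟩]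
    · rw [Set.indicator_of_notMem hyU]
  refine ⟨contDiff_iff_contDiffAt.2 fun y => ?_, HasCompactSupport.intro hK hz0⟩
  by_cases hy : y ∈ U
  · refine (hh y hy).congr_of_eventuallyEq ?_
    filter_upwards [hU.mem_nhds hy] with z hz using Set.indicator_of_mem hz h
  · refine (contDiffAt_const (c := (0 : ℝ))).congr_of_eventuallyEq ?_
    filter_upwards [hK.isClosed.isOpen_compl.mem_nhds fun h => hy (hKU h)] with z hz using hz0 z hz

/-- The pairing of a covector field with the differential of a function. -/
def gradPairing (G : LocalMetric) (X : TensorField 1) (F : E4 → ℝ) (y : E4) : ℝ :=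
  ∑ k, (∑ j, (G y)⁻¹ k j * X y ![j]) * pderiv k F y

variable {G : LocalMetric} {U K : Set E4}

/-- The divergence theorem in coordinates. -/
theorem IsMetricOn.integral_div (hG : IsMetricOn G U) {X : TensorField 1} (hX : SmoothOn X U)
    {F : E4 → ℝ} (hF : ∀ y ∈ U, ContDiffAt ℝ ∞ F y) (hK : IsCompact K) (hKU : K ⊆ U)
    (h0 : ∀ y ∈ U \ K, F y = 0) (I : Fin 0 → Fin 4) :
    ∫ y in U, √(G y).det * (F y * contr G (covDeriv G X) y I + gradPairing G X F y) = 0 := by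
  set Y : Fin 4 → E4 → ℝ := fun k z => √(G z).det * ∑ j, (G z)⁻¹ k j * X z ![j] with hYdef
  have hY : ∀ k, ∀ y ∈ U, ContDiffAt ℝ ∞ (Y k) y := fun k y hy =>
    (hG.smooth_sqrt_det hy).mul (ContDiffAt.sum fun j _ => (hG.smooth_inv hy k j).mul (hX _ y hy))
  -- F vanishes off a compact subset of U, so each product F·√g X^k extends by zero to a smooth
  -- function of compact support, whose partial derivatives integrate to zero.
  have hH := fun k => contDiff_indicator hG.isOpen hK hKU (h := fun z => F z * Y k z)
    (fun y hy => (hF y hy).mul (hY k y hy)) (fun y hy => by simp [h0 y hy])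
  have hi := fun k => integral_pderiv_eq_zero (hH k).1 (hH k).2 k
  have hint : ∀ k, Integrable (pderiv k (U.indicator fun z => F z * Y k z)) := fun k =>
    (((hH k).1.continuous_fderiv (by simp)).clm_apply
      continuous_const).integrable_of_hasCompactSupport ((hH k).2.fderiv_apply (𝕜 := ℝ) _)
  have hsum : ∫ y, ∑ k, pderiv k (U.indicator fun z => F z * Y k z) y = 0 := by
    rw [integral_finsetSum _ fun k _ => hint k]
    simp [hi]
  rw [← integral_indicator hG.isOpen.measurableSet, ← hsum]
  refine integral_congr_ae (Filter.Eventually.of_forall fun y => ?_)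
  by_cases hy : y ∈ U
  · have e : ∀ k, pderiv k (U.indicator fun z => F z * Y k z) y
        = pderiv k F y * Y k y + F y * pderiv k (Y k) y := fun k => by
      rw [pderiv_congr (h := fun z => F z * Y k z), pderiv_mul ((hF y hy).differentiableAt (by simp))
        ((hY k y hy).differentiableAt (by simp))]
      filter_upwards [hG.isOpen.mem_nhds hy] with z hz using Set.indicator_of_mem hz _
    have e2 : ∑ k, pderiv k (Y k) y = √(G y).det * contr G (covDeriv G X) y I :=
      hG.sqrt_det_mul_div hX hy I
    beta_reduce
    rw [Set.indicator_of_mem hy, Finset.sum_congr rfl fun k _ => e k, Finset.sum_add_distrib,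
      ← Finset.mul_sum, e2, gradPairing, mul_add, Finset.mul_sum, add_comm]
    congr 1
    · exact Finset.sum_congr rfl fun k _ => by ring
    · ring
  · have hyK : y ∉ K := fun h => hy (hKU h)
    rw [Set.indicator_of_notMem hy, eq_comm]
    refine Finset.sum_eq_zero fun k _ => ?_
    rw [pderiv_congr (h := fun _ => (0 : ℝ)), pderiv_const]
    filter_upwards [hK.isClosed.isOpen_compl.mem_nhds hyK] with z hz
    by_cases hzU : z ∈ U
    · rw [Set.indicator_of_mem hzU, h0 z ⟨hzU, hz⟩, zero_mul]
    · rw [Set.indicator_of_notMem hzU]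

end LocalDivergence

/-! ### The Riemannian volume measure -/

section Volume

theorem measurableSet_inter_preimage {X Y : Type*} [TopologicalSpace X] [MeasurableSpace X]
    [BorelSpace X] [TopologicalSpace Y] [MeasurableSpace Y] [BorelSpace Y] {f : X → Y} {s : Set X}
    (hf : ContinuousOn f s) (hs : MeasurableSet s) {A : Set Y} (hA : MeasurableSet A) :
    MeasurableSet (s ∩ f ⁻¹' A) := by
  have h : Measurable (s.domRestrict f) := hf.domRestrict.measurable
  have := hs.subtype_image (h hA)
  convert this using 1
  ext y
  simp [Set.domRestrict, and_comm]

variable {M : Type*} [TopologicalSpace M] [ChartedSpace E4 M] [IsManifold 𝓘(ℝ, E4) ∞ M]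
  [MeasurableSpace M] [BorelSpace M] (g : Metric M) {e e' : OpenPartialHomeomorph M E4}

omit [ChartedSpace E4 M] [IsManifold 𝓘(ℝ, E4) ∞ M] in
theorem aemeasurable_symm : AEMeasurable e.symm (volume.restrict e.target) :=
  e.continuousOn_symm.aemeasurable e.open_target.measurableSet

omit [ChartedSpace E4 M] [IsManifold 𝓘(ℝ, E4) ∞ M] in
theorem measurableSet_preimage_symm {A : Set M} (hA : MeasurableSet A) :
    MeasurableSet (e.target ∩ e.symm ⁻¹' A) :=
  measurableSet_inter_preimage e.continuousOn_symm e.open_target.measurableSet hA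

omit [MeasurableSpace M] [BorelSpace M] in
theorem continuousOn_sqrt_det (he : e ∈ atlas E4 M) :
    ContinuousOn (fun y => √(metricIn g e y).det) e.target := fun _ hy =>
  ((isMetricOn_metricIn g he).smooth_sqrt_det hy).continuousAt.continuousWithinAt

omit [MeasurableSpace M] [BorelSpace M] in
theorem aemeasurable_density (he : e ∈ atlas E4 M) :
    AEMeasurable (fun y => ENNReal.ofReal √(metricIn g e y).det) (volume.restrict e.target) :=
  ((continuousOn_sqrt_det g he).aemeasurable e.open_target.measurableSet).ennreal_ofReal

theorem chartVolume_apply {A : Set M} (hA : MeasurableSet A) :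
    chartVolume g e A
      = ∫⁻ y in e.target ∩ e.symm ⁻¹' A, ENNReal.ofReal √(metricIn g e y).det := by
  have hm := (aemeasurable_symm (e := e)).mono_ac (withDensity_absolutelyContinuous
    (volume.restrict e.target) fun y => ENNReal.ofReal √(metricIn g e y).det)
  have h1 := measurableSet_preimage_symm (e := e) hA
  rw [chartVolume, Measure.map_apply_of_aemeasurable hm hA]
  have h2 : ((volume.restrict e.target).withDensity
      fun y => ENNReal.ofReal √(metricIn g e y).det) (e.target)ᶜ = 0 :=
    withDensity_absolutelyContinuous _ _ (by
      rw [Measure.restrict_apply e.open_target.measurableSet.compl]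
      simp)
  rw [← measure_inter_add_sdiff (e.symm ⁻¹' A) e.open_target.measurableSet,
    measure_mono_null (Set.sdiff_subset_compl _ _) h2, add_zero, Set.inter_comm,
    withDensity_apply _ h1, Measure.restrict_restrict h1, Set.inter_right_comm, Set.inter_self]

theorem det_fderiv_eq_det_jac {φ : E4 → E4} {y : E4} (hφ : DifferentiableAt ℝ φ y) :
    (fderiv ℝ φ y).det = (jac φ y).det := by
  have h := LinearMap.det_toMatrix (EuclideanSpace.basisFun (Fin 4) ℝ).toBasis
    (fderiv ℝ φ y : E4 →ₗ[ℝ] E4)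
  rw [ContinuousLinearMap.det, ← h]
  congr 1
  ext c i
  have h7 := (EuclideanSpace.proj c : E4 →L[ℝ] ℝ).hasFDerivAt.comp y hφ.hasFDerivAt
  have h8 := congrArg (fun L : E4 →L[ℝ] ℝ => L (basisVec i)) h7.fderiv
  rw [LinearMap.toMatrix_apply]
  simp only [OrthonormalBasis.coe_toBasis, EuclideanSpace.basisFun_apply]
  exact h8.symm

/-- Change of variables along the transition map: its Jacobian determinant is the ratio of the two
densities √det g, up to sign. -/
theorem chartVolume_eq_of_subset (he : e ∈ atlas E4 M) (he' : e' ∈ atlas E4 M) {A : Set M}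
    (hA : MeasurableSet A) (h : A ⊆ e.source) (h' : A ⊆ e'.source) :
    chartVolume g e A = chartVolume g e' A := by
  rw [chartVolume_apply g hA, chartVolume_apply g hA]
  set S := e.target ∩ e.symm ⁻¹' A with hS
  have hSo : S ⊆ overlap e e' := fun y hy => ⟨hy.1, h' hy.2⟩
  have himage : e'.target ∩ e'.symm ⁻¹' A = (e' ∘ e.symm) '' S := by
    ext z
    constructor
    · rintro ⟨hz, hzA⟩
      exact ⟨e (e'.symm z), ⟨e.map_source (h hzA), by
        simpa [e.left_inv (h hzA)] using hzA⟩, by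
        simp [e.left_inv (h hzA), e'.right_inv hz]⟩
    · rintro ⟨y, hy, rfl⟩
      exact ⟨e'.map_source (h' hy.2), by simpa [e'.left_inv (h' hy.2)] using hy.2⟩
  have hinj : Set.InjOn (e' ∘ e.symm) S := fun y hy z hz hyz =>
    e.symm.injOn hy.1 hz.1 (e'.injOn (h' hy.2) (h' hz.2) hyz)
  have hφ := isPullback_transition g he he'
  have hd : ∀ y ∈ S, DifferentiableAt ℝ (e' ∘ e.symm) y := fun y hy => hφ.differentiableAt (hSo hy)
  rw [himage, lintegral_image_eq_lintegral_abs_det_fderiv_mul volume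
    (measurableSet_preimage_symm hA) (fun y hy => (hd y hy).hasFDerivAt.hasFDerivWithinAt) hinj]
  refine setLIntegral_congr_fun (measurableSet_preimage_symm hA) fun y hy => ?_
  beta_reduce
  rw [det_fderiv_eq_det_jac (hd y hy), ← ENNReal.ofReal_mul (abs_nonneg _), hφ.metric_eq (hSo hy),
    Matrix.det_mul, Matrix.det_mul, Matrix.det_transpose, mul_right_comm, ← pow_two,
    Real.sqrt_mul (sq_nonneg _), Real.sqrt_sq_eq_abs]

theorem chartVolume_compl_source : chartVolume g e (e.source)ᶜ = 0 := by
  rw [chartVolume_apply g e.open_source.measurableSet.compl]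
  have : e.target ∩ e.symm ⁻¹' (e.source)ᶜ = ∅ := by
    ext y
    simp only [Set.mem_inter_iff, Set.mem_preimage, Set.mem_compl_iff, Set.mem_empty_iff_false,
      iff_false, not_and, not_not]
    exact fun hy => e.map_target hy
  rw [this]
  simp

/-- On the domain of a chart the Riemannian measure is the measure of the chart. -/
theorem restrict_riemannianVolume (he : e ∈ atlas E4 M) :
    (riemannianVolume g).restrict e.source = chartVolume g e := by
  have hs := e.open_source.measurableSet
  have hle : ∀ e' ∈ atlas E4 M, chartVolume g e' ≤ riemannianVolume g := fun e' he' =>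
    le_iSup (fun e : atlas E4 M => chartVolume g e.1) ⟨e', he'⟩
  -- The right side dominates every chart measure: inside the source of e because chart measures
  -- agree on overlaps, outside trivially. Minimality of the supremum then bounds it by the right
  -- side.
  have hub : riemannianVolume g
      ≤ chartVolume g e + (riemannianVolume g).restrict (e.source)ᶜ := by
    refine iSup_le fun ⟨e', he'⟩ => Measure.le_iff.2 fun A hA => ?_
    show chartVolume g e' A ≤ _
    have hs' := e'.open_source.measurableSet
    rw [Measure.add_apply, Measure.restrict_apply hA, ← measure_inter_add_sdiff A hs]
    refine add_le_add ?_ ?_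
    · rw [← measure_inter_add_sdiff (A ∩ e.source) hs',
        measure_mono_null (Set.sdiff_subset_compl _ _) (chartVolume_compl_source g), add_zero,
        ← chartVolume_eq_of_subset g he he' ((hA.inter hs).inter hs')
          (fun x hx => hx.1.2) (fun x hx => hx.2)]
      exact measure_mono fun x hx => hx.1.1
    · exact hle e' he' _
  refine le_antisymm ?_ ?_
  · calc (riemannianVolume g).restrict e.source
        ≤ (chartVolume g e + (riemannianVolume g).restrict (e.source)ᶜ).restrict e.source :=
          Measure.restrict_mono le_rfl hub
      _ = (chartVolume g e).restrict e.source := by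
        rw [Measure.restrict_add, Measure.restrict_restrict hs]
        simp
      _ ≤ chartVolume g e := Measure.restrict_le_self
  · rw [← Measure.restrict_eq_self_of_ae_mem (μ := chartVolume g e) (s := e.source)
      (by rw [ae_iff]; exact chartVolume_compl_source g)]
    exact Measure.restrict_mono le_rfl (hle e he)

theorem setIntegral_source (he : e ∈ atlas E4 M) {f : M → ℝ} (hf : ContinuousOn f e.source) :
    ∫ q in e.source, f q ∂(riemannianVolume g)
      = ∫ y in e.target, √(metricIn g e y).det * f (e.symm y) := by
  have hm := (aemeasurable_symm (e := e)).mono_ac (withDensity_absolutelyContinuous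
    (volume.restrict e.target) fun y => ENNReal.ofReal √(metricIn g e y).det)
  have hfm : AEStronglyMeasurable f (chartVolume g e) := by
    rw [← Measure.restrict_eq_self_of_ae_mem (μ := chartVolume g e) (s := e.source)
      (by rw [ae_iff]; exact chartVolume_compl_source g)]
    exact hf.aestronglyMeasurable e.open_source.measurableSet
  rw [restrict_riemannianVolume g he]
  unfold chartVolume at hfm ⊢
  rw [integral_map hm hfm, integral_withDensity_eq_integral_toReal_smul₀ (aemeasurable_density g he)
    (by simp)]
  refine integral_congr_ae (Filter.Eventually.of_forall fun y => ?_)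
  simp [ENNReal.toReal_ofReal (Real.sqrt_nonneg _)]

/-- A point has a neighbourhood that is compact in its chart, where the continuous density is
integrable. On a compact manifold this makes continuous functions integrable. -/
theorem isLocallyFiniteMeasure_riemannianVolume :
    IsLocallyFiniteMeasure (riemannianVolume g) := by
  refine ⟨fun q => ?_⟩
  set e := chartAt E4 q with hedef
  have he : e ∈ atlas E4 M := chart_mem_atlas E4 q
  have hq : q ∈ e.source := mem_chart_source E4 q
  obtain ⟨K, hK, hqK, hKt⟩ := exists_compact_subset e.open_target (e.map_source hq)
  refine ⟨e.source ∩ e ⁻¹' K, ?_, ?_⟩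
  · refine Filter.inter_mem (e.open_source.mem_nhds hq) ?_
    exact (e.continuousAt hq).preimage_mem_nhds (mem_interior_iff_mem_nhds.1 hqK)
  · have hKm : MeasurableSet (e.source ∩ e ⁻¹' K) :=
      measurableSet_inter_preimage e.continuousOn e.open_source.measurableSet hK.measurableSet
    rw [← Set.inter_self e.source, Set.inter_assoc, Set.inter_comm,
      ← Measure.restrict_apply hKm, restrict_riemannianVolume g he, chartVolume_apply g hKm]
    have hsub : e.target ∩ e.symm ⁻¹' (e.source ∩ e ⁻¹' K) ⊆ K := by
      rintro y ⟨hy, -, hy2⟩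
      simpa [e.right_inv hy] using hy2
    refine (lintegral_mono_set hsub).trans_lt ?_
    have hi := ((continuousOn_sqrt_det g he).mono hKt).integrableOn_compact (μ := volume) hK
    exact hi.lintegral_lt_top

end Volume

/-! ### Natural scalars and the divergence theorem on a manifold -/

/-- Presents the pairing as a contraction of X ⊗ ∇F, with F a tensor of rank 0, so that it inherits
chart independence. -/
theorem gradPairing_eq (G : LocalMetric) (X : TensorField 1) (F : E4 → ℝ) (y : E4)
    (I : Fin 0 → Fin 4) : gradPairing G X F y
      = contr G (mulT ![1] ![0] X (covDeriv G fun z (_ : Fin 0 → Fin 4) => F z)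
        : TensorField 2) y I := by
  simp only [gradPairing, contr, mulT, comp_vecCons, comp_vecEmpty, covDeriv_vecCons,
    Finset.univ_eq_empty, Finset.sum_empty, sub_zero, Finset.sum_mul]
  refine Finset.sum_congr rfl fun a _ => Finset.sum_congr rfl fun b _ => ?_
  simp only [Matrix.cons_val]
  ring

section Scalars

variable {M : Type*} [TopologicalSpace M] [ChartedSpace E4 M] {e : OpenPartialHomeomorph M E4}

theorem mem_overlap (e : OpenPartialHomeomorph M E4) {q : M} (hq : q ∈ e.source) :
    chartAt E4 q q ∈ overlap (chartAt E4 q) e :=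
  ⟨mem_chart_target E4 q, by simpa using hq⟩

/-- The preferred chart at q may jump with q. A formula valid in every chart allows one chart to be
kept fixed near a given point. -/
theorem continuous_of_chart {f : M → ℝ} {F : OpenPartialHomeomorph M E4 → E4 → ℝ}
    (h : ∀ e ∈ atlas E4 M, ∀ q ∈ e.source, f q = F e (e q))
    (hF : ∀ e ∈ atlas E4 M, ∀ y ∈ e.target, ContinuousAt (F e) y) : Continuous f := by
  refine continuous_iff_continuousAt.2 fun q => ?_
  have hq := mem_chart_source E4 q
  have he := chart_mem_atlas E4 q
  have h1 : ContinuousAt (fun p => F (chartAt E4 q) (chartAt E4 q p)) q :=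
    (hF _ he _ (mem_chart_target E4 q)).comp ((chartAt E4 q).continuousAt hq)
  refine h1.congr ?_
  filter_upwards [(chartAt E4 q).open_source.mem_nhds hq] with p hp using (h _ he p hp).symm

variable [IsManifold 𝓘(ℝ, E4) ∞ M] (g : Metric M)

/-- The value at `q` of a natural scalar of the metric. -/
def scalarAt (τ : LocalMetric → TensorField 0) (q : M) : ℝ :=
  τ (metricIn g (chartAt E4 q)) (chartAt E4 q q) ![]

/-- The pairing at `q` of a natural covector field of the metric with the differential of `r`. -/
def gradAt (τ : LocalMetric → TensorField 1) (r : M → ℝ) (q : M) : ℝ :=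
  gradPairing (metricIn g (chartAt E4 q)) (τ (metricIn g (chartAt E4 q)))
    (r ∘ (chartAt E4 q).symm) (chartAt E4 q q)

theorem Natural.scalarAt_eq {τ : LocalMetric → TensorField 0} (hτ : Natural τ)
    (he : e ∈ atlas E4 M) {q : M} (hq : q ∈ e.source) :
    scalarAt g τ q = τ (metricIn g e) (e q) ![] := by
  have h := hτ.covariant (isPullback_transition g (chart_mem_atlas E4 q) he) _ (mem_overlap e hq) ![]
  rw [pullComp_nil] at h
  refine h.trans ?_
  simp

theorem contDiffAt_comp_symm {r : M → ℝ} (hr : ContMDiff 𝓘(ℝ, E4) 𝓘(ℝ, ℝ) ∞ r)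
    (he : e ∈ atlas E4 M) {y : E4} (hy : y ∈ e.target) : ContDiffAt ℝ ∞ (r ∘ e.symm) y :=
  (hr.contMDiffAt.comp y ((contMDiffOn_symm he).contMDiffAt
    (e.open_target.mem_nhds hy))).contDiffAt

theorem Natural.gradAt_eq {τ : LocalMetric → TensorField 1} (hτ : Natural τ) {r : M → ℝ}
    (hr : ContMDiff 𝓘(ℝ, E4) 𝓘(ℝ, ℝ) ∞ r) (he : e ∈ atlas E4 M) {q : M} (hq : q ∈ e.source) :
    gradAt g τ r q = gradPairing (metricIn g e) (τ (metricIn g e)) (r ∘ e.symm) (e q) := by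
  have hφ := isPullback_transition g (chart_mem_atlas E4 q) he
  have h0 : Covariant (e ∘ (chartAt E4 q).symm) (overlap (chartAt E4 q) e)
      (fun z (_ : Fin 0 → Fin 4) => (r ∘ (chartAt E4 q).symm) z)
      (fun z (_ : Fin 0 → Fin 4) => (r ∘ e.symm) z) := by
    intro z hz I
    rw [pullComp_nil]
    simp [e.left_inv hz.2]
  have hs : SmoothOn (fun z (_ : Fin 0 → Fin 4) => (r ∘ e.symm) z) e.target := fun _ z hz =>
    contDiffAt_comp_symm hr he hz
  have h1 := ((hτ.covariant hφ).mulT (n := 2) (a := ![1]) (b := ![0]) (by decide)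
    (h0.covDeriv hφ hs)).contr hφ _ (mem_overlap e hq) ![]
  rw [pullComp_nil] at h1
  rw [gradAt, gradPairing_eq _ _ _ _ ![], h1, gradPairing_eq _ _ _ _ ![]]
  simp

theorem Natural.continuous_scalarAt {τ : LocalMetric → TensorField 0} (hτ : Natural τ) :
    Continuous (scalarAt g τ) :=
  continuous_of_chart (F := fun e y => τ (metricIn g e) y ![])
    (fun _ he _ hq => hτ.scalarAt_eq g he hq)
    fun _ he y hy => (hτ.smooth (isMetricOn_metricIn g he) _ y hy).continuousAt

theorem Natural.continuous_gradAt {τ : LocalMetric → TensorField 1} (hτ : Natural τ) {r : M → ℝ}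
    (hr : ContMDiff 𝓘(ℝ, E4) 𝓘(ℝ, ℝ) ∞ r) : Continuous (gradAt g τ r) :=
  continuous_of_chart (fun _ he _ hq => hτ.gradAt_eq g hr he hq) fun _ he y hy =>
    tendsto_finsetSum _ fun k _ => ContinuousAt.mul
      (tendsto_finsetSum _ fun j _ => ContinuousAt.mul
        ((isMetricOn_metricIn g he).smooth_inv hy k j).continuousAt
        (hτ.smooth (isMetricOn_metricIn g he) _ y hy).continuousAt)
      (contDiffAt_pderiv (contDiffAt_comp_symm hr he hy) k).continuousAt

theorem gradAt_eq_zero {τ : LocalMetric → TensorField 1} {r : M → ℝ} {q : M} (c : ℝ)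
    (h : r =ᶠ[nhds q] fun _ => c) : gradAt g τ r q = 0 := by
  have hq := mem_chart_source E4 q
  rw [gradAt, gradPairing]
  refine Finset.sum_eq_zero fun k _ => ?_
  rw [pderiv_congr (h := fun _ => c), pderiv_const, mul_zero]
  have hc := (chartAt E4 q).continuousAt_symm (mem_chart_target E4 q)
  rw [ContinuousAt, (chartAt E4 q).left_inv hq] at hc
  exact hc.eventually h

theorem gradAt_sum {ι : Type*} [Fintype ι] {τ : LocalMetric → TensorField 1} {r : ι → M → ℝ}
    (hr : ∀ i, ContMDiff 𝓘(ℝ, E4) 𝓘(ℝ, ℝ) ∞ (r i)) (q : M) :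
    gradAt g τ (fun p => ∑ i, r i p) q = ∑ i, gradAt g τ (r i) q := by
  simp only [gradAt, gradPairing]
  rw [Finset.sum_comm]
  refine Finset.sum_congr rfl fun k _ => ?_
  rw [← Finset.mul_sum]
  congr 1
  exact pderiv_sum _ fun i _ => (contDiffAt_comp_symm (hr i) (chart_mem_atlas E4 q)
    (mem_chart_target E4 q)).differentiableAt (by simp)

variable [MeasurableSpace M] [BorelSpace M] [CompactSpace M]

theorem integrable_of_continuous {f : M → ℝ} (hf : Continuous f) :
    Integrable f (riemannianVolume g) := by
  have := isLocallyFiniteMeasure_riemannianVolume g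
  exact hf.integrable_of_hasCompactSupport (HasCompactSupport.of_compactSpace f)

/-- The integrand is div(rX) and vanishes off the support of r, which lies in one chart. The
integral is thus that of the divergence theorem in coordinates, with compact set the image of this
support. -/
theorem Natural.integral_mul_div {τ : LocalMetric → TensorField 1} (hτ : Natural τ) {r : M → ℝ}
    (hr : ContMDiff 𝓘(ℝ, E4) 𝓘(ℝ, ℝ) ∞ r) (he : e ∈ atlas E4 M) (hre : tsupport r ⊆ e.source) :
    ∫ q, (r q * scalarAt g (fun G => BachFlat.contr G (BachFlat.covDeriv G (τ G))) q
      + gradAt g τ r q) ∂(riemannianVolume g) = 0 := by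
  set D := scalarAt g (fun G => BachFlat.contr G (BachFlat.covDeriv G (τ G))) with hD
  have hDn := hτ.covDeriv.contr
  have hz : ∀ q, q ∉ e.source → r q * D q + gradAt g τ r q = 0 := fun q hq => by
    have hq' : q ∉ tsupport r := fun h => hq (hre h)
    rw [image_eq_zero_of_notMem_tsupport hq',
      gradAt_eq_zero g 0 (notMem_tsupport_iff_eventuallyEq.1 hq'), zero_mul, add_zero]
  rw [← setIntegral_eq_integral_of_forall_compl_eq_zero (s := e.source) fun q hq => hz q hq,
    setIntegral_source g he (f := fun q => r q * D q + gradAt g τ r q)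
      (((hr.continuous.mul (hDn.continuous_scalarAt g)).add
      (hτ.continuous_gradAt g hr)).continuousOn)]
  have hK : IsCompact (e '' tsupport r) :=
    (isClosed_tsupport r).isCompact.image_of_continuousOn (e.continuousOn.mono hre)
  have hKt : e '' tsupport r ⊆ e.target := by
    rintro _ ⟨q, hq, rfl⟩
    exact e.map_source (hre hq)
  rw [← (isMetricOn_metricIn g he).integral_div (hτ.smooth (isMetricOn_metricIn g he))
    (F := r ∘ e.symm) (fun y hy => contDiffAt_comp_symm hr he hy) hK hKt (fun y hy => by
      have : e.symm y ∉ tsupport r := fun h => hy.2 ⟨_, h, e.right_inv hy.1⟩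
      exact image_eq_zero_of_notMem_tsupport (f := r) this) ![]]
  refine setIntegral_congr_fun e.open_target.measurableSet fun y hy => ?_
  have hs := e.map_target hy
  rw [hτ.gradAt_eq g hr he hs, hD, hDn.scalarAt_eq g he hs, e.right_inv hy]
  rfl

variable [T2Space M]

/-- The divergence theorem. -/
theorem Natural.integral_div {τ : LocalMetric → TensorField 1} (hτ : Natural τ) :
    ∫ q, scalarAt g (fun G => BachFlat.contr G (BachFlat.covDeriv G (τ G))) q
      ∂(riemannianVolume g) = 0 := by
  set D := scalarAt g (fun G => BachFlat.contr G (BachFlat.covDeriv G (τ G))) with hD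
  have hDc : Continuous D := hτ.covDeriv.contr.continuous_scalarAt g
  obtain ⟨t, ht⟩ := isCompact_univ.elim_finite_subcover (fun q : M => (chartAt E4 q).source)
    (fun q => (chartAt E4 q).open_source) fun q _ => Set.mem_iUnion.2 ⟨q, mem_chart_source E4 q⟩
  obtain ⟨ρ, hρ⟩ := SmoothPartitionOfUnity.exists_isSubordinate 𝓘(ℝ, E4) isClosed_univ
    (fun i : t => (chartAt E4 i.1).source) (fun i => (chartAt E4 i.1).open_source) fun q hq => by
      obtain ⟨i, hi, hqi⟩ := Set.mem_iUnion₂.1 (ht hq)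
      exact Set.mem_iUnion.2 ⟨⟨i, hi⟩, hqi⟩
  have h1 : ∀ q, ∑ i, ρ i q = 1 := fun q => by
    rw [← finsum_eq_sum_of_fintype]
    exact ρ.sum_eq_one (Set.mem_univ q)
  have hs : ∀ i, ContMDiff 𝓘(ℝ, E4) 𝓘(ℝ, ℝ) ∞ (ρ i) := fun i => (ρ i).contMDiff
  -- The functions of the partition add up to the constant 1, so the gradient terms cancel; adding
  -- them to ρ_i div X makes each summand a divergence supported in one chart.
  have h2 : ∀ q, ∑ i, gradAt g τ (ρ i) q = 0 := fun q => by
    rw [← gradAt_sum g hs]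
    exact gradAt_eq_zero g 1 (Filter.Eventually.of_forall h1)
  have h3 : ∀ q, D q = ∑ i, (ρ i q * D q + gradAt g τ (ρ i) q) := fun q => by
    rw [Finset.sum_add_distrib, h2, ← Finset.sum_mul, h1, one_mul, add_zero]
  rw [integral_congr_ae (Filter.Eventually.of_forall h3), integral_finsetSum]
  · exact Finset.sum_eq_zero fun i _ =>
      hτ.integral_mul_div g (hs i) (chart_mem_atlas E4 i.1) (hρ i)
  · exact fun i _ => integrable_of_continuous g
      (((hs i).continuous.mul hDc).add (hτ.continuous_gradAt g (hs i)))

end Scalars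

/-! ### The integrands on the manifold -/

section Integrands

variable {M : Type*} [TopologicalSpace M] [ChartedSpace E4 M] [IsManifold 𝓘(ℝ, E4) ∞ M]
  (g : Metric M)

/-- The coordinate vectors form a basis, so a nonzero alternating 4-form does not vanish on them and
the sign is ±1. -/
theorem frameSign_mul_self (o : PointwiseOrientation M) (q : M) :
    frameSign o q * frameSign o q = 1 := by
  set e := chartAt E4 q with he
  have hy : e q ∈ e.target := mem_chart_target E4 q
  let L : E4 ≃ₗ[ℝ] E4 := ((mdifferentiable_of_mem_atlas (I := 𝓘(ℝ, E4))
    (chart_mem_atlas E4 q)).symm.mfderiv hy).toLinearEquiv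
  set b : Module.Basis (Fin 4) ℝ E4 := (EuclideanSpace.basisFun (Fin 4) ℝ).toBasis.map L with hb
  have hbe : (fun i => (coordVec e (e q) i : E4)) = b := by
    funext i
    rw [hb, Module.Basis.map_apply, OrthonormalBasis.coe_toBasis, EuclideanSpace.basisFun_apply]
    rfl
  set f : E4 [⋀^Fin 4]→ₗ[ℝ] ℝ := (o q).someVector with hf
  have hf0 : f ≠ 0 := (o q).someVector_ne_zero
  have hfb : f b ≠ 0 := by
    rw [ne_eq, AlternatingMap.map_basis_eq_zero_iff]
    exact hf0
  have : frameSign o q = Real.sign (f b) := by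
    rw [← hbe]
    rfl
  rw [this]
  rcases lt_or_gt_of_ne hfb with h | h
  · rw [Real.sign_of_neg h]; norm_num
  · rw [Real.sign_of_pos h]; norm_num

theorem scalarAt_weylPotentialT (o : PointwiseOrientation M) (q : M) :
    scalarAt g weylPotentialT q = 72 * detWeylPlus g o q + 72 * detWeylMinus g o q
      - (1 / 2) * scalarCurvature g q * normSqWeyl g q + 2 * weylEE g q :=
  (isMetricOn_metricIn g (chart_mem_atlas E4 q)).weylPotentialT_eq (mem_chart_target E4 q)
    (frameSign_mul_self o q) ![]

theorem normSqCovDerivWeyl_eq (hg : IsBachFlat g) (q : M) :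
    normSqCovDerivWeyl g q = scalarAt g weylPotentialT q
      + scalarAt g (fun G => contr G (covDeriv G (fluxT G))) q :=
  (isMetricOn_metricIn g (chart_mem_atlas E4 q)).normSqCovDerivWeylT_eq (mem_chart_target E4 q)
    (hg _ (chart_mem_atlas E4 q) _ (mem_chart_target E4 q)) ![]

end Integrands

end BachFlat

end

/-! ### The integral formula -/

open BachFlat in
theorem proposition3p3 {M : Type*} [TopologicalSpace M] [T2Space M] [CompactSpace M]
    [ChartedSpace E4 M] [IsManifold 𝓘(ℝ, E4) ∞ M] [MeasurableSpace M] [BorelSpace M]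
    (g : BachFlat.Metric M) (hg : IsBachFlat g) (o : PointwiseOrientation M) :
    Integrable (fun q => normSqCovDerivWeyl g q) (riemannianVolume g) ∧
    Integrable (fun q => 72 * detWeylPlus g o q + 72 * detWeylMinus g o q
      - (1 / 2) * scalarCurvature g q * normSqWeyl g q + 2 * weylEE g q) (riemannianVolume g) ∧
    ∫ q, normSqCovDerivWeyl g q ∂(riemannianVolume g)
      = ∫ q, (72 * detWeylPlus g o q + 72 * detWeylMinus g o q
          - (1 / 2) * scalarCurvature g q * normSqWeyl g q + 2 * weylEE g q)
          ∂(riemannianVolume g) := by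
  have h1 := integrable_of_continuous g (natural_weylPotentialT.continuous_scalarAt g)
  have h2 := integrable_of_continuous g (natural_div_fluxT.continuous_scalarAt g)
  -- Both integrands are now natural scalars, hence continuous; they differ by the divergence of the
  -- flux, which integrates to zero.
  simp only [← scalarAt_weylPotentialT, normSqCovDerivWeyl_eq g hg]
  refine ⟨h1.add h2, h1, ?_⟩
  rw [integral_add h1 h2, natural_fluxT.integral_div g, add_zero]
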